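/- Let $q$ be even (a power of $2$), let $\mathbb F_q\subset\mathbb F_{q^3}\subset\mathbb F_{q^6}$ be finite fields, write $\mathrm{Tr}$ for the trace from $\mathbb F_{q^3}$ to $\mathbb F_q$, and let $\beta\in\mathbb F_{q^6}^*$ have order $(q^3+1)(q-1)$. Regard $V=\mathbb F_{q^6}$ as a $6$-dimensional vector space over $\mathbb F_q$, and for $a\in\mathbb F_{q^6}^*$ let $\Theta(a)$ be the map $x\mapsto ax$ on $V$. A spread of $V$ is a set of $3$-dimensional $\mathbb F_q$-subspaces (components) such that every nonzero vector lies in exactly one of them. Its automorphism group $\mathrm{Aut}(\mathcal S)$ consists of the $g\in\Gamma L(V)$ with $\{g(W):W\in\mathcal S\}=\mathcal S$; its kernel is the ring of additive maps $V\to V$ that map every component into itself; spreads $\mathcal S,\mathcal S'$ are isomorphic if $\mathcal S'=\{g(W):W\in\mathcal S\}$ for some $g\in\Gamma L(V)$. A spread $\mathcal S$ of $V$ with kernel $\mathbb F_q$ (that is, whose kernel consists of the scalar maps $x\mapsto cx$, $c\in\mathbb F_q$) is of type $\mathcal C$ if $\mathrm{Aut}(\mathcal S)$ is transitive on the components and,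 after replacement of $\mathcal S$ by an isomorphic spread, $\mathrm{Aut}(\mathcal S)$ is contained in $\Gamma L(1,q^6)=\{x\mapsto a\,x^\sigma: a\in\mathbb F_{q^6}^*,\ \sigma\in\mathrm{Aut}(\mathbb F_{q^6})\}$ and meets the Singer group $\{\Theta(a):a\in\mathbb F_{q^6}^*\}$ in a group of order $(q^3+1)(q-1)$ (which is then $\langle\Theta(\beta)\rangle$). Then: 1. For $\delta\in\mathbb F_{q^6}\setminus\mathbb F_{q^3}$, the map $x\mapsto(\mathrm{Tr}(x)+\delta x)^{1+q^3}$ is a permutation of $\mathbb F_{q^3}$ if and only if $\delta^{-1}+\delta^{-q^3}\in\mathbb F_q^*$. 2. Let $L(X)\in\mathbb F_{q^3}[X]$ be a monic $q$-polynomial (only monomials $X^{q^i}$ occur) of degree at most $q^3-1$ with $L(X)\ne X$, and let $\delta\in\mathbb F_{q^6}\setminus\mathbb F_{q^3}$. The map $x\mapsto(L(x)+\delta x)^{1+q^3}$ is a permutation of $\mathbb F_{q^3}$ if and only if there are $\delta'\in\mathbb F_{q^6}\setminus\mathbb F_{q^3}$ and $u\in\mathbb F_{q^3}^*$ with $\delta'^{-1}+\delta'^{-q^3}\in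 u^{1-q}\,\mathbb F_q^*$ such that $L(x)+\delta x=u^{-1}\mathrm{Tr}(u^qx)+\delta'x$ for all $x\in\mathbb F_{q^3}$. 3. For $\delta\in\mathbb F_{q^6}\setminus\mathbb F_{q^3}$ with $\delta^{-1}+\delta^{-q^3}\in\mathbb F_q^*$, the orbit under $\langle\Theta(\beta)\rangle$ of the image $\{\mathrm{Tr}(x)+\delta x:x\in\mathbb F_{q^3}\}$ is a spread of $V$. 4. Every spread of type $\mathcal C$ with ambient space $(\mathbb F_{q^6},+)$ and kernel $\mathbb F_q$ is isomorphic to the orbit in 3 for some $\delta\in\mathbb F_{q^6}\setminus\mathbb F_{q^3}$ with $\delta^{-1}+\delta^{-q^3}\in\mathbb F_q^*$. -/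

import Mathlib

open Pointwise

namespace FlagSpread

/-- The semilinear group `ΓL(V)` of a `k`-vector space `V`: all bijections `g` of `V` that are
additive and satisfy `g (c v) = σ(c) g v` for some automorphism `σ` of the field `k`. -/
def GammaL (k V : Type*) [Field k] [AddCommGroup V] [Module k V] : Subgroup (Equiv.Perm V) where
  carrier := {g | (∀ u v, g (u + v) = g u + g v) ∧
    ∃ σ : k ≃+* k, ∀ (c : k) (v : V), g (c • v) = σ c • g v}
  mul_mem' := by
    rintro g h ⟨ga, σ, hσ⟩ ⟨ha, τ, hτ⟩
    exact ⟨fun u v => by simp [ga, ha], τ.trans σ, fun c v => by simp [hσ, hτ]⟩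
  one_mem' := ⟨fun _ _ => rfl, RingEquiv.refl k, fun _ _ => rfl⟩
  inv_mem' := by
    rintro g ⟨ga, σ, hσ⟩
    refine ⟨fun u v => ?_, σ.symm, fun c v => ?_⟩
    · apply g.injective; simp [ga]
    · apply g.injective; simp [hσ]

/-- `ΓL(V)` acts on the subspaces of `V`: `g • W` is the image `g(W)`. -/
instance instActionSubmodule (k V : Type*) [Field k] [AddCommGroup V] [Module k V] :
    MulAction (GammaL k V) (Submodule k V) where
  smul g W :=
    { carrier := (g : Equiv.Perm V) '' (W : Set V)
      add_mem' := by
        rintro _ _ ⟨u, hu, rfl⟩ ⟨v, hv, rfl⟩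
        exact ⟨u + v, W.add_mem hu hv, g.2.1 u v⟩
      zero_mem' := by
        refine ⟨0, W.zero_mem, ?_⟩
        have h := g.2.1 0 0
        simpa using h
      smul_mem' := by
        rintro c _ ⟨u, hu, rfl⟩
        obtain ⟨σ, hσ⟩ := g.2.2
        exact ⟨σ.symm c • u, W.smul_mem _ hu, by rw [hσ]; simp⟩ }
  one_smul W := by
    apply SetLike.coe_injective
    exact Set.image_id (W : Set V)
  mul_smul g h W := by
    apply SetLike.coe_injective
    exact Set.image_comp (g : Equiv.Perm V) (h : Equiv.Perm V) (W : Set V)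

/-- The action on subspaces is by taking images. -/
theorem coe_smul_submodule {k V : Type*} [Field k] [AddCommGroup V] [Module k V]
    (g : GammaL k V) (W : Submodule k V) :
    ((g • W : Submodule k V) : Set V) = (g : Equiv.Perm V) '' (W : Set V) := rfl

/-- A spread of `V`: a set of subspaces of dimension `dim V / 2` such that every nonzero vector
lies in exactly one of them. -/
def IsSpread (k : Type*) {V : Type*} [Field k] [AddCommGroup V] [Module k V]
    (S : Set (Submodule k V)) : Prop :=
  (∀ W ∈ S, 2 * Module.finrank k W = Module.finrank k V) ∧
    ∀ v : V, v ≠ 0 → ∃! W : Submodule k V, W ∈ S ∧ v ∈ W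

/-- The kernel of a spread: the ring of all additive maps `V → V` that map every component into
itself. -/
def kernel {k V : Type*} [Field k] [AddCommGroup V] [Module k V]
    (S : Set (Submodule k V)) : Subring (AddMonoid.End V) where
  carrier := {f | ∀ W ∈ S, ∀ w ∈ W, f w ∈ W}
  mul_mem' := fun hf hg W hW w hw => hf W hW _ (hg W hW w hw)
  one_mem' := fun _ _ _ hw => hw
  add_mem' := fun hf hg W hW w hw => W.add_mem (hf W hW w hw) (hg W hW w hw)
  zero_mem' := fun W _ _ _ => W.zero_mem
  neg_mem' := fun hf W hW w hw => W.neg_mem (hf W hW w hw)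

/-- The automorphism group of a spread: the elements `g` of `ΓL(V)` with
`{g(W) : W ∈ S} = S`. -/
def autGroup {k V : Type*} [Field k] [AddCommGroup V] [Module k V]
    (S : Set (Submodule k V)) : Subgroup (GammaL k V) :=
  MulAction.stabilizer (GammaL k V) S

/-- Two spreads are isomorphic if `S' = {g(W) : W ∈ S}` for some `g` in `ΓL(V)`. -/
def AreIsomorphic {k V : Type*} [Field k] [AddCommGroup V] [Module k V]
    (S S' : Set (Submodule k V)) : Prop :=
  ∃ g : GammaL k V, S' = g • S

/-- `Θ(a)` is the map `x ↦ a x` of `F`, as an element of the semilinear group of `F` over `k`.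
The range of `Θ` is the Singer group. -/
def Theta (k F : Type*) [Field k] [Field F] [Algebra k F] : Fˣ →* GammaL k F where
  toFun a := ⟨Units.mulLeft a, fun u v => mul_add _ u v, RingEquiv.refl k,
    fun c v => mul_smul_comm c (a : F) v⟩
  map_one' := by
    apply Subtype.ext; ext x; simp
  map_mul' a b := by
    apply Subtype.ext; ext x; simp [mul_assoc]

/-- A spread of type `𝒞` with ambient space `F` of dimension `2 n` over `k` and with kernel `k`:
its automorphism group is transitive on the components and, after replacement of the spread by
an isomorphic one, is contained in `ΓL(1, F)`, the group of all maps `x ↦ a σ(x)` with `a ≠ 0`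
and `σ` a field automorphism of `F` (that is, the semilinear group of `F` over itself), and it
meets the Singer group in a group of order `(q ^ n + 1) (q - 1)`, where `q = |k|`, that is, in a
group which has order `q ^ n + 1` modulo the scalars in `kˣ`. -/
structure IsTypeC {k F : Type*} [Field k] [Field F] [Algebra k F] (n : ℕ)
    (S : Set (Submodule k F)) : Prop where
  dim : Module.finrank k F = 2 * n
  isSpread : IsSpread k S
  kernel_eq : kernel S = (Module.toAddMonoidEnd k F).range
  transitive : ∀ U ∈ S, ∀ W ∈ S, ∃ g ∈ autGroup S, g • U = W
  singer : ∃ S' : Set (Submodule k F), AreIsomorphic S S' ∧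
    (autGroup S').map (GammaL k F).subtype ≤ GammaL F F ∧
    Nat.card (autGroup S' ⊓ (Theta k F).range : Subgroup (GammaL k F)) =
      (Nat.card k ^ n + 1) * (Nat.card k - 1)

/-- A `q`-polynomial: only monomials `X ^ (q ^ i)` occur. -/
def IsQPolynomial {K : Type*} [Field K] (q : ℕ) (L : Polynomial K) : Prop :=
  ∀ m ∈ L.support, ∃ i : ℕ, m = q ^ i

/-- The map `x ↦ Tr(x) + δ x` from `K` to `F`, where `Tr` is the trace from `K` to `k`. -/
noncomputable def traceMap (k : Type*) {K F : Type*} [Field k] [Field K] [Field F]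
    [Algebra k K] [Algebra K F] [Algebra k F] [IsScalarTower k K F] (δ : F) : K →ₗ[k] F where
  toFun x := algebraMap k F (Algebra.trace k K x) + δ * algebraMap K F x
  map_add' x y := by simp only [map_add]; ring
  map_smul' c x := by
    rw [map_smul]
    simp only [smul_eq_mul, map_mul, RingHom.id_apply, Algebra.smul_def,
      ← IsScalarTower.algebraMap_apply k K F]
    ring

/-- The orbit of the image of `x ↦ Tr(x) + δ x` (`x ∈ K`) under the group generated by `Θ(β)`. -/
noncomputable def traceOrbit (k K : Type*) {F : Type*} [Field k] [Field K] [Field F]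
    [Algebra k K] [Algebra K F] [Algebra k F] [IsScalarTower k K F] (β : Fˣ) (δ : F) :
    Set (Submodule k F) :=
  MulAction.orbit (Subgroup.zpowers (Theta k F β)) (LinearMap.range (traceMap (K := K) k δ))

end FlagSpread

/-! Put `Q = |K| = q ^ 3`. The map `v ↦ v ^ (1 + Q)` is the norm from `F` to the finite field `K`,
so "permutation" means "injective". The powers of `β` are the elements of `F` whose norm lies in
`kˣ`, and on `k` the norm is squaring, a bijection in characteristic two. Hence the orbit of an
image on which the norm is injective is a spread; conversely the norm is injective on every
component of a `Θ(β)`-invariant spread (`norm_injOn_component`).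

It remains to decide when the norm of `b φ(x) + c φ²(x) + δ x` is injective on `K`, where `φ` is the
Frobenius of `K` over `k`. The heart is that, unless `b = c = 0`, injectivity forces `b` and `c` to
have equal norm over `k` (`exists_ratio_of_injective`). Hilbert 90 then turns the map into a scaled
trace, and the trace itself is settled by direct computation (`trace_injective_iff`).

Let `s`, `n` be the trace and norm of `δ` over `K`. The norm in question is a `k`-quadratic map `f`,
so `f (x + z) = f x` means `s B(x, z) = f z` for the polar form `B` (`twistedPolar`, up to the
factor `s`). If `b` and `c` have different norms, the image of `B(·, z)` is the hyperplane `Tr (w y)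
= 0`, where `z = φ(w b) + φ²(w c)`. So a collision exists as soon as some `w ≠ 0` satisfies `Tr (w
f(z) / s) = 0`, a ternary cubic equation over `k`.

A plane cubic over `k` without rational points contains a line over `K` (`exists_linear_root`). If
the cubic at hand contains such a line, the irreducibility of `y² + s y + n` leads to a rational
zero after all (`exists_zero_of_plane`).

For `exists_linear_root`, suppose that the cubic has no linear factor over `K`. Frobenius acts with
order three on the normal coordinate ring over `K`. If it fixed no prime, every nonzero invariant
ideal would be a product of three conjugates, and counting pairs of invariant elements would give
too many ideals of a given index (`exists_stable_prime`). A stable prime is then reduced to one of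
degree one by pigeonhole, and that is a rational point.

For a spread of type `𝒞`, a suitable multiple of a component is the graph of a linear map `K → K`,
hence of `a x + b φ(x) + c φ²(x)`; the kernel condition excludes `b = c = 0`, and the result above
applies. -/

namespace FlagSpread

/-! ### Factorizations of elements fixed by an automorphism of order three. -/

section FreeOrbits

open UniqueFactorizationMonoid

/-- A set of representatives for the orbits of a map of order three without fixed points. -/
def orbitRep {M : Type*} (T : M → M) (P : M) : Prop :=
  WellOrderingRel P (T P) ∧ WellOrderingRel P (T (T P))

theorem not_orbitRep_map {M : Type*} {T : M → M} (hT : ∀ x, T (T (T x)) = x) {P : M}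
    (h : orbitRep T P) : ¬ orbitRep T (T P) := fun h' =>
  asymm_of WellOrderingRel h.1 (by simpa [hT] using h'.2)

theorem not_orbitRep_map_map {M : Type*} {T : M → M} (hT : ∀ x, T (T (T x)) = x) {P : M}
    (h : orbitRep T P) : ¬ orbitRep T (T (T P)) := fun h' =>
  asymm_of WellOrderingRel h.2 (by simpa [hT] using h'.1)

theorem orbitRep_or {M : Type*} {T : M → M} (hT : ∀ x, T (T (T x)) = x) {P : M} (hP : T P ≠ P) :
    orbitRep T P ∨ orbitRep T (T P) ∨ orbitRep T (T (T P)) := by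
  have h1 : T (T P) ≠ P := fun h => hP (by conv_lhs => rw [← h, hT])
  have h2 : T (T P) ≠ T P := fun h => h1 (by simpa [hT] using (congrArg T h).symm)
  simp only [orbitRep, hT]
  rcases trichotomous_of WellOrderingRel P (T P) with a | a | a
  · rcases trichotomous_of WellOrderingRel P (T (T P)) with b | b | b
    · exact Or.inl ⟨a, b⟩
    · exact absurd b.symm h1
    · exact Or.inr (Or.inr ⟨b, trans_of WellOrderingRel b a⟩)
  · exact absurd a.symm hP
  · rcases trichotomous_of WellOrderingRel (T P) (T (T P)) with b | b | b
    · exact Or.inr (Or.inl ⟨b, a⟩)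
    · exact absurd b.symm h2
    · exact Or.inr (Or.inr ⟨trans_of WellOrderingRel b a, b⟩)

variable {M : Type*} [CommMonoidWithZero M] [UniqueFactorizationMonoid M]
  [NormalizationMonoid M] [Subsingleton Mˣ]

theorem normalizedFactors_mulEquiv (T : M ≃* M) {x : M} (hx : x ≠ 0) :
    normalizedFactors (T x) = (normalizedFactors x).map T := by
  have h1 : ((normalizedFactors x).map T).prod = T x := by
    rw [← map_multiset_prod, associated_iff_eq.1 (prod_normalizedFactors hx)]
  rw [← h1]
  apply normalizedFactors_prod_of_prime
  intro p hp
  obtain ⟨a, ha, rfl⟩ := Multiset.mem_map.1 hp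
  exact (MulEquiv.prime_iff T).2 (prime_of_normalized_factor a ha)

open Classical in
/-- The prime factors that belong to the set of orbit representatives. -/
noncomputable def repFactors (T : M ≃* M) (x : M) : Multiset M :=
  (normalizedFactors x).filter (orbitRep T)

omit [Subsingleton Mˣ] in
theorem prime_of_mem_repFactors {T : M ≃* M} {x P : M} (h : P ∈ repFactors T x) : Prime P := by
  classical
  exact prime_of_normalized_factor P (Multiset.mem_of_mem_filter h)

omit [Subsingleton Mˣ] in
theorem orbitRep_of_mem_repFactors {T : M ≃* M} {x P : M} (h : P ∈ repFactors T x) :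
    orbitRep T P := by
  classical
  exact Multiset.of_mem_filter h

/-- The factor multiset of a fixed element is `T`-stable. Each orbit `P, T P, T² P` has exactly one
representative, so sorting the factors by its position gives three translates of one multiset. -/
theorem normalizedFactors_eq_of_fixed {T : M ≃* M} (hT : ∀ x, T (T (T x)) = x)
    (hfree : ∀ P : M, Prime P → T P ≠ P) {x : M} (hx : x ≠ 0) (hTx : T x = x) :
    normalizedFactors x =
      repFactors T x + ((repFactors T x).map T + ((repFactors T x).map T).map T) := by
  classical
  set f := normalizedFactors x with hf
  have hmap : f.map T = f := by rw [hf, ← normalizedFactors_mulEquiv T hx, hTx]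
  have e1 : f.filter (fun P => orbitRep T (T (T P))) = (f.filter (orbitRep T)).map T := by
    conv_lhs => rw [← hmap]
    rw [Multiset.filter_map]
    congr 1
    apply Multiset.filter_congr
    intro P _
    simp [hT]
  have e2 : f.filter (fun P => orbitRep T (T P)) =
      (f.filter (fun P => orbitRep T (T (T P)))).map T := by
    conv_lhs => rw [← hmap]
    rw [Multiset.filter_map]
    rfl
  have e3 : f = f.filter (orbitRep T) + (f.filter (fun P => orbitRep T (T (T P))) +
      f.filter (fun P => orbitRep T (T P))) := by
    conv_lhs => rw [← Multiset.filter_add_not (orbitRep T) f]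
    congr 1
    conv_lhs => rw [← Multiset.filter_add_not (fun P => orbitRep T (T (T P)))
      (f.filter (fun P => ¬ orbitRep T P)), Multiset.filter_filter, Multiset.filter_filter]
    congr 1
    · apply Multiset.filter_congr
      intro P _
      refine ⟨fun h => h.1, fun h => ⟨h, fun h' => not_orbitRep_map_map hT h' h⟩⟩
    · apply Multiset.filter_congr
      intro P hP
      have hP' := hfree P (prime_of_normalized_factor P hP)
      constructor
      · rintro ⟨h1, h2⟩
        rcases orbitRep_or hT hP' with h | h | h
        exacts [absurd h h2, h, absurd h h1]
      · exact fun h => ⟨not_orbitRep_map hT h, fun h' => not_orbitRep_map hT h' h⟩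
  conv_lhs => rw [e3, e2, e1]
  rfl

theorem eq_prod_of_fixed {T : M ≃* M} (hT : ∀ x, T (T (T x)) = x)
    (hfree : ∀ P : M, Prime P → T P ≠ P) {x : M} (hx : x ≠ 0) (hTx : T x = x) :
    x = (repFactors T x).prod * (T (repFactors T x).prod * T (T (repFactors T x).prod)) := by
  conv_lhs => rw [← associated_iff_eq.1 (prod_normalizedFactors hx),
    normalizedFactors_eq_of_fixed hT hfree hx hTx]
  simp only [Multiset.prod_add, map_multiset_prod]

/-- No translate `T P` of a representative is a representative, so the representatives among the
factors of the product are those of `x`; what is left is the translate of those of `y`. -/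
theorem repFactors_prod_mul_injective {T : M ≃* M} (hT : ∀ x, T (T (T x)) = x)
    (hfree : ∀ P : M, Prime P → T P ≠ P) {x y x' y' : M} (hx : x ≠ 0) (hTx : T x = x)
    (hy : y ≠ 0) (hTy : T y = y) (hx' : x' ≠ 0) (hTx' : T x' = x') (hy' : y' ≠ 0) (hTy' : T y' = y')
    (h : (repFactors T x).prod * T (repFactors T y).prod =
      (repFactors T x').prod * T (repFactors T y').prod) : x = x' ∧ y = y' := by
  classical
  have key : ∀ x y : M, normalizedFactors ((repFactors T x).prod * T (repFactors T y).prod) =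
      repFactors T x + (repFactors T y).map T := by
    intro x y
    rw [map_multiset_prod, ← Multiset.prod_add]
    apply normalizedFactors_prod_of_prime
    intro P hP
    rcases Multiset.mem_add.1 hP with hP | hP
    · exact prime_of_mem_repFactors hP
    · obtain ⟨a, ha, rfl⟩ := Multiset.mem_map.1 hP
      exact (MulEquiv.prime_iff T).2 (prime_of_mem_repFactors ha)
  have hfilt : ∀ x y : M, (repFactors T x + (repFactors T y).map T).filter (orbitRep T) =
      repFactors T x := by
    intro x y
    rw [Multiset.filter_add, Multiset.filter_eq_self.2 fun P hP => orbitRep_of_mem_repFactors hP,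
      Multiset.filter_eq_nil.2, add_zero]
    intro P hP
    obtain ⟨a, ha, rfl⟩ := Multiset.mem_map.1 hP
    exact not_orbitRep_map hT (orbitRep_of_mem_repFactors ha)
  have h1 := key x y
  rw [h, key x' y'] at h1
  have h2 : repFactors T x' = repFactors T x := by
    rw [← hfilt x' y', h1, hfilt x y]
  have h3 : repFactors T y' = repFactors T y := by
    rw [h2] at h1
    exact Multiset.map_injective T.injective (add_left_cancel h1)
  constructor
  · rw [eq_prod_of_fixed hT hfree hx hTx, eq_prod_of_fixed hT hfree hx' hTx', h2]
  · rw [eq_prod_of_fixed hT hfree hy hTy, eq_prod_of_fixed hT hfree hy' hTy', h3]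

end FreeOrbits

end FlagSpread

namespace FlagSpread

/-! ### Counting ideals: existence of a stable prime. -/

section StablePrime

open Submodule

/-- The index is multiplicative on coprime ideals and on prime powers of a Dedekind domain;
infinitude of `R` gives the zero ideal the index `0`. -/
theorem cardQuot_mul_of_infinite {R : Type*} [CommRing R] [IsDedekindDomain R] [Infinite R]
    (I J : Ideal R) : cardQuot (I * J) = cardQuot I * cardQuot J :=
  UniqueFactorizationMonoid.multiplicative_of_coprime cardQuot I J (cardQuot_bot _ _)
    (fun {I J} hI => by simp [Ideal.isUnit_iff.mp hI, Ideal.mul_top])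
    (fun {I} i hI =>
      have : Ideal.IsPrime I := Ideal.isPrime_of_prime hI
      cardQuot_pow_of_prime hI.ne_zero)
    fun {I J} hIJ => cardQuot_mul_of_coprime <| Ideal.isCoprime_iff_sup_eq.mpr
      (Ideal.isUnit_iff.mp
        (hIJ (Ideal.dvd_iff_le.mpr le_sup_left) (Ideal.dvd_iff_le.mpr le_sup_right)))

/-- The action of a ring automorphism on ideals. -/
def idealMulEquiv {R : Type*} [CommRing R] (σ : R ≃+* R) : Ideal R ≃* Ideal R where
  toFun I := I.map σ
  invFun I := I.map σ.symm
  left_inv I := by simpa using Ideal.comap_map_of_bijective σ σ.bijective (I := I)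
  right_inv I := by
    simpa using Ideal.map_comap_of_surjective σ σ.surjective I
  map_mul' I J := Ideal.map_mul _ I J

theorem idealMulEquiv_apply {R : Type*} [CommRing R] (σ : R ≃+* R) (I : Ideal R) :
    idealMulEquiv σ I = I.map σ := rfl

theorem cardQuot_map {R : Type*} [CommRing R] (σ : R ≃+* R) (I : Ideal R) :
    cardQuot (I.map σ) = cardQuot I := by
  rw [cardQuot_apply, cardQuot_apply]
  exact (Nat.card_congr (Ideal.quotientEquiv I (I.map σ) σ rfl).toEquiv).symm

theorem idealMulEquiv_iterate_three {R : Type*} [CommRing R] {σ : R ≃+* R}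
    (hσ : ∀ x, σ (σ (σ x)) = x) (I : Ideal R) :
    idealMulEquiv σ (idealMulEquiv σ (idealMulEquiv σ I)) = I := by
  have h : ((σ : R →+* R).comp ((σ : R →+* R).comp (σ : R →+* R))) = RingHom.id R :=
    RingHom.ext hσ
  have h' := Ideal.map_id I
  rw [← h, ← Ideal.map_map, ← Ideal.map_map] at h'
  exact h'

/-- Without stable primes, each `r ∈ W m` generates an ideal `A · T A · T² A`. The ideals `A r * T
(A s)` with `r ∈ W m` and `s ∈ W (d - m)` have index `q ^ (3 * d)`, and over all `m` their number
grows like `d * q ^ (3 * d)`. But `U` and the finiteness of the possible cofactors `J` bound the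
number of ideals of this index by a constant times `q ^ (3 * d)`. In terms of zeta functions, a
double pole is compared with a simple one. -/
theorem exists_stable_prime {R Λ : Type*} [CommRing R] [IsDedekindDomain R] [Infinite R]
    [Fintype Λ] (σ : R ≃+* R) (hσ : ∀ x, σ (σ (σ x)) = x) {q : ℕ} (hq : 2 ≤ q)
    (hJ : {J : Ideal R | J ≠ ⊥ ∧ cardQuot J ≤ q ^ 9}.Finite)
    (U : ℕ → Finset R) (hUcard : ∀ d, (U d).card ≤ q ^ (3 * d + 9))
    (hU : ∀ d (I : Ideal R), cardQuot I = q ^ (3 * d) →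
      ∃ r ∈ U d, r ≠ 0 ∧ r ∈ I ∧ cardQuot (Ideal.span {r}) ≤ q ^ (3 * d + 9))
    (W : ℕ → Finset R) (hWcard : ∀ m, 1 ≤ m → q ^ (3 * m - 1) ≤ (W m).card)
    (hWσ : ∀ m, ∀ r ∈ W m, σ r = r)
    (hWcd : ∀ m, 1 ≤ m → ∀ r ∈ W m, cardQuot (Ideal.span {r}) = q ^ (9 * m))
    (lam : ℕ → R → Λ) (hΛ : Fintype.card Λ = q ^ 3)
    (hlam : ∀ m, 1 ≤ m → ∀ r ∈ W m, ∀ s ∈ W m, Ideal.span {r} = Ideal.span {s} →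
      lam m r = lam m s → r = s) :
    ∃ P : Ideal R, P.IsPrime ∧ P ≠ ⊥ ∧ P.map σ = P := by
  classical
  by_contra hno
  push Not at hno
  set T := idealMulEquiv σ with hTdef
  have hT : ∀ I, T (T (T I)) = I := idealMulEquiv_iterate_three hσ
  have hfree : ∀ P : Ideal R, Prime P → T P ≠ P := fun P hP =>
    hno P (Ideal.isPrime_of_prime hP) hP.ne_zero
  set C := hJ.toFinset.card with hC
  -- The final comparison reads `(d - 1) * q ^ (3 * d - 2) ≤ q ^ 17 * C * q ^ (3 * d - 2)`: in the
  -- exponent 17, 11 comes from `3 * d + 9` against `3 * d - 2`, and 6 from the two labels in `Λ`.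
  -- This `d` violates it.
  set d := q ^ 17 * C + 2 with hd
  have hq0 : 0 < q := by omega
  have hW0 : ∀ m, 1 ≤ m → ∀ r ∈ W m, Ideal.span {r} ≠ (0 : Ideal R) := by
    intro m hm r hr h0
    have := hWcd m hm r hr
    rw [h0, Ideal.zero_eq_bot, cardQuot_bot] at this
    exact (pow_pos hq0 _).ne this
  have hWT : ∀ m, ∀ r ∈ W m, T (Ideal.span {r}) = Ideal.span {r} := by
    intro m r hr
    rw [hTdef, idealMulEquiv_apply, Ideal.map_span, Set.image_singleton]
    congr 2
    exact hWσ m r hr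
  set A : R → Ideal R := fun r => (repFactors T (Ideal.span {r})).prod with hA
  have hAcd : ∀ m, 1 ≤ m → ∀ r ∈ W m, cardQuot (A r) = q ^ (3 * m) := by
    intro m hm r hr
    have h := eq_prod_of_fixed hT hfree (hW0 m hm r hr) (hWT m r hr)
    have h2 := hWcd m hm r hr
    rw [h, cardQuot_mul_of_infinite, cardQuot_mul_of_infinite, hTdef, idealMulEquiv_apply,
      idealMulEquiv_apply, cardQuot_map, cardQuot_map, cardQuot_map] at h2
    have h3 : (cardQuot (A r)) ^ 3 = (q ^ (3 * m)) ^ 3 := by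
      rw [← pow_mul, show 3 * m * 3 = 9 * m by ring, ← h2]
      simp only [hA, hTdef]
      ring
    exact Nat.pow_left_injective (n := 3) (by norm_num) h3
  have hBcd : ∀ m ∈ Finset.Icc 1 (d - 1), ∀ r ∈ W m, ∀ s ∈ W (d - m),
      cardQuot (A r * T (A s)) = q ^ (3 * d) := by
    intro m hm r hr s hs
    rw [Finset.mem_Icc] at hm
    rw [cardQuot_mul_of_infinite, hTdef, idealMulEquiv_apply, cardQuot_map, hAcd m hm.1 r hr,
      hAcd (d - m) (by omega) s hs, ← pow_add]
    congr 1
    omega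
  have hex : ∀ I : Ideal R, cardQuot I = q ^ (3 * d) →
      ∃ x : R × Ideal R, x.1 ∈ U d ∧ x.2 ∈ hJ.toFinset ∧ Ideal.span {x.1} = I * x.2 := by
    intro I hI
    obtain ⟨r, hrU, hr0, hrI, hr⟩ := hU d I hI
    obtain ⟨J, hJr⟩ := Ideal.dvd_span_singleton.2 hrI
    refine ⟨(r, J), hrU, ?_, hJr⟩
    rw [Set.Finite.mem_toFinset]
    refine ⟨?_, ?_⟩
    · rintro rfl
      rw [Ideal.mul_bot, Ideal.span_singleton_eq_bot] at hJr
      exact hr0 hJr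
    · rw [hJr, cardQuot_mul_of_infinite, hI, pow_add] at hr
      exact Nat.le_of_mul_le_mul_left hr (pow_pos hq0 _)
  choose! g hgU hgJ hg using hex
  let X : Finset (Σ _ : ℕ, R × R) := (Finset.Icc 1 (d - 1)).sigma fun m => W m ×ˢ W (d - m)
  let Y : Finset ((R × Ideal R) × (Λ × Λ)) := (U d ×ˢ hJ.toFinset) ×ˢ Finset.univ
  have hcard : X.card ≤ Y.card := by
    -- Generator and cofactor determine the ideal, which determines the principal ideals of `r` and
    -- `s`; their indices give `m`, and the labels single out `r` and `s` among the generators.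
    refine Finset.card_le_card_of_injOn
      (fun x => (g (A x.2.1 * T (A x.2.2)), (lam x.1 x.2.1, lam (d - x.1) x.2.2))) ?_ ?_
    · rintro ⟨m, r, s⟩ hx
      simp only [X, Finset.coe_sigma, Set.mem_sigma_iff, Finset.mem_coe, Finset.mem_product] at hx
      have hB := hBcd m hx.1 r hx.2.1 s hx.2.2
      simp only [Y, Finset.coe_product, Set.mem_prod, Finset.mem_coe, Finset.mem_univ, and_true]
      exact ⟨hgU _ hB, hgJ _ hB⟩
    · rintro ⟨m, r, s⟩ hx ⟨m', r', s'⟩ hx' heq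
      simp only [X, Finset.coe_sigma, Set.mem_sigma_iff, Finset.mem_coe, Finset.mem_product]
        at hx hx'
      simp only [Prod.mk.injEq] at heq
      obtain ⟨h1, h2, h3⟩ := heq
      have hB := hBcd m hx.1 r hx.2.1 s hx.2.2
      have hB' := hBcd m' hx'.1 r' hx'.2.1 s' hx'.2.2
      have e1 := hg _ hB
      have e2 := hg _ hB'
      rw [h1, e2] at e1
      have hJ0 : (g (A r' * T (A s'))).2 ≠ 0 := ((Set.Finite.mem_toFinset hJ).1 (hgJ _ hB')).1
      have e3 := mul_right_cancel₀ hJ0 e1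
      have hm := Finset.mem_Icc.1 hx.1
      have hm' := Finset.mem_Icc.1 hx'.1
      obtain ⟨e4, e5⟩ := repFactors_prod_mul_injective hT hfree
        (hW0 m' hm'.1 r' hx'.2.1) (hWT m' r' hx'.2.1)
        (hW0 (d - m') (by omega) s' hx'.2.2) (hWT _ s' hx'.2.2)
        (hW0 m hm.1 r hx.2.1) (hWT m r hx.2.1) (hW0 (d - m) (by omega) s hx.2.2)
        (hWT _ s hx.2.2) e3
      have e6 : m' = m := by
        have a := hWcd m hm.1 r hx.2.1
        rw [← e4, hWcd m' hm'.1 r' hx'.2.1] at a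
        have := Nat.pow_right_injective hq a
        omega
      subst e6
      have e7 := hlam m' hm.1 r hx.2.1 r' hx'.2.1 e4.symm h2
      have e8 := hlam (d - m') (by omega) s hx.2.2 s' hx'.2.2 e5.symm h3
      rw [e7, e8]
  have hX : (d - 1) * q ^ (3 * d - 2) ≤ X.card := by
    rw [Finset.card_sigma]
    calc (d - 1) * q ^ (3 * d - 2) = ∑ _m ∈ Finset.Icc 1 (d - 1), q ^ (3 * d - 2) := by simp
      _ ≤ _ := by
        refine Finset.sum_le_sum fun m hm => ?_
        rw [Finset.mem_Icc] at hm
        rw [Finset.card_product]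
        calc q ^ (3 * d - 2) = q ^ (3 * m - 1) * q ^ (3 * (d - m) - 1) := by
              rw [← pow_add]; congr 1; omega
          _ ≤ _ := Nat.mul_le_mul (hWcard m hm.1) (hWcard (d - m) (by omega))
  have hY : Y.card ≤ q ^ (3 * d + 9) * C * (q ^ 3 * q ^ 3) := by
    simp only [Y, Finset.card_product, Finset.card_univ, Fintype.card_prod, hΛ]
    exact Nat.mul_le_mul_right _ (Nat.mul_le_mul_right _ (hUcard d))
  have hfin : (d - 1) * q ^ (3 * d - 2) ≤ (q ^ 17 * C) * q ^ (3 * d - 2) := by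
    refine (hX.trans (hcard.trans hY)).trans (le_of_eq ?_)
    have : 3 * d + 9 = (3 * d - 2) + 11 := by omega
    rw [this, pow_add]
    ring
  have := Nat.le_of_mul_le_mul_right hfin (pow_pos hq0 _)
  omega

end StablePrime

end FlagSpread

namespace FlagSpread

/-! ### The automorphism of order three on a residue field. -/

section FixedPoints

/-- By Artin, `E` has degree three over the fixed field. The non-fixed element `a` lies among the
roots of `X ^ q ^ 3 - X`, which the fixed field would contain if its degree exponent `e` were
divisible by 3. -/
theorem card_fixedPoints_of_order_three {E : Type*} [Field E] [Finite E] (σ : E ≃+* E)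
    (hσ : ∀ x, σ (σ (σ x)) = x) {a : E} (ha : σ a ≠ a) {q e : ℕ} (hE : Nat.card E = (q ^ 3) ^ e)
    (haq : a ^ q ^ 3 = a) : Nat.card {y : E // σ y = y} = q ^ e ∧ ¬ 3 ∣ e := by
  classical
  have hord : orderOf σ = 3 := by
    have : Fact (Nat.Prime 3) := ⟨by norm_num⟩
    refine orderOf_eq_prime ?_ ?_
    · ext x
      simp [pow_succ, RingAut.mul_apply, hσ]
    · rintro rfl
      exact ha rfl
  let G := Subgroup.zpowers σ
  have : Finite G := Nat.finite_of_card_ne_zero (by rw [Nat.card_zpowers, hord]; norm_num)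
  have : Fintype G := Fintype.ofFinite _
  have hG : Fintype.card G = 3 := by
    rw [← Nat.card_eq_fintype_card, Nat.card_zpowers, hord]
  have hfin := FixedPoints.finrank_eq_card G E
  have hmem : ∀ y : E, y ∈ FixedPoints.subfield G E ↔ σ y = y := by
    intro y
    constructor
    · intro h
      exact h ⟨σ, Subgroup.mem_zpowers σ⟩
    · rintro h ⟨g, hg⟩
      obtain ⟨n, rfl⟩ := Subgroup.mem_zpowers_iff.1 hg
      have h1 : σ ∈ MulAction.stabilizer (RingAut E) y := h
      exact (Subgroup.zpow_mem _ h1 n : σ ^ n ∈ MulAction.stabilizer (RingAut E) y)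
  have hcard : Nat.card E = Nat.card (FixedPoints.subfield G E) ^ 3 := by
    rw [Module.natCard_eq_pow_finrank (K := FixedPoints.subfield G E) (V := E), hfin, hG]
  have hE0 : Nat.card (FixedPoints.subfield G E) = q ^ e := by
    rw [hE, ← pow_mul, mul_comm, pow_mul] at hcard
    exact (Nat.pow_left_injective (n := 3) (by norm_num) hcard).symm
  have hE0' : Nat.card {y : E // σ y = y} = q ^ e := by
    rw [← hE0]
    exact Nat.card_congr (Equiv.subtypeEquivRight fun y => (hmem y).symm)
  refine ⟨hE0', ?_⟩
  -- For `e = 3 j` the fixed field exhausts the roots of `X ^ q ^ (3 j) - X`, yet `a` is a further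
  -- root.
  rintro ⟨j, rfl⟩
  have hpow : ∀ j : ℕ, a ^ (q ^ (3 * j)) = a := by
    intro j
    induction j with
    | zero => simp
    | succ j ih => rw [mul_add, mul_one, pow_add, pow_mul, ih, haq]
  have hq1 : 1 < q ^ (3 * j) := by
    rw [← hE0]
    exact Finite.one_lt_card
  have : Fintype (FixedPoints.subfield G E) := Fintype.ofFinite _
  let S : Finset E := (Polynomial.X ^ (q ^ (3 * j)) - Polynomial.X : Polynomial E).roots.toFinset
  have hne := FiniteField.X_pow_card_sub_X_ne_zero E hq1
  have hS : S.card ≤ q ^ (3 * j) :=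
    (Multiset.toFinset_card_le _).trans ((Polynomial.card_roots' _).trans
      (FiniteField.X_pow_card_sub_X_natDegree_eq E hq1).le)
  have hmemS : ∀ y : E, y ^ (q ^ (3 * j)) = y → y ∈ S := by
    intro y hy
    rw [Multiset.mem_toFinset, Polynomial.mem_roots hne]
    simp [hy]
  let S0 : Finset E := Finset.univ.map ⟨fun y : FixedPoints.subfield G E => (y : E),
    Subtype.val_injective⟩
  have hS0 : S0.card = q ^ (3 * j) := by
    rw [Finset.card_map, Finset.card_univ, ← Nat.card_eq_fintype_card, hE0]
  have hS0S : insert a S0 ⊆ S := by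
    intro y hy
    rcases Finset.mem_insert.1 hy with rfl | hy
    · exact hmemS _ (hpow j)
    · obtain ⟨y0, -, rfl⟩ := Finset.mem_map.1 hy
      refine hmemS _ ?_
      have := FiniteField.pow_card y0
      rw [← Nat.card_eq_fintype_card, hE0] at this
      exact congrArg Subtype.val this
  have haS0 : a ∉ S0 := by
    intro h
    obtain ⟨y0, -, rfl⟩ := Finset.mem_map.1 h
    exact ha ((hmem _).1 y0.2)
  have := Finset.card_le_card hS0S
  rw [Finset.card_insert_of_notMem haS0, hS0] at this
  omega

end FixedPoints

/-! ### From a stable prime to a stable prime of degree one. -/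

section StableDescent

open Submodule

variable {R K : Type*} [CommRing R] [IsDedekindDomain R] [Field K] [Algebra K R]

/-- The automorphism of the residue field of a stable ideal. -/
def quotientAut (σ : R ≃+* R) {P : Ideal R} (hP : P.map σ = P) : (R ⧸ P) ≃+* (R ⧸ P) :=
  Ideal.quotientEquiv P P σ hP.symm

omit [IsDedekindDomain R] in
theorem quotientAut_mk (σ : R ≃+* R) {P : Ideal R} (hP : P.map σ = P) (x : R) :
    quotientAut σ hP (Ideal.Quotient.mk P x) = Ideal.Quotient.mk P (σ x) := rfl

/-- The automorphism of the residue field is nontrivial because it already moves the image of `a ∈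
K`. -/
theorem stable_prime_fixed {σ : R ≃+* R} (hσ : ∀ x, σ (σ (σ x)) = x) {q : ℕ}
    (hK : Nat.card K = q ^ 3) (hσK : ∀ c : K, σ (algebraMap K R c) = algebraMap K R (c ^ q))
    {a : K} (ha : a ^ q ≠ a) (hfin : ∀ I : Ideal R, I ≠ ⊥ → Finite (R ⧸ I))
    {P : Ideal R} (hP : P.IsPrime) (hP0 : P ≠ ⊥) (hPσ : P.map σ = P) :
    ∃ e, 1 ≤ e ∧ cardQuot P = (q ^ 3) ^ e ∧ ¬ 3 ∣ e ∧
      Nat.card {y : R ⧸ P // quotientAut σ hPσ y = y} = q ^ e := by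
  have := hfin P hP0
  have hmax : P.IsMaximal := hP.isMaximal hP0
  let : Field (R ⧸ P) := Ideal.Quotient.field P
  have : Fintype (R ⧸ P) := Fintype.ofFinite _
  have hinj : Function.Injective (algebraMap K (R ⧸ P)) := (algebraMap K (R ⧸ P)).injective
  have : Finite K := Finite.of_injective _ hinj
  have : Fintype K := Fintype.ofFinite _
  have hcard := Module.natCard_eq_pow_finrank (K := K) (V := R ⧸ P)
  rw [hK] at hcard
  have h := card_fixedPoints_of_order_three (quotientAut σ hPσ) (a := algebraMap K (R ⧸ P) a)
    (q := q) (e := Module.finrank K (R ⧸ P)) ?_ ?_ hcard ?_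
  · exact ⟨_, Module.finrank_pos, hcard, h.2, h.1⟩
  · intro x
    obtain ⟨x, rfl⟩ := Ideal.Quotient.mk_surjective x
    simp [quotientAut_mk, hσ]
  · have e1 : ∀ c : K, algebraMap K (R ⧸ P) c = Ideal.Quotient.mk P (algebraMap K R c) :=
      fun c => rfl
    rw [e1, quotientAut_mk, hσK, ← e1]
    exact fun h => ha (hinj h)
  · rw [← map_pow, ← hK, Nat.card_eq_fintype_card, FiniteField.pow_card]

theorem cardQuot_prime {q : ℕ} (hK : Nat.card K = q ^ 3)
    (hfin : ∀ I : Ideal R, I ≠ ⊥ → Finite (R ⧸ I)) {P : Ideal R} (hP : P.IsPrime) (hP0 : P ≠ ⊥) :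
    ∃ e, 1 ≤ e ∧ cardQuot P = (q ^ 3) ^ e := by
  have := hfin P hP0
  have hmax : P.IsMaximal := hP.isMaximal hP0
  let : Field (R ⧸ P) := Ideal.Quotient.field P
  have : Finite K := Finite.of_injective _ (algebraMap K (R ⧸ P)).injective
  have hcard := Module.natCard_eq_pow_finrank (K := K) (V := R ⧸ P)
  rw [hK] at hcard
  exact ⟨_, Module.finrank_pos, hcard⟩

/-- A stable ideal of degree one or two is contained in a stable prime. -/
theorem exists_stable_prime_of_small [Infinite R] {σ : R ≃+* R} (hσ : ∀ x, σ (σ (σ x)) = x) {q : ℕ}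
    (hq : 2 ≤ q) (hK : Nat.card K = q ^ 3) (hfin : ∀ I : Ideal R, I ≠ ⊥ → Finite (R ⧸ I))
    {J : Ideal R} (hJσ : J.map σ = J) {f : ℕ} (hf1 : 1 ≤ f) (hf2 : f ≤ 2)
    (hJ : cardQuot J = (q ^ 3) ^ f) :
    ∃ P : Ideal R, P.IsPrime ∧ P ≠ ⊥ ∧ P.map σ = P ∧ ∃ e, 1 ≤ e ∧ e ≤ f ∧
      cardQuot P = (q ^ 3) ^ e := by
  have hQ : 2 ≤ q ^ 3 := hq.trans (Nat.le_self_pow (by norm_num) q)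
  have hJ0 : J ≠ ⊥ := by
    rintro rfl
    rw [cardQuot_bot] at hJ
    exact (pow_pos (by omega) f).ne hJ
  have hJ1 : J ≠ ⊤ := by
    rintro rfl
    rw [cardQuot_top] at hJ
    have := Nat.one_lt_pow (by omega : f ≠ 0) (by omega : 1 < q ^ 3)
    omega
  obtain ⟨P, hPmax, hJP⟩ := Ideal.exists_le_maximal J hJ1
  have hP0 : P ≠ ⊥ := fun h => hJ0 (le_bot_iff.1 (h ▸ hJP))
  have hPp := hPmax.isPrime
  obtain ⟨e, he1, he⟩ := cardQuot_prime hK hfin hPp hP0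
  obtain ⟨J1, hJ1'⟩ := Ideal.dvd_iff_le.2 hJP
  have hle : e ≤ f := by
    rw [hJ1', cardQuot_mul_of_infinite, he] at hJ
    exact (Nat.pow_dvd_pow_iff_le_right (by omega)).1 (Dvd.intro _ hJ)
  refine ⟨P, hPp, hP0, ?_, e, he1, hle, he⟩
  -- If `P` were moved, `P`, `T P` and `T² P` would all divide `J`. Degree at most two leaves only
  -- `J = P * T P`, and then `T² P` is one of these two factors, which makes `P` stable.
  by_contra hne
  set T := idealMulEquiv σ with hTdef
  have hT : ∀ I, T (T (T I)) = I := idealMulEquiv_iterate_three hσ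
  have hPprime : Prime P := Ideal.prime_of_isPrime hP0 hPp
  have hTP : Prime (T P) := (MulEquiv.prime_iff T).2 hPprime
  have hTTP : Prime (T (T P)) := (MulEquiv.prime_iff T).2 hTP
  have hdvd : T P ∣ J := by
    have : T P ∣ T J := map_dvd T ⟨J1, hJ1'⟩
    rwa [hTdef, idealMulEquiv_apply, idealMulEquiv_apply, hJσ] at this
  have hdvd2 : T (T P) ∣ J := by
    have : T (T P) ∣ T J := map_dvd T hdvd
    rwa [hTdef, idealMulEquiv_apply, idealMulEquiv_apply, idealMulEquiv_apply, hJσ] at this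
  have hne1 : ¬ T P ∣ P := fun h => hne (associated_iff_eq.1
    ((Prime.dvd_prime_iff_associated hTP hPprime).1 h))
  obtain ⟨J2, hJ2⟩ := (hTP.dvd_or_dvd (hJ1' ▸ hdvd)).resolve_left hne1
  have hcd : (q ^ 3) ^ (e + e) * cardQuot J2 = (q ^ 3) ^ f := by
    rw [← hJ, hJ1', hJ2, cardQuot_mul_of_infinite, cardQuot_mul_of_infinite, he, hTdef,
      idealMulEquiv_apply, cardQuot_map, he]
    ring
  have hle2 := (Nat.pow_dvd_pow_iff_le_right (by omega)).1 (Dvd.intro _ hcd)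
  have hef : f = e + e := by omega
  have hJ2' : J2 = ⊤ := by
    rw [hef] at hcd
    exact cardQuot_eq_one_iff.1 (Nat.eq_of_mul_eq_mul_left (pow_pos (by omega) _)
      (hcd.trans (mul_one _).symm))
  rw [hJ2', Ideal.mul_top] at hJ2
  rw [hJ1', hJ2] at hdvd2
  rcases hTTP.dvd_or_dvd hdvd2 with h | h
  · have h' := associated_iff_eq.1 ((Prime.dvd_prime_iff_associated hTTP hPprime).1 h)
    have h2 := hT P
    rw [h'] at h2
    exact hne h2
  · exact hne (T.injective (associated_iff_eq.1 ((Prime.dvd_prime_iff_associated hTTP hTP).1 h)))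

/-- Reduction of the degree of a stable prime with the help of fixed elements of small degree. -/
theorem stable_prime_descent [Infinite R] {σ : R ≃+* R} (hσ : ∀ x, σ (σ (σ x)) = x) {q : ℕ}
    (hq : 2 ≤ q) (hK : Nat.card K = q ^ 3)
    (hσK : ∀ c : K, σ (algebraMap K R c) = algebraMap K R (c ^ q)) {a : K} (ha : a ^ q ≠ a)
    (hfin : ∀ I : Ideal R, I ≠ ⊥ → Finite (R ⧸ I))
    (V : ℕ → Finset R) (hVσ : ∀ m, ∀ r ∈ V m, σ r = r)
    (hVcard : ∀ m, 1 ≤ m → (V m).card = q ^ (3 * m))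
    (hVcd : ∀ m, 1 ≤ m → ∀ r ∈ V m, ∀ s ∈ V m, r ≠ s →
      ∃ m' ≤ m, cardQuot (Ideal.span {r - s}) = q ^ (9 * m'))
    {P : Ideal R} (hP : P.IsPrime) (hP0 : P ≠ ⊥) (hPσ : P.map σ = P) :
    ∃ e, 1 ≤ e ∧ ¬ 3 ∣ e ∧ cardQuot P = (q ^ 3) ^ e ∧ ∃ P' : Ideal R, P'.IsPrime ∧ P' ≠ ⊥ ∧
      P'.map σ = P' ∧ ∃ e', 1 ≤ e' ∧ e' ≤ 3 * (e / 3 + 1) - e ∧ cardQuot P' = (q ^ 3) ^ e' := by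
  classical
  obtain ⟨e, he1, he, he3, hfix⟩ := stable_prime_fixed hσ hK hσK ha hfin hP hP0 hPσ
  refine ⟨e, he1, he3, he, ?_⟩
  have := hfin P hP0
  -- The least `m` with `3 m > e`. As `3 ∤ e`, the excess `3 m - e` is 1 or 2; two elements of `V m`
  -- agree modulo `P`, and the cofactor of `P` in their difference has this degree.
  set m := e / 3 + 1 with hm
  have hlt : e < 3 * m := by omega
  let S : Finset (R ⧸ P) := (Set.toFinite {y : R ⧸ P | quotientAut σ hPσ y = y}).toFinset
  have hS : S.card = q ^ e := by
    rw [← hfix, ← Nat.card_eq_card_finite_toFinset]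
    rfl
  obtain ⟨r, hr, s, hs, hrs, hmk⟩ := Finset.exists_ne_map_eq_of_card_lt_of_maps_to
    (s := V m) (t := S) (f := Ideal.Quotient.mk P)
    (by rw [hS, hVcard m (by omega)]; exact Nat.pow_lt_pow_right (by omega) hlt)
    (by
      intro r hr
      simp only [S, Set.Finite.coe_toFinset, Set.mem_ofPred_eq, quotientAut_mk, hVσ m r hr])
  have hmem : r - s ∈ P := Ideal.Quotient.eq.1 hmk
  obtain ⟨J, hJ⟩ := Ideal.dvd_span_singleton.2 hmem
  obtain ⟨m', hm', hcd⟩ := hVcd m (by omega) r hr s hs hrs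
  have hJσ : J.map σ = J := by
    have h1 : (Ideal.span {r - s}).map σ = Ideal.span {r - s} := by
      rw [Ideal.map_span, Set.image_singleton]
      congr 2
      rw [map_sub, hVσ m r hr, hVσ m s hs]
    rw [hJ, Ideal.map_mul, hPσ] at h1
    exact mul_left_cancel₀ hP0 h1
  have hQ : 2 ≤ q ^ 3 := hq.trans (Nat.le_self_pow (by norm_num) q)
  have hcd' : (q ^ 3) ^ e * cardQuot J = (q ^ 3) ^ (3 * m') := by
    rw [← he, ← cardQuot_mul_of_infinite, ← hJ, hcd, ← pow_mul]
    congr 1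
    ring
  have hle := (Nat.pow_dvd_pow_iff_le_right (by omega)).1 (Dvd.intro _ hcd')
  -- A smaller `m'` would satisfy `e ≤ 3 m' ≤ e`, against `3 ∤ e`.
  have hmm : m' = m := by omega
  have hJcd : cardQuot J = (q ^ 3) ^ (3 * m - e) := by
    apply Nat.eq_of_mul_eq_mul_left (pow_pos (by omega : 0 < q ^ 3) e)
    rw [hcd', ← pow_add, hmm]
    congr 1
    omega
  exact exists_stable_prime_of_small hσ hq hK hfin hJσ (by omega) (by omega) hJcd

/-- One descent leads to degree at most 2. A second descent from degree 2 leads to degree at most `3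
- 2 = 1`. -/
theorem exists_stable_prime_degree_one [Infinite R] {σ : R ≃+* R} (hσ : ∀ x, σ (σ (σ x)) = x)
    {q : ℕ} (hq : 2 ≤ q) (hK : Nat.card K = q ^ 3)
    (hσK : ∀ c : K, σ (algebraMap K R c) = algebraMap K R (c ^ q)) {a : K} (ha : a ^ q ≠ a)
    (hfin : ∀ I : Ideal R, I ≠ ⊥ → Finite (R ⧸ I))
    (V : ℕ → Finset R) (hVσ : ∀ m, ∀ r ∈ V m, σ r = r)
    (hVcard : ∀ m, 1 ≤ m → (V m).card = q ^ (3 * m))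
    (hVcd : ∀ m, 1 ≤ m → ∀ r ∈ V m, ∀ s ∈ V m, r ≠ s →
      ∃ m' ≤ m, cardQuot (Ideal.span {r - s}) = q ^ (9 * m'))
    {P : Ideal R} (hP : P.IsPrime) (hP0 : P ≠ ⊥) (hPσ : P.map σ = P) :
    ∃ P : Ideal R, ∃ hPσ : P.map σ = P, P.IsPrime ∧ P ≠ ⊥ ∧
      Nat.card {y : R ⧸ P // quotientAut σ hPσ y = y} = q := by
  obtain ⟨e, he1, he3, he, P', hP', hP0', hPσ', e', he1', hle', he'⟩ :=
    stable_prime_descent hσ hq hK hσK ha hfin V hVσ hVcard hVcd hP hP0 hPσ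
  obtain ⟨f, hf1, hf3, hf, P'', hP'', hP0'', hPσ'', f', hf1', hfle', hf'⟩ :=
    stable_prime_descent hσ hq hK hσK ha hfin V hVσ hVcard hVcd hP' hP0' hPσ'
  have hQ : 2 ≤ q ^ 3 := hq.trans (Nat.le_self_pow (by norm_num) q)
  have e1 : f = e' := Nat.pow_right_injective hQ (hf.symm.trans he')
  have key : ∀ (P : Ideal R) (_ : P.IsPrime) (_ : P ≠ ⊥) (_ : P.map σ = P)
      (_ : cardQuot P = (q ^ 3) ^ 1), ∃ P : Ideal R, ∃ hPσ : P.map σ = P, P.IsPrime ∧ P ≠ ⊥ ∧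
      Nat.card {y : R ⧸ P // quotientAut σ hPσ y = y} = q := by
    intro P hP hP0 hPσ h
    obtain ⟨g, -, hg, -, hfix⟩ := stable_prime_fixed hσ hK hσK ha hfin hP hP0 hPσ
    have : g = 1 := Nat.pow_right_injective hQ (hg.symm.trans h)
    subst this
    exact ⟨P, hPσ, hP, hP0, hfix.trans (pow_one q)⟩
  have : e' = 1 ∨ e' = 2 := by omega
  rcases this with h | h
  · exact key P' hP' hP0' hPσ' (h ▸ he')
  · have : f' = 1 := by omega
    exact key P'' hP'' hP0'' hPσ'' (this ▸ hf')

end StableDescent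

end FlagSpread

namespace FlagSpread

/-! ### The norm form of a cubic extension and its leading coefficient. -/

section CubicNorm

open Polynomial

/-- The norm of `a + b z + c z ^ 2`, where `z ^ 3 + A z ^ 2 + B z + C = 0`. -/
def cubicNorm {S : Type*} [CommRing S] (A B C a b c : S) : S :=
  a ^ 3 - a ^ 2 * b * A + a ^ 2 * c * (A ^ 2 - 2 * B) + a * b ^ 2 * B + a * b * c * (3 * C - A * B)
    + a * c ^ 2 * (B ^ 2 - 2 * A * C) - b ^ 3 * C + b ^ 2 * c * (A * C) - b * c ^ 2 * (B * C)
    + c ^ 3 * C ^ 2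

theorem map_cubicNorm {S T : Type*} [CommRing S] [CommRing T] (f : S →+* T) (A B C a b c : S) :
    f (cubicNorm A B C a b c) = cubicNorm (f A) (f B) (f C) (f a) (f b) (f c) := by
  simp [cubicNorm, map_ofNat]

theorem norm_eq_cubicNorm {S L : Type*} [CommRing S] [CommRing L] [Algebra S L]
    (b : Module.Basis (Fin 3) S L) {z : L} (h0 : b 0 = 1) (h1 : b 1 = z) (h2 : b 2 = z ^ 2)
    {A B C : S} (hz : z ^ 3 + algebraMap S L A * z ^ 2 + algebraMap S L B * z + algebraMap S L C = 0)
    (u v w : S) :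
    Algebra.norm S (algebraMap S L u + algebraMap S L v * z + algebraMap S L w * z ^ 2) =
      cubicNorm A B C u v w := by
  rw [Algebra.norm_eq_matrix_det b]
  -- The columns are the products with `1`, `z`, `z ^ 2`, reduced by the cubic equation.
  let M : Matrix (Fin 3) (Fin 3) S :=
      !![u, -(w * C), -((v - w * A) * C);
        v, u - w * B, -(w * C) - (v - w * A) * B;
        w, v - w * A, u - w * B - (v - w * A) * A]
  have hM : Algebra.leftMulMatrix b
      (algebraMap S L u + algebraMap S L v * z + algebraMap S L w * z ^ 2) = M := by
    ext i j
    rw [Algebra.leftMulMatrix_eq_repr_mul]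
    refine Eq.trans ?_ (congrFun (b.repr_sum_self fun i => M i j) i)
    congr 2
    fin_cases j
    · simp [M, Fin.sum_univ_three, h0, h1, h2, Algebra.smul_def]
    · simp [M, Fin.sum_univ_three, h0, h1, h2, Algebra.smul_def]
      linear_combination algebraMap S L w * hz
    · simp [M, Fin.sum_univ_three, h0, h1, h2, Algebra.smul_def]
      linear_combination (algebraMap S L v + algebraMap S L w * z - algebraMap S L w * algebraMap S L A) * hz
  rw [hM, Matrix.det_fin_three]
  simp [M, cubicNorm]
  ring

/-- The polynomial `p` has degree at most `n`, and the coefficient of `X ^ n` is `l`. -/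
def HasTop {S : Type*} [CommRing S] (p : S[X]) (n : ℕ) (l : S) : Prop :=
  p.natDegree ≤ n ∧ p.coeff n = l

section HasTop

variable {S : Type*} [CommRing S] {p p' : S[X]} {n n' : ℕ} {l l' : S}

theorem HasTop.mul (h : HasTop p n l) (h' : HasTop p' n' l') :
    HasTop (p * p') (n + n') (l * l') :=
  ⟨natDegree_mul_le_of_le h.1 h'.1, by rw [coeff_mul_add_eq_of_natDegree_le h.1 h'.1, h.2, h'.2]⟩

theorem HasTop.add (h : HasTop p n l) (h' : HasTop p' n l') : HasTop (p + p') n (l + l') :=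
  ⟨natDegree_add_le_of_degree_le h.1 h'.1, by rw [coeff_add, h.2, h'.2]⟩

theorem HasTop.sub (h : HasTop p n l) (h' : HasTop p' n l') : HasTop (p - p') n (l - l') :=
  ⟨natDegree_sub_le_of_le h.1 h'.1 |>.trans (max_self n).le, by rw [coeff_sub, h.2, h'.2]⟩

theorem HasTop.pow (h : HasTop p n l) (j : ℕ) : HasTop (p ^ j) (j * n) (l ^ j) :=
  ⟨natDegree_pow_le_of_le j h.1, by rw [coeff_pow_of_natDegree_le h.1, h.2]⟩

theorem hasTop_ofNat (j : ℕ) [j.AtLeastTwo] : HasTop (OfNat.ofNat j : S[X]) 0 (OfNat.ofNat j) :=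
  ⟨by simp, by simp⟩

theorem HasTop.cast (h : HasTop p n l) (hn : n = n') : HasTop p n' l := hn ▸ h

theorem HasTop.cubicNorm {m : ℕ} {A B C a b c : S[X]} {A1 B2 C3 α β γ : S} (hA : HasTop A 1 A1)
    (hB : HasTop B 2 B2) (hC : HasTop C 3 C3) (ha : HasTop a (m + 2) α) (hb : HasTop b (m + 1) β)
    (hc : HasTop c m γ) :
    HasTop (cubicNorm A B C a b c) (3 * (m + 2)) (FlagSpread.cubicNorm A1 B2 C3 α β γ) := by
  have t2 : HasTop (2 : S[X]) 0 2 := hasTop_ofNat 2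
  have t3 : HasTop (3 : S[X]) 0 3 := hasTop_ofNat 3
  refine HasTop.add (HasTop.sub (HasTop.add (HasTop.sub (HasTop.add (HasTop.add (HasTop.add
    (HasTop.add (HasTop.sub ?_ ?_) ?_) ?_) ?_) ?_) ?_) ?_) ?_) ?_
  · exact ha.pow 3
  · exact (((ha.pow 2).mul hb).mul hA).cast (by ring)
  · exact (((ha.pow 2).mul hc).mul (((hA.pow 2)).sub ((t2.mul hB).cast (by norm_num)))).cast
      (by ring)
  · exact ((ha.mul (hb.pow 2)).mul hB).cast (by ring)
  · exact (((ha.mul hb).mul hc).mul (((t3.mul hC).cast (by norm_num)).sub (hA.mul hB))).cast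
      (by ring)
  · exact ((ha.mul (hc.pow 2)).mul ((hB.pow 2).sub (((t2.mul hA).mul hC).cast (by norm_num)))).cast
      (by ring)
  · exact ((hb.pow 3).mul hC).cast (by ring)
  · exact (((hb.pow 2).mul hc).mul (hA.mul hC)).cast (by ring)
  · exact ((hb.mul (hc.pow 2)).mul (hB.mul hC)).cast (by ring)
  · exact ((hc.pow 3).mul (hC.pow 2)).cast (by ring)

end HasTop

end CubicNorm

end FlagSpread

namespace FlagSpread

/-! ### The normalization of a cubic extension ring and its automorphism. -/

section CubicRing

universe u

open Polynomial nonZeroDivisors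

/-- The monic cubic polynomial with the given coefficients. -/
noncomputable def cubicPoly {S : Type*} [CommRing S] (a b c : S) : S[X] :=
  X ^ 3 + C a * X ^ 2 + C b * X + C c

section cubicPoly

variable {S : Type*} [CommRing S] (a b c : S)

theorem natDegree_cubicPoly [Nontrivial S] : (cubicPoly a b c).natDegree = 3 := by
  rw [cubicPoly]
  compute_degree!

theorem monic_cubicPoly : (cubicPoly a b c).Monic := by
  nontriviality S
  rw [cubicPoly]
  monicity!

theorem eval₂_cubicPoly {T : Type*} [CommRing T] (f : S →+* T) (x : T) :
    (cubicPoly a b c).eval₂ f x = x ^ 3 + f a * x ^ 2 + f b * x + f c := by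
  simp [cubicPoly]

end cubicPoly

theorem irreducible_cubicPoly {E : Type*} [Field E] {a b c : E}
    (h : ∀ x : E, x ^ 3 + a * x ^ 2 + b * x + c ≠ 0) : Irreducible (cubicPoly a b c) := by
  rw [(monic_cubicPoly a b c).irreducible_iff_roots_eq_zero_of_degree_le_three
    (by rw [natDegree_cubicPoly]; norm_num) (natDegree_cubicPoly a b c).le]
  rw [Multiset.eq_zero_iff_forall_notMem]
  intro x hx
  rw [mem_roots (monic_cubicPoly a b c).ne_zero, IsRoot.def, eval, eval₂_cubicPoly] at hx
  exact h x hx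

/-- The basis `1, z, z ^ 2` of the extension by a root `z` of a cubic polynomial. -/
theorem exists_basis_adjoinRoot {E : Type*} [Field E] (a b c : E) :
    ∃ v : Module.Basis (Fin 3) E (AdjoinRoot (cubicPoly a b c)),
      v 0 = 1 ∧ v 1 = AdjoinRoot.root _ ∧ v 2 = AdjoinRoot.root _ ^ 2 := by
  let pb := AdjoinRoot.powerBasis (monic_cubicPoly a b c).ne_zero
  have hd : pb.dim = 3 := by
    rw [AdjoinRoot.powerBasis_dim, natDegree_cubicPoly]
  refine ⟨pb.basis.reindex (finCongr hd), ?_, ?_, ?_⟩ <;>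
  simp [pb]

theorem root_cubicPoly {E : Type*} [Field E] (a b c : E) :
    (AdjoinRoot.root (cubicPoly a b c)) ^ 3 + algebraMap E _ a * AdjoinRoot.root _ ^ 2 +
      algebraMap E _ b * AdjoinRoot.root _ + algebraMap E _ c = 0 := by
  have := AdjoinRoot.eval₂_root (cubicPoly a b c)
  rwa [eval₂_cubicPoly] at this

/-- The norm form of an irreducible cubic is anisotropic. -/
theorem cubicNorm_ne_zero {E : Type*} [Field E] {a b c : E}
    (h : ∀ x : E, x ^ 3 + a * x ^ 2 + b * x + c ≠ 0) {u v w : E} (huvw : ¬ (u = 0 ∧ v = 0 ∧ w = 0)) :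
    cubicNorm a b c u v w ≠ 0 := by
  have : Fact (Irreducible (cubicPoly a b c)) := ⟨irreducible_cubicPoly h⟩
  obtain ⟨B, h0, h1, h2⟩ := exists_basis_adjoinRoot a b c
  have : FiniteDimensional E (AdjoinRoot (cubicPoly a b c)) := Module.Finite.of_basis B
  rw [← norm_eq_cubicNorm B h0 h1 h2 (root_cubicPoly a b c) u v w, Algebra.norm_ne_zero_iff]
  intro h
  have hli := Fintype.linearIndependent_iff.1 B.linearIndependent ![u, v, w] (by
    simpa [Fin.sum_univ_three, h0, h1, h2, Algebra.smul_def] using h)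
  exact huvw ⟨hli 0, hli 1, hli 2⟩

/-- The coefficient of `X ^ 2` in the derivative is 3, so the derivative is nonzero, which suffices
for an irreducible polynomial. -/
theorem isSeparable_adjoinRoot {E : Type*} [Field E] {a b c : E} (h3 : (3 : E) ≠ 0)
    [hirr : Fact (Irreducible (cubicPoly a b c))] :
    Algebra.IsSeparable E (AdjoinRoot (cubicPoly a b c)) := by
  have hsep : (cubicPoly a b c).Separable := by
    rw [separable_iff_derivative_ne_zero hirr.out]
    intro h
    have hd : derivative (cubicPoly a b c) = C 3 * X ^ 2 + C (a * 2) * X + C b := by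
      have e2 : (C 2 : E[X]) = 2 := map_ofNat C 2
      have e3 : (C 3 : E[X]) = 3 := map_ofNat C 3
      simp only [cubicPoly, derivative_add, derivative_C_mul, derivative_X_pow, derivative_X,
        derivative_C, C_mul, e2, e3, Nat.cast_ofNat]
      ring
    rw [hd] at h
    have := congrArg (fun p => coeff p 2) h
    simp only [coeff_add, coeff_C_mul, coeff_X_pow, coeff_X, coeff_C, coeff_zero] at this
    apply h3
    simpa using this
  have hroot : IsSeparable E (AdjoinRoot.root (cubicPoly a b c)) := by
    rw [IsSeparable, AdjoinRoot.minpoly_root (monic_cubicPoly a b c).ne_zero,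
      (monic_cubicPoly a b c).leadingCoeff]
    simpa using hsep
  rw [← IntermediateField.isSeparable_adjoin_simple_iff_isSeparable,
    IntermediateField.adjoin_root_eq_top] at hroot
  exact AlgEquiv.Algebra.isSeparable IntermediateField.topEquiv

/-- The normalization of the ring `S[z]`, where `z` is a root of a cubic polynomial, together with
an automorphism that extends an automorphism of `S` of order three. -/
theorem exists_cubic_ring {S : Type u} [CommRing S] [IsDomain S] [IsPrincipalIdealRing S]
    (τ : S ≃+* S) (hτ : ∀ x, τ (τ (τ x)) = x) {a b c : S} (ha : τ a = a) (hb : τ b = b)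
    (hc : τ c = c) (h3 : (3 : S) ≠ 0) (hroot : ∀ x : S, x ^ 3 + a * x ^ 2 + b * x + c ≠ 0) :
    ∃ (R : Type u) (_ : CommRing R) (_ : IsDedekindDomain R) (_ : Algebra S R) (_ : Module.Free S R)
      (_ : Module.Finite S R) (z : R) (σ : R ≃+* R),
      (z ^ 3 + algebraMap S R a * z ^ 2 + algebraMap S R b * z + algebraMap S R c = 0) ∧
      (∀ s, σ (algebraMap S R s) = algebraMap S R (τ s)) ∧ σ z = z ∧ (∀ x, σ (σ (σ x)) = x) ∧
      (∀ u v w : S, Algebra.norm S (algebraMap S R u + algebraMap S R v * z +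
        algebraMap S R w * z ^ 2) = cubicNorm a b c u v w) ∧
      ∀ u v w : S, algebraMap S R u + algebraMap S R v * z + algebraMap S R w * z ^ 2 = 0 →
        u = 0 ∧ v = 0 ∧ w = 0 := by
  let E := FractionRing S
  let i := algebraMap S E
  have hi : Function.Injective i := IsFractionRing.injective S E
  let g := cubicPoly (i a) (i b) (i c)
  have hg : g = (cubicPoly a b c).map i := by simp [g, cubicPoly]
  have hirr : Fact (Irreducible (cubicPoly (i a) (i b) (i c))) := by
    refine ⟨irreducible_cubicPoly fun x hx => ?_⟩
    have hint : IsIntegral S x := ⟨cubicPoly a b c, monic_cubicPoly a b c, by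
      rw [eval₂_cubicPoly]; exact hx⟩
    obtain ⟨y, rfl⟩ := IsIntegrallyClosed.isIntegral_iff.1 hint
    apply hroot y
    apply hi
    simpa [i] using hx
  let L := AdjoinRoot g
  have hsep : Algebra.IsSeparable E L := isSeparable_adjoinRoot (by
    intro h
    exact h3 (hi (by rw [map_ofNat, map_zero]; exact h)))
  obtain ⟨B, h0, h1, h2⟩ := exists_basis_adjoinRoot (i a) (i b) (i c)
  have hfd : FiniteDimensional E L := Module.Finite.of_basis B
  let R := integralClosure S L
  have hD : IsDedekindDomain R := integralClosure.isDedekindDomain S E L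
  have htf : Module.IsTorsionFree S L := Module.isTorsionFree_iff_algebraMap_injective.2
    ((algebraMap E L).injective.comp hi)
  have hfree : Module.Free S R := IsIntegralClosure.module_free S E L R
  have hfin : Module.Finite S R := IsIntegralClosure.finite S E L R
  have hloc : IsLocalization (Algebra.algebraMapSubmonoid R S⁰) L :=
    IsIntegralClosure.isLocalization S E L R
  have hrt := root_cubicPoly (i a) (i b) (i c)
  have hz : IsIntegral S (AdjoinRoot.root g) := ⟨cubicPoly a b c, monic_cubicPoly a b c, by
    rw [eval₂_cubicPoly]; exact hrt⟩
  let z : R := ⟨AdjoinRoot.root g, hz⟩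
  have hzL : algebraMap R L z = AdjoinRoot.root g := rfl
  have hinjR : Function.Injective (algebraMap R L) := Subtype.val_injective
  have hSL : ∀ s, algebraMap R L (algebraMap S R s) = algebraMap E L (i s) := fun s => rfl
  let τE : E ≃+* E := IsFractionRing.ringEquivOfRingEquiv τ
  have hτE : ∀ s, τE (i s) = i (τ s) := IsFractionRing.ringEquivOfRingEquiv_algebraMap τ
  have hlift : eval₂ ((algebraMap E L).comp (τE : E →+* E)) (AdjoinRoot.root g) g = 0 := by
    simp only [g]
    rw [eval₂_cubicPoly]
    simp only [RingHom.comp_apply, RingHom.coe_coe, hτE, ha, hb, hc]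
    exact hrt
  -- The cubic has `τ`-fixed coefficients, so `τ` extends to `L` with `z ↦ z`. The extension
  -- preserves integrality over `S` and therefore restricts to the integral closure.
  let σL : L →+* L := AdjoinRoot.lift ((algebraMap E L).comp (τE : E →+* E)) (AdjoinRoot.root g) hlift
  have hσroot : σL (AdjoinRoot.root g) = AdjoinRoot.root g := AdjoinRoot.lift_root hlift
  have hσE : ∀ x : E, σL (algebraMap E L x) = algebraMap E L (τE x) := fun x =>
    AdjoinRoot.lift_of hlift
  have hσ3 : σL.comp (σL.comp σL) = RingHom.id L := by
    apply AdjoinRoot.ringHom_ext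
    · apply IsFractionRing.ringHom_ext (A := S)
      intro s
      have : ∀ x : E, AdjoinRoot.of g x = algebraMap E L x := fun x => rfl
      simp only [RingHom.comp_apply, this]
      change σL (σL (σL (algebraMap E L (i s)))) = algebraMap E L (i s)
      rw [hσE, hσE, hσE, hτE, hτE, hτE, hτ]
    · change σL (σL (σL (AdjoinRoot.root g))) = AdjoinRoot.root g
      rw [hσroot, hσroot, hσroot]
  have hσ3' : ∀ x, σL (σL (σL x)) = x := fun x => RingHom.congr_fun hσ3 x
  have hσint : ∀ x : L, IsIntegral S x → IsIntegral S (σL x) := by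
    intro x hx
    refine IsIntegral.map_of_comp_eq (τ : S →+* S) σL ?_ hx
    ext s
    change algebraMap E L (i (τ s)) = σL (algebraMap E L (i s))
    rw [hσE, hτE]
  let σR : R →+* R := (σL.comp (algebraMap R L)).codRestrict R.toSubring fun x => hσint _ x.2
  have hσR : ∀ x : R, ((σR x : R) : L) = σL x := fun x => rfl
  have hσR3 : ∀ x, σR (σR (σR x)) = x := fun x => Subtype.ext (by rw [hσR, hσR, hσR, hσ3'])
  let σ : R ≃+* R := RingEquiv.ofRingHom σR (σR.comp σR) (RingHom.ext hσR3) (RingHom.ext hσR3)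
  refine ⟨R, inferInstance, hD, inferInstance, hfree, hfin, z, σ, ?_, ?_, ?_, hσR3, ?_, ?_⟩
  · apply hinjR
    rw [map_add, map_add, map_add, map_mul, map_mul, map_pow, map_pow, map_zero]
    exact hrt
  · intro s
    apply Subtype.ext
    change σL (algebraMap E L (i s)) = algebraMap E L (i (τ s))
    rw [hσE, hτE]
  · exact Subtype.ext hσroot
  · intro u v w
    apply hi
    rw [map_cubicNorm, ← norm_eq_cubicNorm B h0 h1 h2 hrt]
    have := Algebra.norm_localization S (Rₘ := E) (Sₘ := L) S⁰ (algebraMap S R u +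
      algebraMap S R v * z + algebraMap S R w * z ^ 2)
    rw [← this]
    rfl
  · intro u v w h
    have h' := congrArg (algebraMap R L) h
    have hli := Fintype.linearIndependent_iff.1 B.linearIndependent ![i u, i v, i w] (by
      rw [map_add, map_add, map_mul, map_mul, map_pow, map_zero, hSL, hSL, hSL, hzL] at h'
      rw [Fin.sum_univ_three, h0, h1, h2, Algebra.smul_def, Algebra.smul_def, Algebra.smul_def,
        mul_one]
      exact h')
    exact ⟨hi ((hli 0).trans (map_zero i).symm), hi ((hli 1).trans (map_zero i).symm),
      hi ((hli 2).trans (map_zero i).symm)⟩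

end CubicRing

end FlagSpread

namespace FlagSpread

/-! ### Counting elements and ideals by weighted degree. -/

section CountingPolynomials

open Polynomial Submodule

theorem finite_degreeLT (K : Type*) [Field K] [Finite K] (n : ℕ) :
    (degreeLT K n : Set K[X]).Finite :=
  have : Finite (degreeLT K n) := Finite.of_equiv _ (degreeLTEquiv K n).symm.toEquiv
  Set.toFinite _

/-- The polynomials of degree less than `n` over a finite field. -/
noncomputable def polyLT (K : Type*) [Field K] [Finite K] (n : ℕ) : Finset K[X] :=
  (finite_degreeLT K n).toFinset

theorem mem_polyLT {K : Type*} [Field K] [Finite K] {n : ℕ} {p : K[X]} :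
    p ∈ polyLT K n ↔ p ∈ degreeLT K n := by
  simp [polyLT]

theorem card_polyLT (K : Type*) [Field K] [Finite K] (n : ℕ) :
    (polyLT K n).card = Nat.card K ^ n := by
  rw [polyLT, ← Set.ncard_eq_toFinset_card _ (finite_degreeLT K n), ← Nat.card_coe_set_eq]
  exact (Nat.card_congr (degreeLTEquiv K n).toEquiv).trans (by rw [Nat.card_fun, Nat.card_fin])

/-- The triples `(a, b, c)` of polynomials with `deg a ≤ m`, `deg b < m` and `deg c < m - 1`. -/
noncomputable def triples (K : Type*) [Field K] [Finite K] (m : ℕ) : Finset (K[X] × K[X] × K[X]) :=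
  polyLT K (m + 1) ×ˢ polyLT K m ×ˢ polyLT K (m - 1)

theorem mem_triples {K : Type*} [Field K] [Finite K] {m : ℕ} {p : K[X] × K[X] × K[X]} :
    p ∈ triples K m ↔
      p.1 ∈ degreeLT K (m + 1) ∧ p.2.1 ∈ degreeLT K m ∧ p.2.2 ∈ degreeLT K (m - 1) := by
  simp [triples, mem_polyLT]

theorem sub_mem_triples {K : Type*} [Field K] [Finite K] {m : ℕ} {p p' : K[X] × K[X] × K[X]}
    (hp : p ∈ triples K m) (hp' : p' ∈ triples K m) : p - p' ∈ triples K m := by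
  rw [mem_triples] at *
  exact ⟨sub_mem hp.1 hp'.1, sub_mem hp.2.1 hp'.2.1, sub_mem hp.2.2 hp'.2.2⟩

theorem card_triples (K : Type*) [Field K] [Finite K] {m : ℕ} (hm : 1 ≤ m) :
    (triples K m).card = Nat.card K ^ (3 * m) := by
  rw [triples, Finset.card_product, Finset.card_product, card_polyLT, card_polyLT, card_polyLT,
    ← pow_add, ← pow_add]
  congr 1
  omega

/-- The coefficients of weighted degree `m` of a triple of polynomials. -/
noncomputable def topCoeff {K : Type*} [Field K] (m : ℕ) (p : K[X] × K[X] × K[X]) : K × K × K :=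
  (p.1.coeff m, (X * p.2.1).coeff m, (X ^ 2 * p.2.2).coeff m)

theorem topCoeff_sub {K : Type*} [Field K] (m : ℕ) (p p' : K[X] × K[X] × K[X]) :
    topCoeff m (p - p') = topCoeff m p - topCoeff m p' := by
  simp [topCoeff, mul_sub]

theorem natDegree_X_pow_mul_le {K : Type*} [Field K] {p : K[X]} {n m j : ℕ} (hp : p ∈ degreeLT K n)
    (h : n + j ≤ m + 1) : (X ^ j * p).natDegree ≤ m := by
  rw [mem_degreeLT] at hp
  by_cases h0 : p = 0
  · simp [h0]
  · rw [degree_eq_natDegree h0] at hp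
    have : p.natDegree < n := by exact_mod_cast hp
    rw [natDegree_X_pow_mul _ h0]
    omega

theorem mem_degreeLT_of_coeff_eq_zero {K : Type*} [Field K] {p : K[X]} {n : ℕ}
    (hp : p ∈ degreeLT K (n + 1)) (h : p.coeff n = 0) : p ∈ degreeLT K n := by
  rw [mem_degreeLT, degree_lt_iff_coeff_zero] at *
  intro j hj
  rcases hj.eq_or_lt with rfl | hj
  · exact h
  · exact hp j hj

theorem hasTop_cubicNorm_triple {K : Type*} [Field K] [Finite K] {A B C : K[X]}
    (hA : A.natDegree ≤ 1) (hB : B.natDegree ≤ 2) (hC : C.natDegree ≤ 3) {m : ℕ}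
    {p : K[X] × K[X] × K[X]} (hp : p ∈ triples K m) :
    HasTop (cubicNorm A B C p.1 p.2.1 p.2.2) (3 * m)
      (cubicNorm (A.coeff 1) (B.coeff 2) (C.coeff 3) (topCoeff m p).1 (topCoeff m p).2.1
        (topCoeff m p).2.2) := by
  rw [mem_triples] at hp
  -- Multiplying the triple by `X ^ 2` makes the weights `m`, `m - 1`, `m - 2` of its entries
  -- nonnegative for every `m`; the norm is multiplied by `X ^ 6`, which is removed at the end.
  have h1 : HasTop (X ^ 2 * p.1) (m + 2) (topCoeff m p).1 :=
    ⟨natDegree_X_pow_mul_le hp.1 (by omega), by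
      rw [coeff_X_pow_mul]; rfl⟩
  have h2 : HasTop (X ^ 2 * p.2.1) (m + 1) (topCoeff m p).2.1 :=
    ⟨natDegree_X_pow_mul_le hp.2.1 (by omega), by
      rw [pow_two, mul_assoc, coeff_X_mul]; rfl⟩
  have h3 : HasTop (X ^ 2 * p.2.2) m (topCoeff m p).2.2 := by
    refine ⟨?_, rfl⟩
    rcases Nat.eq_zero_or_pos m with rfl | hm
    · have : p.2.2 = 0 := by
        have := hp.2.2
        rw [mem_degreeLT] at this
        simpa [degree_lt_iff_coeff_zero, Polynomial.ext_iff] using this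
      simp [this]
    · exact natDegree_X_pow_mul_le hp.2.2 (by omega)
  have key := HasTop.cubicNorm (A := A) (B := B) (C := C) ⟨hA, rfl⟩ ⟨hB, rfl⟩ ⟨hC, rfl⟩ h1 h2 h3
  have hX : cubicNorm A B C (X ^ 2 * p.1) (X ^ 2 * p.2.1) (X ^ 2 * p.2.2) =
      X ^ 6 * cubicNorm A B C p.1 p.2.1 p.2.2 := by
    simp only [cubicNorm]; ring
  rw [hX] at key
  refine ⟨?_, ?_⟩
  · by_cases h0 : cubicNorm A B C p.1 p.2.1 p.2.2 = 0
    · simp [h0]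
    · have := key.1
      rw [natDegree_X_pow_mul _ h0] at this
      omega
  · have := key.2
    rwa [show 3 * (m + 2) = 3 * m + 6 by ring, coeff_X_pow_mul] at this

/-- A nonzero triple has an exact weighted degree. -/
theorem exists_topCoeff_ne_zero {K : Type*} [Field K] [Finite K] {m : ℕ}
    {p : K[X] × K[X] × K[X]} (hp : p ∈ triples K m) (hp0 : p ≠ 0) :
    ∃ m' ≤ m, p ∈ triples K m' ∧ topCoeff m' p ≠ 0 := by
  induction m with
  | zero =>
    refine ⟨0, le_rfl, hp, fun h => hp0 ?_⟩
    rw [mem_triples] at hp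
    have e0 : ∀ r : K[X], r ∈ degreeLT K 0 → r = 0 := fun r hr => by
      rw [mem_degreeLT] at hr
      simpa [degree_lt_iff_coeff_zero, Polynomial.ext_iff] using hr
    have h1 := e0 _ (mem_degreeLT_of_coeff_eq_zero hp.1 (congrArg Prod.fst h))
    exact Prod.ext h1 (Prod.ext (e0 _ hp.2.1) (e0 _ hp.2.2))
  | succ m ih =>
    by_cases h : topCoeff (m + 1) p = 0
    · rw [mem_triples] at hp
      have h1 := mem_degreeLT_of_coeff_eq_zero hp.1 (congrArg Prod.fst h)
      have h2 : p.2.1.coeff m = 0 := by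
        have : (X * p.2.1).coeff (m + 1) = 0 := congrArg (fun t => t.2.1) h
        rwa [coeff_X_mul] at this
      have h3 : p.2.2 ∈ degreeLT K (m - 1) := by
        rcases Nat.eq_zero_or_pos m with rfl | hm
        · exact hp.2.2
        · obtain ⟨j, rfl⟩ : ∃ j, m = j + 1 := ⟨m - 1, by omega⟩
          refine mem_degreeLT_of_coeff_eq_zero hp.2.2 ?_
          have : (X ^ 2 * p.2.2).coeff (j + 2) = 0 := congrArg (fun t => t.2.2) h
          rwa [coeff_X_pow_mul] at this
      obtain ⟨m', hm', h'⟩ := ih (mem_triples.2 ⟨h1, mem_degreeLT_of_coeff_eq_zero hp.2.1 h2, h3⟩)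
      exact ⟨m', by omega, h'⟩
    · exact ⟨m + 1, le_rfl, hp, h⟩

/-- Triples of exact weighted degree `m` have norm of degree `3 m`, if the norm form at infinity is
anisotropic. -/
theorem natDegree_cubicNorm_triple {K : Type*} [Field K] [Finite K] {A B C : K[X]}
    (hA : A.natDegree ≤ 1) (hB : B.natDegree ≤ 2) (hC : C.natDegree ≤ 3)
    (h : ∀ z : K, z ^ 3 + A.coeff 1 * z ^ 2 + B.coeff 2 * z + C.coeff 3 ≠ 0) {m : ℕ}
    {p : K[X] × K[X] × K[X]} (hp : p ∈ triples K m) (hp0 : topCoeff m p ≠ 0) :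
    (cubicNorm A B C p.1 p.2.1 p.2.2).natDegree = 3 * m := by
  have key := hasTop_cubicNorm_triple hA hB hC hp
  refine le_antisymm key.1 (le_natDegree_of_ne_zero ?_)
  rw [key.2]
  refine cubicNorm_ne_zero h fun h0 => hp0 ?_
  exact Prod.ext h0.1 (Prod.ext h0.2.1 h0.2.2)

/-- The triples `(a, b, c)` of polynomials as in `triples` with `a` monic of degree `m`. -/
noncomputable def monicTriples (K : Type*) [Field K] [Finite K] (m : ℕ) :
    Finset (K[X] × K[X] × K[X]) :=
  ((polyLT K m).map ⟨fun a : K[X] => X ^ m + a, add_right_injective _⟩) ×ˢ polyLT K m ×ˢ polyLT K (m - 1)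

theorem card_monicTriples (K : Type*) [Field K] [Finite K] {m : ℕ} (hm : 1 ≤ m) :
    (monicTriples K m).card = Nat.card K ^ (3 * m - 1) := by
  rw [monicTriples, Finset.card_product, Finset.card_product, Finset.card_map, card_polyLT,
    card_polyLT, ← pow_add, ← pow_add]
  congr 1
  omega

theorem monicTriples_subset {K : Type*} [Field K] [Finite K] {m : ℕ} {p : K[X] × K[X] × K[X]}
    (hp : p ∈ monicTriples K m) : p ∈ triples K m ∧ (topCoeff m p).1 = 1 := by
  simp only [monicTriples, Finset.mem_product, Finset.mem_map, mem_polyLT,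
    Function.Embedding.coeFn_mk] at hp
  obtain ⟨⟨a, ha, hap⟩, hb, hc⟩ := hp
  refine ⟨mem_triples.2 ⟨?_, hb, hc⟩, ?_⟩
  · rw [← hap]
    refine add_mem ?_ (degreeLT_mono (Nat.le_succ m) ha)
    rw [mem_degreeLT, degree_X_pow]
    exact_mod_cast Nat.lt_succ_self m
  · rw [mem_degreeLT, degree_lt_iff_coeff_zero] at ha
    simp [topCoeff, ← hap, ha m le_rfl]

section Quotients

variable {K R : Type*} [Field K] [CommRing R] [IsDedekindDomain R] [Algebra K[X] R]
  [Module.Free K[X] R] [Module.Finite K[X] R] [Algebra K R] [IsScalarTower K K[X] R]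

theorem finiteDimensional_quotient {I : Ideal R} (hI : I ≠ ⊥) : FiniteDimensional K (R ⧸ I) := by
  let b := Module.Free.chooseBasis K[X] R
  exact Module.Finite.equiv ((Ideal.quotientEquivPiSpan I b hI).restrictScalars K).symm

theorem finite_quotient [Finite K] {I : Ideal R} (hI : I ≠ ⊥) : Finite (R ⧸ I) := by
  have : FiniteDimensional K (R ⧸ I) := finiteDimensional_quotient hI
  exact Module.finite_of_finite K

theorem cardQuot_span_singleton [Finite K] {r : R} (hr : r ≠ 0) :
    cardQuot (Ideal.span {r}) = Nat.card K ^ (Algebra.norm K[X] r).natDegree := by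
  have hI : Ideal.span {r} ≠ ⊥ := by simpa using hr
  have : FiniteDimensional K (R ⧸ Ideal.span {r}) := finiteDimensional_quotient hI
  rw [← finrank_quotient_span_eq_natDegree_norm (F := K) (Module.Free.chooseBasis K[X] R) hr]
  rw [cardQuot_apply]
  exact Module.natCard_eq_pow_finrank

/-- The pigeonhole principle modulo an ideal. -/
theorem exists_sub_mem_of_cardQuot_lt {R T : Type*} [CommRing R] {I : Ideal R} [Finite (R ⧸ I)]
    (s : Finset T) (f : T → R) (hs : cardQuot I < s.card) :
    ∃ x ∈ s, ∃ y ∈ s, x ≠ y ∧ f x - f y ∈ I := by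
  have := Fintype.ofFinite (R ⧸ I)
  have hs' : (Finset.univ : Finset (R ⧸ I)).card < s.card := by
    rw [Finset.card_univ, ← Nat.card_eq_fintype_card]
    exact hs
  obtain ⟨x, hx, y, hy, hxy, h⟩ := Finset.exists_ne_map_eq_of_card_lt_of_maps_to hs'
    (f := fun x => Ideal.Quotient.mk I (f x)) (fun _ _ => Finset.mem_coe.2 (Finset.mem_univ _))
  exact ⟨x, hx, y, hy, hxy, (Ideal.Quotient.mk_eq_mk_iff_sub_mem _ _).1 h⟩

/-- By pigeonhole such an ideal contains a nonzero polynomial of degree less than `n`. It therefore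
divides the product `M` of all of these, which has finitely many divisors. -/
theorem finite_setOf_cardQuot_lt [Finite K] [FaithfulSMul K[X] R] (n : ℕ) :
    {J : Ideal R | J ≠ ⊥ ∧ cardQuot J < Nat.card K ^ n}.Finite := by
  classical
  let M : K[X] := ∏ p ∈ (polyLT K n).erase 0, p
  have hM : M ≠ 0 := Finset.prod_ne_zero_iff.2 fun p hp => (Finset.mem_erase.1 hp).1
  have hinj := FaithfulSMul.algebraMap_injective K[X] R
  have hMI : Ideal.span {algebraMap K[X] R M} ≠ 0 := by
    rw [Ideal.zero_eq_bot, Ne, Ideal.span_singleton_eq_bot]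
    exact (map_ne_zero_iff _ hinj).2 hM
  have : Finite {J : Ideal R // J ∣ Ideal.span {algebraMap K[X] R M}} :=
    @Finite.of_fintype _ (UniqueFactorizationMonoid.fintypeSubtypeDvd _ hMI)
  have hf : Set.Finite {J : Ideal R | J ∣ Ideal.span {algebraMap K[X] R M}} := this
  refine hf.subset ?_
  rintro J ⟨hJ0, hJ⟩
  have := finite_quotient (K := K) hJ0
  obtain ⟨x, hx, y, hy, hxy, h⟩ := exists_sub_mem_of_cardQuot_lt (polyLT K n) (algebraMap K[X] R)
    (hJ.trans_le (card_polyLT K n).ge)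
  rw [← map_sub] at h
  refine Ideal.dvd_span_singleton.2 ?_
  have hdvd : x - y ∣ M := Finset.dvd_prod_of_mem _ (Finset.mem_erase.2 ⟨sub_ne_zero.2 hxy,
    mem_polyLT.2 (sub_mem (mem_polyLT.1 hx) (mem_polyLT.1 hy))⟩)
  exact Ideal.mem_of_dvd _ (map_dvd _ hdvd) h

end Quotients

end CountingPolynomials

end FlagSpread

namespace FlagSpread

/-! ### Plane cubics without rational points. -/

section CubicCurves

open Polynomial Submodule

section FrobeniusFacts

variable {k K : Type*} [Field k] [Finite k] [Field K] [Algebra k K]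

/-- The elements fixed by the Frobenius automorphism of an extension of a finite field. -/
theorem pow_card_eq_self_iff {x : K} :
    x ^ Nat.card k = x ↔ x ∈ Set.range (algebraMap k K) := by
  classical
  have := Fintype.ofFinite k
  have hq : 1 < Nat.card k := Finite.one_lt_card
  constructor
  · intro hx
    have hp0 := FiniteField.X_pow_card_sub_X_ne_zero K hq
    have hsub : (Finset.univ.image (algebraMap k K)) ⊆ (X ^ Nat.card k - X : K[X]).roots.toFinset := by
      intro y hy
      obtain ⟨c, -, rfl⟩ := Finset.mem_image.1 hy
      rw [Multiset.mem_toFinset, mem_roots hp0, IsRoot.def, eval_sub, eval_pow, eval_X, ← map_pow,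
        Nat.card_eq_fintype_card, FiniteField.pow_card, sub_self]
    have heq := Finset.eq_of_subset_of_card_le hsub (by
      rw [Finset.card_image_of_injective _ (algebraMap k K).injective, Finset.card_univ,
        ← Nat.card_eq_fintype_card]
      exact (Multiset.toFinset_card_le _).trans ((card_roots' _).trans
        (FiniteField.X_pow_card_sub_X_natDegree_eq K hq).le))
    have : x ∈ (X ^ Nat.card k - X : K[X]).roots.toFinset := by
      rw [Multiset.mem_toFinset, mem_roots hp0, IsRoot.def, eval_sub, eval_pow, eval_X, hx, sub_self]
    rw [← heq] at this
    obtain ⟨c, -, hc⟩ := Finset.mem_image.1 this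
    exact ⟨c, hc⟩
  · rintro ⟨c, rfl⟩
    rw [← map_pow, Nat.card_eq_fintype_card, FiniteField.pow_card]

end FrobeniusFacts

/-- The element `a + b z + c z ^ 2` for a triple of polynomials. -/
def evalTriple {S R : Type*} [CommRing S] [CommRing R] [Algebra S R] (z : R) (p : S × S × S) : R :=
  algebraMap S R p.1 + algebraMap S R p.2.1 * z + algebraMap S R p.2.2 * z ^ 2

theorem evalTriple_sub {S R : Type*} [CommRing S] [CommRing R] [Algebra S R] (z : R)
    (p p' : S × S × S) : evalTriple z (p - p') = evalTriple z p - evalTriple z p' := by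
  simp [evalTriple]
  ring

/-- The triple of polynomials with coefficients mapped to an extension field. -/
noncomputable def mapTriple {k : Type*} (K : Type*) [Field k] [Field K] [Algebra k K]
    (p : k[X] × k[X] × k[X]) : K[X] × K[X] × K[X] :=
  (p.1.map (algebraMap k K), p.2.1.map (algebraMap k K), p.2.2.map (algebraMap k K))

theorem mapTriple_sub {k K : Type*} [Field k] [Field K] [Algebra k K] (p p' : k[X] × k[X] × k[X]) :
    mapTriple K (p - p') = mapTriple K p - mapTriple K p' := by
  simp [mapTriple]

theorem mapTriple_injective {k K : Type*} [Field k] [Field K] [Algebra k K] :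
    Function.Injective (mapTriple (k := k) K) := by
  intro p p' h
  have hm := map_injective (algebraMap k K) (algebraMap k K).injective
  simp only [mapTriple, Prod.mk.injEq] at h
  exact Prod.ext (hm h.1) (Prod.ext (hm h.2.1) (hm h.2.2))

/-- A plane cubic over a finite field `k` without rational points contains a line over the cubic
extension field. The cubic is given by an affine equation `z³ + A z² + B z + C = 0`. -/
theorem exists_linear_root {k K : Type*} [Field k] [Finite k] [Field K] [Algebra k K]
    (hK : Module.finrank k K = 3) (h3 : (3 : k) ≠ 0) {A B C : k[X]} (hA : A.natDegree ≤ 1)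
    (hB : B.natDegree ≤ 2) (hC : C.natDegree ≤ 3)
    (h : ∀ x z : k, z ^ 3 + A.eval x * z ^ 2 + B.eval x * z + C.eval x ≠ 0)
    (hinf : ∀ z : k, z ^ 3 + A.coeff 1 * z ^ 2 + B.coeff 2 * z + C.coeff 3 ≠ 0) :
    ∃ ρ : K[X], ρ.natDegree ≤ 1 ∧ ρ ^ 3 + A.map (algebraMap k K) * ρ ^ 2 +
      B.map (algebraMap k K) * ρ + C.map (algebraMap k K) = 0 := by
  classical
  -- Without a linear root over `K` the cubic is irreducible over `K(X)`. A stable prime of degree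
  -- one in the normalization over `K` then yields a rational point. The hypothesis `hinf`, absence
  -- of points at infinity, makes the norm degrees of invariant elements exact.
  by_contra hno
  push Not at hno
  have hfd : FiniteDimensional k K := FiniteDimensional.of_finrank_pos (by omega)
  have hfinK : Finite K := Module.finite_of_finite k
  set q := Nat.card k with hqdef
  have hq : 2 ≤ q := Finite.one_lt_card
  have hcK : Nat.card K = q ^ 3 := by rw [Module.natCard_eq_pow_finrank (K := k), hK]
  have := Fintype.ofFinite k
  have := Fintype.ofFinite K
  let φ := algebraMap k K
  have hφ : Function.Injective φ := φ.injective
  let frob : K ≃+* K := (FiniteField.frobeniusAlgEquivOfAlgebraic k K : K ≃ₐ[k] K)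
  have hfrob : ∀ x, frob x = x ^ q := fun x => by
    rw [hqdef, Nat.card_eq_fintype_card]; rfl
  have hfrob3 : ∀ x, frob (frob (frob x)) = x := fun x => by
    rw [hfrob, hfrob, hfrob, ← pow_mul, ← pow_mul, show q * (q * q) = q ^ 3 by ring, ← hcK,
      Nat.card_eq_fintype_card, FiniteField.pow_card]
  have hfrobk : ∀ c, frob (φ c) = φ c := fun c => by
    rw [hfrob]; exact pow_card_eq_self_iff.2 ⟨c, rfl⟩
  let τ : K[X] ≃+* K[X] := Polynomial.mapEquiv frob
  have hτ : ∀ p, τ p = p.map (frob : K →+* K) := fun p => rfl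
  have hτ3 : ∀ p, τ (τ (τ p)) = p := fun p => by
    ext j; simp [hτ, coeff_map, hfrob3]
  have hτk : ∀ p : k[X], τ (p.map φ) = p.map φ := fun p => by
    ext j; simp [hτ, coeff_map, hfrobk]
  -- A root of degree at least 2 is impossible, since `ρ ^ 3` would outweigh the other terms.
  have hdeg : ∀ ρ : K[X], ρ ^ 3 + A.map φ * ρ ^ 2 + B.map φ * ρ + C.map φ ≠ 0 := by
    intro ρ hρ
    refine hno ρ ?_ hρ
    by_contra hd
    push Not at hd
    have e1 : (A.map φ * ρ ^ 2).natDegree ≤ 1 + 2 * ρ.natDegree :=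
      natDegree_mul_le_of_le (natDegree_map_le.trans hA) (natDegree_pow_le)
    have e2 : (B.map φ * ρ).natDegree ≤ 2 + ρ.natDegree :=
      natDegree_mul_le_of_le (natDegree_map_le.trans hB) le_rfl
    have e3 : (C.map φ).natDegree ≤ 3 := natDegree_map_le.trans hC
    have e4 : (ρ ^ 3).natDegree = 3 * ρ.natDegree := natDegree_pow _ _
    have e5 : ρ ^ 3 = -(A.map φ * ρ ^ 2 + B.map φ * ρ + C.map φ) := by linear_combination hρ
    have e6 : (A.map φ * ρ ^ 2 + B.map φ * ρ + C.map φ).natDegree ≤ 1 + 2 * ρ.natDegree :=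
      natDegree_add_le_of_degree_le (natDegree_add_le_of_degree_le e1 (by omega)) (by omega)
    rw [e5, natDegree_neg] at e4
    omega
  have h3' : (3 : K[X]) ≠ 0 := by
    have : (3 : K) ≠ 0 := by
      have := (map_ne_zero φ).2 h3
      rwa [map_ofNat] at this
    rw [← map_ofNat (Polynomial.C : K →+* K[X]) 3]
    exact C_ne_zero.2 this
  obtain ⟨R, _, _, _, _, _, z, σ, hz, hσ, hσz, hσ3, hnorm, hli⟩ := exists_cubic_ring τ hτ3 (hτk A)
    (hτk B) (hτk C) h3' hdeg
  let algKR : Algebra K R := ((algebraMap K[X] R).comp Polynomial.C).toAlgebra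
  have hKR : ∀ c : K, algebraMap K R c = algebraMap K[X] R (Polynomial.C c) := fun c => rfl
  have : IsScalarTower K K[X] R := IsScalarTower.of_algebraMap_eq fun c => rfl
  have hinj : Function.Injective (evalTriple (S := K[X]) z) := by
    intro p p' hp
    have := hli _ _ _ ((evalTriple_sub z p p').trans (sub_eq_zero.2 hp))
    exact sub_eq_zero.1 (Prod.ext this.1 (Prod.ext this.2.1 this.2.2))
  have hSR : Function.Injective (algebraMap K[X] R) := by
    intro p p' hp
    have : evalTriple z (p, 0, 0) = evalTriple z (p', (0 : K[X]), (0 : K[X])) := by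
      simp [evalTriple, hp]
    exact congrArg Prod.fst (hinj this)
  have : FaithfulSMul K[X] R := (faithfulSMul_iff_algebraMap_injective K[X] R).2 hSR
  have : Infinite R := Infinite.of_injective _ hSR
  have hev0 : evalTriple (S := K[X]) z 0 = 0 := by simp [evalTriple]
  have hcd : ∀ p : K[X] × K[X] × K[X], p ≠ 0 → cardQuot (Ideal.span {evalTriple z p}) =
      q ^ (3 * (cubicNorm (A.map φ) (B.map φ) (C.map φ) p.1 p.2.1 p.2.2).natDegree) := by
    intro p hp
    rw [cardQuot_span_singleton (K := K) (fun h0 => hp (hinj (h0.trans hev0.symm))), hcK,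
      evalTriple, hnorm, pow_mul]
  have hcdle : ∀ m, ∀ p ∈ triples K m, p ≠ 0 →
      cardQuot (Ideal.span {evalTriple z p}) ≤ q ^ (9 * m) := by
    intro m p hp hp0
    rw [hcd p hp0]
    apply Nat.pow_le_pow_right (by omega)
    have := (hasTop_cubicNorm_triple ((natDegree_map_le (f := φ)).trans hA)
      ((natDegree_map_le (f := φ)).trans hB) ((natDegree_map_le (f := φ)).trans hC) hp).1
    omega
  let evk : k[X] × k[X] × k[X] → R := fun p => evalTriple z (mapTriple K p)
  have hevk : Function.Injective evk := hinj.comp mapTriple_injective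
  have hevk_sub : ∀ p p', evk p - evk p' = evk (p - p') := fun p p' => by
    simp only [evk, mapTriple_sub, evalTriple_sub]
  have hevkσ : ∀ p, σ (evk p) = evk p := fun p => by
    simp only [evk, evalTriple, mapTriple, map_add, map_mul, map_pow, hσ, hσz]
    rw [hτk, hτk, hτk]
  have hcdk : ∀ m, ∀ p ∈ triples k m, topCoeff m p ≠ 0 →
      cardQuot (Ideal.span {evk p}) = q ^ (9 * m) := by
    intro m p hp hp0
    have hne : p ≠ 0 := by
      rintro rfl
      simp [topCoeff] at hp0
    rw [hcd _ (fun h0 => hne (mapTriple_injective (h0.trans (by simp [mapTriple]; rfl))))]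
    simp only [mapTriple]
    rw [show cubicNorm (A.map φ) (B.map φ) (C.map φ) (p.1.map φ) (p.2.1.map φ) (p.2.2.map φ) =
      (cubicNorm A B C p.1 p.2.1 p.2.2).map φ from (map_cubicNorm (mapRingHom φ) _ _ _ _ _ _).symm,
      natDegree_map_eq_of_injective hφ, natDegree_cubicNorm_triple hA hB hC hinf hp hp0]
    congr 1
    ring
  have hfin : ∀ I : Ideal R, I ≠ ⊥ → Finite (R ⧸ I) := fun I hI => finite_quotient (K := K) hI
  have hJ : {J : Ideal R | J ≠ ⊥ ∧ cardQuot J ≤ q ^ 9}.Finite := by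
    refine (finite_setOf_cardQuot_lt (K := K) (R := R) 4).subset fun J hJ => ⟨hJ.1, hJ.2.trans_lt ?_⟩
    rw [hcK, ← pow_mul]
    exact Nat.pow_lt_pow_right (by omega) (by norm_num)
  -- Here `m = d / 3 + 1` is the least `m` with `3 m > d`, so the `q ^ (9 m)` triples over `K`
  -- outnumber the residues modulo `I`; the difference of two congruent triples has index at most `q
  -- ^ (9 m) ≤ q ^ (3 d + 9)`.
  obtain ⟨P, hP, hP0, hPσ⟩ := exists_stable_prime (Λ := k × k × k) σ hσ3 hq hJ
    (fun d => (triples K (d / 3 + 1)).image (evalTriple z))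
    (fun d => by
      rw [Finset.card_image_of_injective _ hinj, card_triples K (by omega), hcK, ← pow_mul]
      exact Nat.pow_le_pow_right (by omega) (by omega))
    (fun d I hI => by
      have hI0 : I ≠ ⊥ := by
        rintro rfl
        rw [cardQuot_bot] at hI
        exact (pow_pos (by omega : 0 < q) _).ne hI
      have := hfin I hI0
      obtain ⟨p, hp, p', hp', hne, hmem⟩ := exists_sub_mem_of_cardQuot_lt (I := I)
        (triples K (d / 3 + 1)) (evalTriple z) (by
          rw [hI, card_triples K (by omega), hcK, ← pow_mul]
          exact Nat.pow_lt_pow_right (by omega) (by omega))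
      rw [← evalTriple_sub] at hmem
      have hsub := sub_mem_triples hp hp'
      refine ⟨_, Finset.mem_image_of_mem _ hsub, fun h0 => hne ?_, hmem, ?_⟩
      · exact sub_eq_zero.1 (hinj (h0.trans hev0.symm))
      · exact (hcdle _ _ hsub (sub_ne_zero.2 hne)).trans
          (Nat.pow_le_pow_right (by omega) (by omega)))
    (fun m => (monicTriples k m).image evk)
    (fun m hm => by
      rw [Finset.card_image_of_injective _ hevk, card_monicTriples k hm])
    (fun m r hr => by
      obtain ⟨p, -, rfl⟩ := Finset.mem_image.1 hr
      exact hevkσ p)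
    (fun m hm r hr => by
      obtain ⟨p, hp, rfl⟩ := Finset.mem_image.1 hr
      obtain ⟨hp1, hp2⟩ := monicTriples_subset hp
      exact hcdk m p hp1 fun h0 => by simp [h0] at hp2)
    -- Top coefficients serve as labels: if two generators of one ideal share them, their difference
    -- lies in the ideal but, when nonzero, has too small an index.
    (fun m r => topCoeff m (Function.invFun evk r))
    (by rw [Fintype.card_prod, Fintype.card_prod, hqdef, Nat.card_eq_fintype_card]; ring)
    (fun m hm r hr s hs hrs hlam => by
      obtain ⟨p, hp, rfl⟩ := Finset.mem_image.1 hr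
      obtain ⟨p', hp', rfl⟩ := Finset.mem_image.1 hs
      simp only [Function.leftInverse_invFun hevk _] at hlam
      obtain ⟨hp1, hp2⟩ := monicTriples_subset hp
      obtain ⟨hp1', -⟩ := monicTriples_subset hp'
      by_contra hne
      have hne' : p - p' ≠ 0 := sub_ne_zero.2 fun h0 => hne (by rw [h0])
      have hsub := sub_mem_triples hp1 hp1'
      obtain ⟨m', hm', hm1, hm2⟩ := exists_topCoeff_ne_zero hsub hne'
      have hlt : m' < m := by
        refine lt_of_le_of_ne hm' ?_
        rintro rfl
        exact hm2 (by rw [topCoeff_sub, hlam, sub_self])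
      have hle : Ideal.span {evk (p - p')} ≤ Ideal.span {evk p} := by
        rw [Ideal.span_singleton_le_iff_mem, ← hevk_sub]
        exact sub_mem (Ideal.mem_span_singleton_self _) (hrs ▸ Ideal.mem_span_singleton_self _)
      have : Finite (R ⧸ Ideal.span {evk (p - p')}) := hfin _ fun h0 => by
        have := hcdk m' _ hm1 hm2
        rw [h0, cardQuot_bot] at this
        exact (pow_pos (by omega : 0 < q) _).ne this
      have hcard : cardQuot (Ideal.span {evk p}) ≤ cardQuot (Ideal.span {evk (p - p')}) := by
        rw [cardQuot_apply, cardQuot_apply]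
        exact Nat.card_le_card_of_surjective _ (Ideal.Quotient.factor_surjective hle)
      rw [hcdk m' _ hm1 hm2, hcdk m p hp1 (fun h0 => by simp [h0] at hp2)] at hcard
      have := (Nat.pow_le_pow_iff_right (by omega : 1 < q)).1 hcard
      omega)
  obtain ⟨a, ha⟩ : ∃ a : K, a ^ q ≠ a := by
    by_contra hall
    push Not at hall
    have hsurj : Function.Surjective φ := fun x => pow_card_eq_self_iff.1 (hall x)
    have := Nat.card_le_card_of_surjective φ hsurj
    rw [hcK] at this
    exact absurd this (not_le.2 (lt_self_pow₀ (by omega) (by norm_num)))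
  obtain ⟨P, hPσ, hP, hP0, hPcard⟩ := exists_stable_prime_degree_one hσ3 hq hcK (a := a)
    (fun c => by rw [hKR, hKR, hσ, hτ, map_C, ← hfrob]; rfl) ha hfin
    (fun m => (triples k m).image evk)
    (fun m r hr => by
      obtain ⟨p, -, rfl⟩ := Finset.mem_image.1 hr
      exact hevkσ p)
    (fun m hm => by
      rw [Finset.card_image_of_injective _ hevk, card_triples k hm])
    (fun m hm r hr s hs hrs => by
      obtain ⟨p, hp, rfl⟩ := Finset.mem_image.1 hr
      obtain ⟨p', hp', rfl⟩ := Finset.mem_image.1 hs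
      have hne : p - p' ≠ 0 := sub_ne_zero.2 fun h0 => hrs (by rw [h0])
      obtain ⟨m', hm', hm1, hm2⟩ := exists_topCoeff_ne_zero (sub_mem_triples hp hp') hne
      exact ⟨m', hm', by rw [hevk_sub, hcdk m' _ hm1 hm2]⟩) hP hP0 hPσ
  have hmax : P.IsMaximal := hP.isMaximal hP0
  have := hfin P hP0
  let mk := Ideal.Quotient.mk P
  let ψ : k →+* R ⧸ P := mk.comp ((algebraMap K R).comp φ)
  have hψ : ∀ c, quotientAut σ hPσ (ψ c) = ψ c := fun c => by
    change mk (σ (algebraMap K R (φ c))) = mk (algebraMap K R (φ c))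
    rw [hKR, hσ, hτ, map_C]
    exact congrArg (fun t => mk (algebraMap K[X] R (Polynomial.C t))) (hfrobk c)
  -- At a stable prime of degree one the fixed residues are exactly `k`. The images of `X` and `z`
  -- are fixed, so they are the coordinates of a rational point.
  have hbij : Function.Bijective
      (fun c : k => (⟨ψ c, hψ c⟩ : {y : R ⧸ P // quotientAut σ hPσ y = y})) := by
    rw [Nat.bijective_iff_injective_and_card]
    exact ⟨fun c c' hc => ψ.injective (congrArg Subtype.val hc), hPcard.symm⟩
  have hfix : ∀ r : R, σ r = r → ∃ c : k, ψ c = mk r := fun r hr => by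
    obtain ⟨c, hc⟩ := hbij.2 ⟨mk r, by rw [quotientAut_mk, hr]⟩
    exact ⟨c, congrArg Subtype.val hc⟩
  obtain ⟨x, hx⟩ := hfix (algebraMap K[X] R X) (by rw [hσ, hτ, map_X])
  obtain ⟨y, hy⟩ := hfix z hσz
  have hev : ∀ p : k[X], mk (algebraMap K[X] R (p.map φ)) = ψ (p.eval x) := by
    intro p
    have : (mk.comp ((algebraMap K[X] R).comp (mapRingHom φ))) = ψ.comp (evalRingHom x) := by
      apply Polynomial.ringHom_ext
      · intro c
        simp [ψ, hKR]
      · simp [hx]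
    exact RingHom.congr_fun this p
  refine h x y (ψ.injective ?_)
  have := congrArg mk hz
  simp only [map_add, map_mul, map_pow, map_zero] at this ⊢
  rw [← hy, hev, hev, hev] at this
  exact this

end CubicCurves

end FlagSpread

namespace FlagSpread

/-! ### Cubic forms in conjugate variables: from no rational zero to a plane of zeros. -/

section ConjForm

/-- A ternary cubic form, which is used for conjugate arguments and conjugate coefficients. -/
def conjForm {S : Type*} [CommRing S] (p0 p1 p2 t0 t1 t2 u0 u1 u2 : S) : S :=
  u0 * u1 * u2 + p0 * u0 * u1 ^ 2 + p1 * u1 * u2 ^ 2 + p2 * u2 * u0 ^ 2 +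
    t0 * u0 * u2 ^ 2 + t1 * u1 * u0 ^ 2 + t2 * u2 * u1 ^ 2

/-- The derivative of `conjForm` at `u` in the direction `v`. -/
def conjFormDeriv {S : Type*} [CommRing S] (p0 p1 p2 t0 t1 t2 u0 u1 u2 v0 v1 v2 : S) : S :=
  v0 * u1 * u2 + u0 * v1 * u2 + u0 * u1 * v2 +
    p0 * (v0 * u1 ^ 2 + 2 * u0 * u1 * v1) + p1 * (v1 * u2 ^ 2 + 2 * u1 * u2 * v2) +
    p2 * (v2 * u0 ^ 2 + 2 * u2 * u0 * v0) + t0 * (v0 * u2 ^ 2 + 2 * u0 * u2 * v2) +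
    t1 * (v1 * u0 ^ 2 + 2 * u1 * u0 * v0) + t2 * (v2 * u1 ^ 2 + 2 * u2 * u1 * v1)

/-- The second derivative of `conjForm`. -/
def conjFormPolar {S : Type*} [CommRing S] (p0 p1 p2 t0 t1 t2 u0 u1 u2 v0 v1 v2 w0 w1 w2 : S) : S :=
  conjFormDeriv p0 p1 p2 t0 t1 t2 (u0 + w0) (u1 + w1) (u2 + w2) v0 v1 v2 -
    conjFormDeriv p0 p1 p2 t0 t1 t2 u0 u1 u2 v0 v1 v2 -
    conjFormDeriv p0 p1 p2 t0 t1 t2 w0 w1 w2 v0 v1 v2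

variable {k K : Type*} [Field k] [Finite k] [Field K] [Algebra k K]

open Polynomial

theorem leadingCoeff_eq_zero_of_forall_cubic_eq_zero {K : Type*} [Field K]
    (hcard : 3 < Nat.card K) {a b c d : K}
    (h : ∀ x, a * x ^ 3 + b * x ^ 2 + c * x + d = 0) : a = 0 := by
  by_contra ha
  have : Finite K := Nat.finite_of_card_ne_zero (by omega)
  have := Fintype.ofFinite K
  have hdeg : (C a * X ^ 3 + C b * X ^ 2 + C c * X + C d : K[X]).natDegree = 3 := by
    compute_degree!
  have hp : (C a * X ^ 3 + C b * X ^ 2 + C c * X + C d : K[X]) = 0 :=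
    eq_zero_of_natDegree_lt_card_of_eval_eq_zero _ Function.injective_id
      (fun x => by simpa using h x) (by rw [hdeg, ← Nat.card_eq_fintype_card]; exact hcard)
  rw [hp] at hdeg
  simp at hdeg

/-- If the form has no nontrivial rational zero, it vanishes on a plane over the cubic extension. -/
theorem exists_plane_of_conjForm_ne_zero (hK : Module.finrank k K = 3) (h3 : (3 : k) ≠ 0)
    (φ : K ≃ₐ[k] K) (hφ : ∀ x, φ (φ (φ x)) = x)
    (hfix : ∀ x, φ x = x → x ∈ Set.range (algebraMap k K)) {θ : K} (hθ : φ θ ≠ θ) (p t : K)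
    (h : ∀ w : K, w ≠ 0 → conjForm p (φ p) (φ (φ p)) t (φ t) (φ (φ t)) w (φ w) (φ (φ w)) ≠ 0) :
    ∃ m0 m1 m2 n0 n1 n2 : K,
      ¬ (m1 * n2 - m2 * n1 = 0 ∧ m2 * n0 - m0 * n2 = 0 ∧ m0 * n1 - m1 * n0 = 0) ∧
      ∀ x y, conjForm p (φ p) (φ (φ p)) t (φ t) (φ (φ t)) (x * m0 + y * n0) (x * m1 + y * n1)
        (x * m2 + y * n2) = 0 := by
  have hθ1 : φ (φ θ) ≠ φ θ := fun h => hθ (φ.injective h)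
  have hθ2 : φ (φ θ) ≠ θ := fun h => hθ (by
    have := congrArg φ h
    rw [hφ] at this
    exact this.symm)
  set G : K → K := fun w => conjForm p (φ p) (φ (φ p)) t (φ t) (φ (φ t)) w (φ w) (φ (φ w)) with hG
  set D : K → K → K := fun w v => conjFormDeriv p (φ p) (φ (φ p)) t (φ t) (φ (φ t))
    w (φ w) (φ (φ w)) v (φ v) (φ (φ v)) with hD
  set T : K → K → K → K := fun w v u => conjFormPolar p (φ p) (φ (φ p)) t (φ t) (φ (φ t))
    w (φ w) (φ (φ w)) v (φ v) (φ (φ v)) u (φ u) (φ (φ u)) with hT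
  have hGφ : ∀ w, φ (G w) = G w := fun w => by
    simp only [hG, conjForm, map_add, map_mul, map_pow, hφ]
    ring
  have hDφ : ∀ w v, φ (D w v) = D w v := fun w v => by
    simp only [hD, conjFormDeriv, map_add, map_mul, map_pow, hφ, map_ofNat]
    ring
  have hTφ : ∀ w v u, φ (T w v u) = T w v u := fun w v u => by
    simp only [hT, conjFormPolar, conjFormDeriv, map_add, map_sub, map_mul, map_pow, hφ, map_ofNat]
    ring
  have hθ0 : θ ≠ 0 := by
    rintro rfl
    simp at hθ
  have hg := h θ hθ0
  change G θ ≠ 0 at hg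
  -- In the coordinates `w = x + z θ + y θ²` all coefficients of the form are fixed by `φ`. The
  -- coefficient of `z ^ 3` is `G θ ≠ 0`; after division by it the cubic is monic in `z` over `k`.
  have hdiv : ∀ x, φ x = x → ∃ c : k, algebraMap k K c * G θ = x := fun x hx => by
    obtain ⟨c, hc⟩ := hfix (x / G θ) (by rw [map_div₀, hx, hGφ])
    exact ⟨c, by rw [hc, div_mul_cancel₀ _ hg]⟩
  obtain ⟨A1, hA1⟩ := hdiv _ (hDφ θ 1)
  obtain ⟨A0, hA0⟩ := hdiv _ (hDφ θ (θ ^ 2))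
  obtain ⟨B2, hB2⟩ := hdiv _ (hDφ 1 θ)
  obtain ⟨B1, hB1⟩ := hdiv _ (hTφ 1 θ (θ ^ 2))
  obtain ⟨B0, hB0⟩ := hdiv _ (hDφ (θ ^ 2) θ)
  obtain ⟨C3, hC3⟩ := hdiv _ (hGφ 1)
  obtain ⟨C2, hC2⟩ := hdiv _ (hDφ 1 (θ ^ 2))
  obtain ⟨C1, hC1⟩ := hdiv _ (hDφ (θ ^ 2) 1)
  obtain ⟨C0, hC0⟩ := hdiv _ (hGφ (θ ^ 2))
  let i := algebraMap k K
  have hφi : ∀ c, φ (i c) = i c := fun c => φ.commutes c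
  -- the expansion of the form
  have hexp : ∀ x z : K, conjForm p (φ p) (φ (φ p)) t (φ t) (φ (φ t)) (x + z * θ + θ ^ 2)
      (x + z * φ θ + φ θ ^ 2) (x + z * φ (φ θ) + φ (φ θ) ^ 2) = G θ * (z ^ 3 +
        (i A1 * x + i A0) * z ^ 2 + (i B2 * x ^ 2 + i B1 * x + i B0) * z +
        (i C3 * x ^ 3 + i C2 * x ^ 2 + i C1 * x + i C0)) := by
    intro x z
    have e : G θ * (z ^ 3 +
        (i A1 * x + i A0) * z ^ 2 + (i B2 * x ^ 2 + i B1 * x + i B0) * z +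
        (i C3 * x ^ 3 + i C2 * x ^ 2 + i C1 * x + i C0)) = G θ * z ^ 3 +
        (D θ 1 * x + D θ (θ ^ 2)) * z ^ 2 + (D 1 θ * x ^ 2 + T 1 θ (θ ^ 2) * x + D (θ ^ 2) θ) * z +
        (G 1 * x ^ 3 + D 1 (θ ^ 2) * x ^ 2 + D (θ ^ 2) 1 * x + G (θ ^ 2)) := by
      rw [← hA1, ← hA0, ← hB2, ← hB1, ← hB0, ← hC3, ← hC2, ← hC1, ← hC0]
      ring
    rw [e]
    simp only [hG, hD, hT, conjFormPolar, conjFormDeriv, conjForm, map_pow, map_one]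
    ring
  have hpoint : ∀ x y z : K, (x * 1 + z * θ + y * θ ^ 2 = 0 ∧ x * 1 + z * φ θ + y * φ θ ^ 2 = 0 ∧
      x * 1 + z * φ (φ θ) + y * φ (φ θ) ^ 2 = 0) → x = 0 ∧ y = 0 ∧ z = 0 := by
    rintro x y z ⟨h0, h1, h2⟩
    have e1 : z + y * (φ θ + θ) = 0 := by
      apply mul_left_cancel₀ (sub_ne_zero.2 hθ)
      linear_combination h1 - h0
    have e2 : z + y * (φ (φ θ) + θ) = 0 := by
      apply mul_left_cancel₀ (sub_ne_zero.2 hθ2)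
      linear_combination h2 - h0
    have hy : y = 0 := by
      apply mul_left_cancel₀ (sub_ne_zero.2 hθ1)
      linear_combination e2 - e1
    subst hy
    have hz : z = 0 := by linear_combination e1
    subst hz
    exact ⟨by linear_combination h0, rfl, rfl⟩
  have hres : ∃ ρ : K[X], ρ.natDegree ≤ 1 ∧ ρ ^ 3 + (C A1 * X + C A0 : k[X]).map i * ρ ^ 2 +
      (C B2 * X ^ 2 + C B1 * X + C B0 : k[X]).map i * ρ +
      (C C3 * X ^ 3 + C C2 * X ^ 2 + C C1 * X + C C0 : k[X]).map i = 0 := by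
    refine exists_linear_root hK h3 (by compute_degree) (by compute_degree) (by compute_degree) ?_ ?_
    · intro x z hxz
      have := congrArg i hxz
      simp only [eval_add, eval_mul, eval_C, eval_X, eval_pow, map_add, map_mul, map_pow,
        map_zero] at this
      have h' := hexp (i x) (i z)
      rw [this, mul_zero] at h'
      refine h (i x + i z * θ + θ ^ 2) (fun h0 => ?_) ?_
      · have h1 := congrArg φ h0
        have h2 := congrArg φ h1
        simp only [map_add, map_mul, map_pow, hφi, map_zero] at h1 h2
        have := hpoint (i x) 1 (i z) ⟨by linear_combination h0, by linear_combination h1,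
          by linear_combination h2⟩
        exact one_ne_zero this.2.1
      · simp only [map_add, map_mul, map_pow, hφi]
        exact h'
    · intro z hz
      have e : G θ * (i z ^ 3 + i A1 * i z ^ 2 + i B2 * i z + i C3) =
          G θ * i z ^ 3 + D θ 1 * i z ^ 2 + D 1 θ * i z + G 1 := by
        rw [← hA1, ← hB2, ← hC3]
        ring
      have hz' := congrArg i hz
      simp only [coeff_add, coeff_C_mul, coeff_X, coeff_C, coeff_X_pow] at hz'
      norm_num at hz'
      rw [hz', mul_zero] at e
      refine h (1 + i z * θ) (fun h0 => ?_) ?_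
      · have h1 := congrArg φ h0
        have h2 := congrArg φ h1
        simp only [map_add, map_mul, map_one, hφi, map_zero] at h1 h2
        have := hpoint 1 0 (i z) ⟨by linear_combination h0, by linear_combination h1,
          by linear_combination h2⟩
        exact one_ne_zero this.1
      · rw [e]
        simp only [hG, hD, conjFormDeriv, conjForm, map_add, map_mul, map_one, hφi]
        ring
  obtain ⟨ρ, hρ1, hρ⟩ := hres
  obtain ⟨α, β, rfl⟩ := exists_eq_X_add_C_of_natDegree_le_one hρ1
  have hline : ∀ x : K, conjForm p (φ p) (φ (φ p)) t (φ t) (φ (φ t))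
      (x * (1 + α * θ) + (β * θ + θ ^ 2)) (x * (1 + α * φ θ) + (β * φ θ + φ θ ^ 2))
      (x * (1 + α * φ (φ θ)) + (β * φ (φ θ) + φ (φ θ) ^ 2)) = 0 := by
    intro x
    have hx := congrArg (eval x) hρ
    simp only [eval_add, eval_mul, eval_pow, eval_C, eval_X, Polynomial.map_add, Polynomial.map_mul,
      map_C, map_X, Polynomial.map_pow, eval_zero] at hx
    have h' := hexp x (α * x + β)
    rw [hx, mul_zero] at h'
    rw [← h']
    congr 1 <;> ring
  have hcard : 3 < Nat.card K := by
    have : FiniteDimensional k K := FiniteDimensional.of_finrank_pos (by omega)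
    rw [Module.natCard_eq_pow_finrank (K := k), hK]
    calc 3 < 2 ^ 3 := by norm_num
      _ ≤ Nat.card k ^ 3 := Nat.pow_le_pow_left Finite.one_lt_card 3
  refine ⟨1 + α * θ, 1 + α * φ θ, 1 + α * φ (φ θ), β * θ + θ ^ 2, β * φ θ + φ θ ^ 2,
    β * φ (φ θ) + φ (φ θ) ^ 2, ?_, ?_⟩
  · rintro ⟨h0, h1, h2⟩
    -- The determinant of the two spanning vectors together with `(θ, φ θ, φ² θ)` is, up to sign,
    -- the Vandermonde determinant of the conjugates of `θ`.
    have hV : (φ θ - θ) * (φ (φ θ) - θ) * (φ (φ θ) - φ θ) = 0 := by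
      linear_combination -θ * h0 - φ θ * h1 - φ (φ θ) * h2
    simp only [mul_eq_zero, sub_eq_zero, hθ, hθ1, hθ2, or_self] at hV
  · intro x y
    -- The line is known only in its affine part `y ≠ 0`. For the missing point, the form along the
    -- line is a cubic polynomial that vanishes at more than three elements, so its leading
    -- coefficient is zero.
    by_cases hy : y = 0
    · have hlead := leadingCoeff_eq_zero_of_forall_cubic_eq_zero hcard
        (a := conjForm p (φ p) (φ (φ p)) t (φ t) (φ (φ t)) (1 + α * θ) (1 + α * φ θ)
          (1 + α * φ (φ θ)))
        (b := conjFormDeriv p (φ p) (φ (φ p)) t (φ t) (φ (φ t)) (1 + α * θ) (1 + α * φ θ)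
          (1 + α * φ (φ θ)) (β * θ + θ ^ 2) (β * φ θ + φ θ ^ 2) (β * φ (φ θ) + φ (φ θ) ^ 2))
        (c := conjFormDeriv p (φ p) (φ (φ p)) t (φ t) (φ (φ t)) (β * θ + θ ^ 2) (β * φ θ + φ θ ^ 2)
          (β * φ (φ θ) + φ (φ θ) ^ 2) (1 + α * θ) (1 + α * φ θ) (1 + α * φ (φ θ)))
        (d := conjForm p (φ p) (φ (φ p)) t (φ t) (φ (φ t)) (β * θ + θ ^ 2) (β * φ θ + φ θ ^ 2)
          (β * φ (φ θ) + φ (φ θ) ^ 2)) (fun x => by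
          rw [← hline x]
          simp only [conjForm, conjFormDeriv]
          ring)
      subst hy
      simp only [conjForm] at hlead ⊢
      linear_combination x ^ 3 * hlead
    · have := hline (x / y)
      have e : x = x / y * y := (div_mul_cancel₀ x hy).symm
      generalize x / y = r at this e
      subst e
      simp only [conjForm] at this ⊢
      linear_combination y ^ 3 * this

end ConjForm

end FlagSpread

namespace FlagSpread

/-! ### Rational zeros of a form that vanishes on a plane. -/

section ConjFormZero

variable {k K : Type*} [Field k] [Field K] [Algebra k K]

/-- A `k`-semilinear fixed point equation, solved as in Hilbert's theorem 90. -/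
theorem exists_eq_add_of_norm_eq_one [Finite K] [CharP K 2] (φ : K ≃ₐ[k] K)
    (hφ : ∀ x, φ (φ (φ x)) = x) {θ : K} (hθ : φ θ ≠ θ) {α : K} (hα : α * φ α * φ (φ α) = 1) :
    ∃ w : K, w ≠ 0 ∧ w = α * φ w + α * φ α * φ (φ w) := by
  by_contra hno
  push Not at hno
  let f : K →+ K :=
    { toFun := fun w => w + α * φ w + α * φ α * φ (φ w)
      map_zero' := by simp
      map_add' := fun x y => by simp only [map_add]; ring }
  have hf : ∀ w, f w = w + α * φ w + α * φ α * φ (φ w) := fun w => rfl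
  have hinj : Function.Injective f := by
    rw [injective_iff_map_eq_zero]
    intro w hw
    by_contra hw0
    refine hno w hw0 ?_
    rw [hf, add_assoc, CharTwo.add_eq_zero] at hw
    exact hw
  have hsurj := Finite.surjective_of_injective hinj
  -- Every value of `f` solves `α φ(y) = y`. If `f` were bijective, `1` and `θ` would be solutions,
  -- and `θ` would be fixed by `φ`.
  have hfix : ∀ y, α * φ y = y := by
    intro y
    obtain ⟨w, rfl⟩ := hsurj y
    rw [hf]
    simp only [map_add, map_mul, hφ]
    linear_combination w * hα
  have h1 := hfix 1
  rw [map_one, mul_one] at h1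
  have := hfix θ
  rw [h1, one_mul] at this
  exact hθ this

/-- A form that vanishes on a plane over the cubic extension has a rational zero. -/
theorem exists_zero_of_plane [Finite K] [CharP K 2] (φ : K ≃ₐ[k] K)
    (hφ : ∀ x, φ (φ (φ x)) = x) {θ : K} (hθ : φ θ ≠ θ) {p t α β : K}
    (hno : ∀ y : K, y ^ 2 + y + p * t ≠ 0)
    (h : ∀ x y, conjForm p (φ p) (φ (φ p)) t (φ t) (φ (φ t)) (α * x + β * y) x y = 0) :
    ∃ w : K, w ≠ 0 ∧ conjForm p (φ p) (φ (φ p)) t (φ t) (φ (φ t)) w (φ w) (φ (φ w)) = 0 := by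
  have h2 : (2 : K) = 0 := CharTwo.two_eq_zero
  have hpt : p * t ≠ 0 := fun h0 => hno 0 (by rw [h0]; ring)
  have hp : p ≠ 0 := left_ne_zero_of_mul hpt
  have ht : t ≠ 0 := right_ne_zero_of_mul hpt
  have hp1 : φ p ≠ 0 := (map_ne_zero φ).2 hp
  have ht1 : φ t ≠ 0 := (map_ne_zero φ).2 ht
  have hp2 : φ (φ p) ≠ 0 := (map_ne_zero φ).2 hp1
  have ht2 : φ (φ t) ≠ 0 := (map_ne_zero φ).2 ht1
  have hφp : φ (φ (φ p)) = p := hφ p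
  have hφt : φ (φ (φ t)) = t := hφ t
  have hθ0 : θ ≠ 0 := by
    rintro rfl
    simp at hθ
  have hθ1 : θ + 1 ≠ 0 := by
    rw [Ne, CharTwo.add_eq_zero]
    rintro rfl
    simp at hθ
  generalize hP1 : φ p = p1 at *
  generalize hP2 : φ p1 = p2 at *
  generalize hT1 : φ t = t1 at *
  generalize hT2 : φ t1 = t2 at *
  -- On the plane the form is a binary cubic in `x`, `y`, and `e1`, `e3`, `e4`, `e2` state that its
  -- four coefficients vanish. The value at `(θ, 1)` separates the two middle ones, since `θ` is
  -- neither 0 nor 1.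
  have e1 : α * (p + t1 * α) = 0 := by
    have := h 1 0
    simp only [conjForm] at this
    linear_combination this
  have e2 : β * (p2 * β + t) = 0 := by
    have := h 0 1
    simp only [conjForm] at this
    linear_combination this
  have e34 : α + p * β + p2 * α ^ 2 + t2 + (β + p1 + t * α + t1 * β ^ 2) = 0 := by
    have h1 := h 1 1
    simp only [conjForm] at h1
    linear_combination h1 - e1 - e2 - α * β * (t1 + p2) * h2
  have e3 : α + p * β + p2 * α ^ 2 + t2 = 0 := by
    have h3 := h θ 1
    simp only [conjForm] at h3
    apply mul_left_cancel₀ (mul_ne_zero hθ0 hθ1)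
    linear_combination h3 - θ ^ 3 * e1 - e2 - α * β * (θ ^ 2 * t1 + θ * p2) * h2 + θ * e34 -
      θ * (β + p1 + t * α + t1 * β ^ 2) * h2
  have e4 : β + p1 + t * α + t1 * β ^ 2 = 0 := by linear_combination e34 - e3
  rcases mul_eq_zero.1 e1 with hα | hα <;> rcases mul_eq_zero.1 e2 with hβ | hβ
  · subst hα hβ
    exact absurd (by linear_combination e3) ht2
  · subst hα
    have ht' : t = p2 * β := by linear_combination hβ - p2 * β * h2
    have ht2' : t2 = p * β := by linear_combination e3 - p * β * h2
    have ha : p * t = p2 * t2 := by rw [ht', ht2']; ring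
    have ha1 : p1 * t1 = p * t := by
      have := congrArg φ ha
      simpa only [map_mul, hP1, hT1, hφp, hφt] using this
    -- With `α = 0`, the relation `e4` becomes, by `t = p2 β` and `p1 t1 = p t`, the excluded
    -- quadratic equation for `p1 p2 / t`. The case `β = 0` is symmetric.
    refine absurd ?_ (hno (p1 * p2 / t))
    have e : (p1 * p2 / t) ^ 2 + p1 * p2 / t + p * t =
        (p1 ^ 2 * p2 ^ 2 + p1 * p2 * t + p * t ^ 3) / t ^ 2 := by
      field_simp
    rw [e, div_eq_zero_iff]
    left
    rw [ht'] at ha1 ⊢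
    linear_combination p2 ^ 2 * p1 * e4 - p2 ^ 2 * β ^ 2 * ha1
  · subst hβ
    have hp' : p = t1 * α := by linear_combination hα - t1 * α * h2
    have hp1' : p1 = t * α := by linear_combination e4 - t * α * h2
    have ha : p1 * t1 = p * t := by rw [hp1', hp']; ring
    have ha2 : p2 * t2 = p * t := by
      have := congrArg φ ha
      simp only [map_mul, hP1, hT1, hP2, hT2] at this
      rw [this, ha]
    refine absurd ?_ (hno (t1 * t2 / p))
    have e : (t1 * t2 / p) ^ 2 + t1 * t2 / p + p * t =
        (t1 ^ 2 * t2 ^ 2 + t1 * t2 * p + p ^ 3 * t) / p ^ 2 := by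
      field_simp
    rw [e, div_eq_zero_iff]
    left
    rw [hp'] at ha2 ⊢
    linear_combination t1 ^ 2 * t2 * e3 - t1 ^ 2 * α ^ 2 * ha2
  · have hp' : p = t1 * α := by linear_combination hα - t1 * α * h2
    have ht' : t = p2 * β := by linear_combination hβ - p2 * β * h2
    -- Let `N = p p1 p2` and `M = t t1 t2`. Eliminating `α` and `β` gives quadratic equations for
    -- `N` and `M`; a conjugate of the first has the coefficients of the second, so `N + M` is 0 or
    -- `p2 t2`.
    have eN : (p * p1 * p2) ^ 2 + p1 * t1 * (p * p1 * p2) + (p1 * t1) ^ 2 * (p * t + p2 * t2) = 0 := by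
      linear_combination (p1 * t1) ^ 2 * p2 * e3 + (p1 ^ 2 * p2 ^ 2 * (p + t1 * α) + p1 ^ 2 * t1 * p2) * hp'
        + p1 ^ 2 * t1 ^ 2 * p * ht'
    have eM : (t * t1 * t2) ^ 2 + p2 * t2 * (t * t1 * t2) + (p2 * t2) ^ 2 * (p * t + p1 * t1) = 0 := by
      linear_combination (p2 * t2) ^ 2 * t1 * e4 +
        (t1 ^ 2 * t2 ^ 2 * (t + p2 * β) + p2 * t2 ^ 2 * t1) * ht' + (p2 * t2) ^ 2 * t * hp'
    have eN' : (p * p1 * p2) ^ 2 + p2 * t2 * (p * p1 * p2) + (p2 * t2) ^ 2 * (p * t + p1 * t1) = 0 := by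
      have := congrArg φ eN
      simp only [map_mul, map_add, map_pow, hP1, hT1, hP2, hT2, hφp, hφt, map_zero] at this
      linear_combination this
    have hNM : (p * p1 * p2 + t * t1 * t2) * (p * p1 * p2 + t * t1 * t2 + p2 * t2) = 0 := by
      linear_combination eM + eN' + (p * p1 * p2 * (t * t1 * t2) -
        (p2 * t2) ^ 2 * (p * t + p1 * t1)) * h2
    -- If `N = M`, then `α = p / t1` has norm one and `β = α φ(α)`, so the plane contains a point
    -- `(w, φ w, φ² w)`. If `N + M = p2 t2`, conjugation makes all `p_i t_i` equal, and `eM` reduces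
    -- to `M N = 0`, which is impossible.
    rcases mul_eq_zero.1 hNM with hNM | hNM
    · have hNM' : p * p1 * p2 = t * t1 * t2 := CharTwo.add_eq_zero.1 hNM
      have hα1 : p1 = t2 * φ α := by
        have := congrArg φ hp'
        simpa only [map_mul, hP1, hT2] using this
      have hα2 : p2 = t * φ (φ α) := by
        have := congrArg φ hα1
        simpa only [map_mul, hP2, hφt] using this
      obtain ⟨w, hw0, hw⟩ := exists_eq_add_of_norm_eq_one φ hφ hθ (α := α) (by
        apply mul_left_cancel₀ (mul_ne_zero (mul_ne_zero ht ht1) ht2)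
        linear_combination hNM' - p1 * p2 * hp' - t1 * α * p2 * hα1 - t1 * α * t2 * φ α * hα2)
      have hβ' : β = α * φ α := by
        apply mul_left_cancel₀ (mul_ne_zero (mul_ne_zero hp2 ht1) ht2)
        linear_combination -hNM' - t1 * t2 * ht' + p1 * p2 * hp' + t1 * α * p2 * hα1
      refine ⟨w, hw0, ?_⟩
      have := h (φ w) (φ (φ w))
      rwa [hβ', ← hw] at this
    · have h0 : p * p1 * p2 + t * t1 * t2 + p * t = 0 := by
        have := congrArg φ hNM
        simp only [map_mul, map_add, hP1, hT1, hP2, hT2, hφp, hφt, map_zero] at this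
        linear_combination this
      have h1 : p * p1 * p2 + t * t1 * t2 + p1 * t1 = 0 := by
        have := congrArg φ h0
        simp only [map_mul, map_add, hP1, hT1, hP2, hT2, hφp, hφt, map_zero] at this
        linear_combination this
      have hN0 : (t * t1 * t2) * (p * p1 * p2) = 0 := by
        have e : p * t = p1 * t1 := by linear_combination h0 - h1
        rw [e] at eM
        linear_combination (t * t1 * t2) * hNM - eM + (p2 * t2) ^ 2 * p1 * t1 * h2
      simp only [mul_eq_zero, hp, hp1, hp2, ht, ht1, ht2, or_self] at hN0

end ConjFormZero

end FlagSpread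

namespace FlagSpread

/-! ### Existence of a rational zero of the conjugate form. -/

section ConjFormZero

theorem conjForm_rotate {S : Type*} [CommRing S] (p0 p1 p2 t0 t1 t2 u0 u1 u2 : S) :
    conjForm p1 p2 p0 t1 t2 t0 u1 u2 u0 = conjForm p0 p1 p2 t0 t1 t2 u0 u1 u2 := by
  simp only [conjForm]
  ring

variable {k K : Type*} [Field k] [Field K] [Algebra k K]

/-- The nonzero minor allows the plane to be solved for its first coordinate by Cramer's rule. -/
theorem exists_zero_of_span [Finite K] [CharP K 2] (φ : K ≃ₐ[k] K)
    (hφ : ∀ x, φ (φ (φ x)) = x) {θ : K} (hθ : φ θ ≠ θ) {p t m0 m1 m2 n0 n1 n2 : K}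
    (hno : ∀ y : K, y ^ 2 + y + p * t ≠ 0) (hl : m1 * n2 - m2 * n1 ≠ 0)
    (h : ∀ x y, conjForm p (φ p) (φ (φ p)) t (φ t) (φ (φ t)) (x * m0 + y * n0) (x * m1 + y * n1)
      (x * m2 + y * n2) = 0) :
    ∃ w : K, w ≠ 0 ∧ conjForm p (φ p) (φ (φ p)) t (φ t) (φ (φ t)) w (φ w) (φ (φ w)) = 0 := by
  refine exists_zero_of_plane φ hφ hθ (α := (n2 * m0 - m2 * n0) / (m1 * n2 - m2 * n1))
    (β := (m1 * n0 - n1 * m0) / (m1 * n2 - m2 * n1)) hno fun x y => ?_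
  rw [← h ((x * n2 - y * n1) / (m1 * n2 - m2 * n1)) ((y * m1 - x * m2) / (m1 * n2 - m2 * n1))]
  congr 1
  · field_simp
    ring
  · rw [div_mul_eq_mul_div, div_mul_eq_mul_div, ← add_div, eq_div_iff hl]
    ring
  · rw [div_mul_eq_mul_div, div_mul_eq_mul_div, ← add_div, eq_div_iff hl]
    ring

/-- The conjugate form has a rational zero if its coefficients avoid a quadratic condition. -/
theorem exists_conjForm_eq_zero [Finite k] [CharP K 2] (hK : Module.finrank k K = 3)
    (h3 : (3 : k) ≠ 0) (φ : K ≃ₐ[k] K) (hφ : ∀ x, φ (φ (φ x)) = x)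
    (hfix : ∀ x, φ x = x → x ∈ Set.range (algebraMap k K)) {θ : K} (hθ : φ θ ≠ θ) {p t : K}
    (hno : ∀ y : K, y ^ 2 + y + p * t ≠ 0) :
    ∃ w : K, w ≠ 0 ∧ conjForm p (φ p) (φ (φ p)) t (φ t) (φ (φ t)) w (φ w) (φ (φ w)) = 0 := by
  by_contra hcon
  have : FiniteDimensional k K := FiniteDimensional.of_finrank_pos (by omega)
  have : Finite K := Module.finite_of_finite k
  obtain ⟨m0, m1, m2, n0, n1, n2, hl, h⟩ := exists_plane_of_conjForm_ne_zero hK h3 φ hφ hfix hθ p t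
    (fun w hw h0 => hcon ⟨w, hw, h0⟩)
  have hno1 : ∀ y : K, y ^ 2 + y + φ p * φ t ≠ 0 := fun y hy => by
    have := congrArg (fun x => φ (φ x)) hy
    simp only [map_add, map_mul, map_pow, hφ, map_zero] at this
    exact hno _ this
  have hno2 : ∀ y : K, y ^ 2 + y + φ (φ p) * φ (φ t) ≠ 0 := fun y hy => by
    have := congrArg φ hy
    simp only [map_add, map_mul, map_pow, hφ, map_zero] at this
    exact hno _ this
  -- Some minor is nonzero; a cyclic rotation of the coordinates, matched by applying `φ` to the
  -- coefficients, brings it to the first position.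
  by_cases h0 : m1 * n2 - m2 * n1 = 0
  · by_cases h1 : m2 * n0 - m0 * n2 = 0
    · have h2 : m0 * n1 - m1 * n0 ≠ 0 := fun h2 => hl ⟨h0, h1, h2⟩
      obtain ⟨w, hw, hw0⟩ := exists_zero_of_span φ hφ hθ (m0 := m2) (n0 := n2) hno2 h2 (fun x y => by
        rw [hφ, hφ, ← conjForm_rotate, h])
      refine hcon ⟨φ w, (map_ne_zero φ).2 hw, ?_⟩
      rw [hφ, hφ] at hw0
      rw [hφ, conjForm_rotate, hw0]
    · obtain ⟨w, hw, hw0⟩ := exists_zero_of_span φ hφ hθ (m0 := m1) (n0 := n1) hno1 h1 (fun x y => by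
        rw [hφ, hφ, conjForm_rotate, h])
      refine hcon ⟨φ (φ w), (map_ne_zero φ).2 ((map_ne_zero φ).2 hw), ?_⟩
      rw [hφ, hφ] at hw0
      rw [hφ, ← conjForm_rotate, hw0]
  · exact hcon (exists_zero_of_span φ hφ hθ hno h0 h)

theorem exists_scaled_conjForm_eq_zero [Finite k] [CharP K 2] (hK : Module.finrank k K = 3)
    (h3 : (3 : k) ≠ 0) (φ : K ≃ₐ[k] K) (hφ : ∀ x, φ (φ (φ x)) = x)
    (hfix : ∀ x, φ x = x → x ∈ Set.range (algebraMap k K)) {θ : K} (hθ : φ θ ≠ θ) {e p t : K}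
    (he : φ e = e) (he0 : e ≠ 0) (hno : ∀ y : K, y ^ 2 + e * y + p * t ≠ 0) :
    ∃ w : K, w ≠ 0 ∧ e * (w * φ w * φ (φ w)) + p * w * φ w ^ 2 + φ p * φ w * φ (φ w) ^ 2 +
      φ (φ p) * φ (φ w) * w ^ 2 + t * w * φ (φ w) ^ 2 + φ t * φ w * w ^ 2 +
      φ (φ t) * φ (φ w) * φ w ^ 2 = 0 := by
  obtain ⟨w, hw, h⟩ := exists_conjForm_eq_zero hK h3 φ hφ hfix hθ (p := p / e) (t := t / e)
    (fun y hy => hno (e * y) (by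
      field_simp at hy
      linear_combination hy))
  refine ⟨w, hw, ?_⟩
  simp only [conjForm, map_div₀, he] at h
  field_simp at h
  linear_combination h

end ConjFormZero

end FlagSpread

namespace FlagSpread

/-! ### The Frobenius automorphism of the cubic extension. -/

section Frobenius

variable {k K : Type*} [Field k] [Finite k] [Field K] [Algebra k K]

/-- The basic properties of the Frobenius automorphism of a cubic extension of a finite field. -/
theorem exists_frobenius (hK : Module.finrank k K = 3) :
    ∃ φ : K ≃ₐ[k] K, (∀ x, φ x = x ^ Nat.card k) ∧ (∀ x, φ (φ (φ x)) = x) ∧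
      (∀ x, φ x = x → x ∈ Set.range (algebraMap k K)) ∧ (∃ θ, φ θ ≠ θ) ∧
      ∀ x, algebraMap k K (Algebra.trace k K x) = x + φ x + φ (φ x) := by
  have hfd : FiniteDimensional k K := FiniteDimensional.of_finrank_pos (by omega)
  have hfinK : Finite K := Module.finite_of_finite k
  have := Fintype.ofFinite k
  have := Fintype.ofFinite K
  have hcK : Nat.card K = Nat.card k ^ 3 := by rw [Module.natCard_eq_pow_finrank (K := k), hK]
  have hφ : ∀ x : K, FiniteField.frobeniusAlgEquivOfAlgebraic k K x = x ^ Nat.card k := fun x => by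
    rw [Nat.card_eq_fintype_card]; rfl
  refine ⟨FiniteField.frobeniusAlgEquivOfAlgebraic k K, hφ, ?_, ?_, ?_, ?_⟩
  · intro x
    rw [hφ, hφ, hφ, ← pow_mul, ← pow_mul, show Nat.card k * (Nat.card k * Nat.card k) =
      Nat.card k ^ 3 by ring, ← hcK, Nat.card_eq_fintype_card, FiniteField.pow_card]
  · intro x hx
    rw [hφ] at hx
    exact pow_card_eq_self_iff.1 hx
  · by_contra hall
    push Not at hall
    have hsurj : Function.Surjective (algebraMap k K) := fun x =>
      pow_card_eq_self_iff.1 ((hφ x).symm.trans (hall x))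
    have := Nat.card_le_card_of_surjective _ hsurj
    rw [hcK] at this
    exact absurd this (not_le.2 (lt_self_pow₀ Finite.one_lt_card (by norm_num)))
  · intro x
    rw [FiniteField.algebraMap_trace_eq_sum_pow, hK, hφ, hφ]
    simp [Finset.sum_range_succ, pow_mul, pow_two]

end Frobenius

/-! ### Different norms of the coefficients produce a collision. -/

section NotInjective

variable {k K : Type*} [Field k] [Field K] [Algebra k K]

/-- The norm of `b φ(x) + c φ²(x) + δ x`, where `δ` has trace `s` and norm `n`. -/
def twistedForm (φ : K ≃ₐ[k] K) (b c s n x : K) : K :=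
  (b * φ x + c * φ (φ x)) ^ 2 + s * x * (b * φ x + c * φ (φ x)) + n * x ^ 2

/-- This is multiplicativity of the norm for `δ² = s δ + n`. The factors on the right are the norms
of `c0 c1 + b1 δ` and `b0 b2 + c2 δ`; the first times the conjugate of the second is `u + e δ`,
where `u` is the repeated sum and `e = b0 b1 b2 + c0 c1 c2`. -/
theorem twisted_discriminant_identity [CharP K 2] (b0 b1 b2 c0 c1 c2 s n : K) :
    (c0 * c1 * b0 * b2 + b1 * c2 * n + c0 * c1 * c2 * s) ^ 2 +
      s * (c0 * c1 * b0 * b2 + b1 * c2 * n + c0 * c1 * c2 * s) * (b0 * b1 * b2 + c0 * c1 * c2) +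
      n * (b0 * b1 * b2 + c0 * c1 * c2) ^ 2 =
    ((c0 * c1) ^ 2 + s * (c0 * c1) * b1 + n * b1 ^ 2) *
      ((b0 * b2) ^ 2 + s * (b0 * b2) * c2 + n * c2 ^ 2) := by
  linear_combination (c0 * c1 * b0 * b2 * b1 * c2 * n * 2 + c0 * c1 * b1 * c2 ^ 2 * n * s +
    c0 ^ 2 * c1 ^ 2 * b0 * b2 * c2 * s + c0 ^ 2 * c1 ^ 2 * c2 ^ 2 * s ^ 2) *
      (CharTwo.two_eq_zero : (2 : K) = 0)

/-- With indices for conjugates under `φ`, the left side is `twistedForm` at `z = φ(w b) + φ²(w c)`.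
Since the right side involves only `w1` and `w2`, its product with `w0` has a conjugate cubic form
as trace. -/
theorem twisted_norm_identity [CharP K 2] (b0 b1 b2 c0 c1 c2 s n w0 w1 w2 : K) :
    (b0 * (w2 * b2 + w0 * c0) + c0 * (w0 * b0 + w1 * c1)) ^ 2 + s * (w1 * b1 + w2 * c2) *
      (b0 * (w2 * b2 + w0 * c0) + c0 * (w0 * b0 + w1 * c1)) + n * (w1 * b1 + w2 * c2) ^ 2 =
    ((c0 * c1) ^ 2 + s * (c0 * c1) * b1 + n * b1 ^ 2) * w1 ^ 2 +
      ((b0 * b2) ^ 2 + s * (b0 * b2) * c2 + n * c2 ^ 2) * w2 ^ 2 +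
      s * (b0 * b1 * b2 + c0 * c1 * c2) * (w1 * w2) := by
  linear_combination (b0 * w2 * b2 * c0 * w1 * c1 + b0 * w2 * w0 * c0 * s * c2 +
    b0 * w0 * c0 * w1 * s * b1 + b0 * w0 * c0 ^ 2 * w1 * c1 * 2 + b0 ^ 2 * w2 * b2 * w0 * c0 * 2 +
    b0 ^ 2 * w0 ^ 2 * c0 ^ 2 * 2 + w2 * w1 * b1 * c2 * n) * (CharTwo.two_eq_zero : (2 : K) = 0)

/-- The kernel of the polar form of `twistedForm`. -/
theorem twisted_polar_kernel [CharP K 2] {φ : K ≃ₐ[k] K} (hφ : ∀ x, φ (φ (φ x)) = x) {b c : K}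
    (hbc : b * φ b * φ (φ b) ≠ c * φ c * φ (φ c)) {x z : K} (hz : z ≠ 0)
    (h : b * (φ x * z + x * φ z) + c * (φ (φ x) * z + x * φ (φ z)) = 0) : φ (x / z) = x / z := by
  obtain ⟨y, rfl⟩ : ∃ y, x = y * z := ⟨x / z, (div_mul_cancel₀ x hz).symm⟩
  rw [mul_div_cancel_right₀ _ hz]
  simp only [map_mul] at h
  have hz1 : φ z ≠ 0 := (map_ne_zero φ).2 hz
  have hz2 : φ (φ z) ≠ 0 := (map_ne_zero φ).2 hz1
  have e0 : b * φ z * (φ y + y) = c * φ (φ z) * (φ (φ y) + y) := by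
    rw [← CharTwo.add_eq_zero]
    apply mul_left_cancel₀ hz
    linear_combination h
  have e1 := congrArg φ e0
  have e2 := congrArg φ e1
  simp only [map_mul, map_add, hφ] at e1 e2
  -- Multiplying the three conjugates of `e0`, both sides share the product of the factors `φ y +
  -- y`, up to order; since the norms of `b` and `c` differ, one of these factors vanishes.
  have hprod : (b * φ b * φ (φ b) - c * φ c * φ (φ c)) * (z * φ z * φ (φ z)) *
      ((φ y + y) * (φ (φ y) + φ y) * (φ (φ y) + y)) = 0 := by
    linear_combination (φ b * φ (φ z) * (φ (φ y) + φ y) * φ (φ b) * z * (y + φ (φ y))) * e0 +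
      c * φ (φ z) * (φ (φ y) + y) * φ (φ b) * z * (y + φ (φ y)) * e1 +
      c * φ (φ z) * (φ (φ y) + y) * φ c * z * (y + φ y) * e2
  have hu : φ y + y = 0 := by
    rcases mul_eq_zero.1 hprod with h | h
    · simp only [mul_eq_zero, sub_eq_zero, hbc, hz, hz1, hz2, or_self] at h
    · rcases mul_eq_zero.1 h with h | h
      · rcases mul_eq_zero.1 h with h | h
        · exact h
        · apply φ.injective
          rw [map_add, map_zero, h]
      · apply φ.injective
        apply φ.injective
        rw [map_add, map_add, map_zero, map_zero, hφ, add_comm, h]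
  exact CharTwo.add_eq_zero.1 hu

/-- The polar form of `twistedForm`. -/
def twistedPolar (φ : K ≃ₐ[k] K) (b c z : K) : K →ₗ[k] K where
  toFun x := b * (φ x * z + x * φ z) + c * (φ (φ x) * z + x * φ (φ z))
  map_add' x y := by simp only [map_add]; ring
  map_smul' r x := by
    simp only [Algebra.smul_def, map_mul, AlgEquiv.commutes, RingHom.id_apply]
    ring

/-- For this choice of `z` the terms of `Tr (w B(x, z))` cancel in pairs, so the range lies in a
hyperplane. The kernel is at most the line `k z`, so the range has dimension at least two and fills
it. -/
theorem range_twistedPolar [Finite k] [CharP K 2] (hK : Module.finrank k K = 3)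
    {φ : K ≃ₐ[k] K} (hφ : ∀ x, φ (φ (φ x)) = x)
    (hfix : ∀ x, φ x = x → x ∈ Set.range (algebraMap k K))
    (htr : ∀ x, algebraMap k K (Algebra.trace k K x) = x + φ x + φ (φ x)) {b c : K}
    (hbc : b * φ b * φ (φ b) ≠ c * φ c * φ (φ c)) {w z : K} (hw : w ≠ 0) (hz : z ≠ 0)
    (hwz : z = φ (w * b) + φ (φ (w * c))) {y : K} (hy : Algebra.trace k K (w * y) = 0) :
    ∃ x, twistedPolar φ b c z x = y := by
  have hfd : FiniteDimensional k K := FiniteDimensional.of_finrank_pos (by omega)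
  let T := (Algebra.trace k K).comp (LinearMap.mulLeft k w)
  have hTsurj : Function.Surjective T := (Algebra.trace_surjective k K).comp
    (mul_left_surjective₀ hw)
  have hle : LinearMap.range (twistedPolar φ b c z) ≤ LinearMap.ker T := by
    rintro _ ⟨x, rfl⟩
    rw [LinearMap.mem_ker]
    apply (algebraMap k K).injective
    change algebraMap k K (Algebra.trace k K (w * (b * (φ x * z + x * φ z) +
      c * (φ (φ x) * z + x * φ (φ z))))) = _
    rw [htr, map_zero, hwz]
    simp only [map_add, map_mul, hφ]
    linear_combination (w * b * φ x * φ w * φ b + w * b * φ x * φ (φ w) * φ (φ c) +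
      w * b * φ (φ w) * x * φ (φ b) + w * φ w * φ b * c * φ (φ x) + w * φ w * x * c * φ c +
      w * φ (φ w) * φ (φ c) * c * φ (φ x) + w ^ 2 * b * x * c + φ x * φ w * φ (φ w) * φ (φ c) * φ c +
      φ x * φ w ^ 2 * φ b * φ c + φ w * φ b * φ (φ w) * φ (φ b) * φ (φ x) +
      φ w * φ (φ w) * x * φ (φ b) * φ c + φ (φ w) ^ 2 * φ (φ c) * φ (φ b) * φ (φ x)) *
      (CharTwo.two_eq_zero : (2 : K) = 0)
  have hker : LinearMap.ker (twistedPolar φ b c z) ≤ Submodule.span k {z} := by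
    intro x hx
    obtain ⟨r, hr⟩ := hfix _ (twisted_polar_kernel hφ hbc hz hx)
    rw [Submodule.mem_span_singleton]
    exact ⟨r, by rw [Algebra.smul_def, hr, div_mul_cancel₀ _ hz]⟩
  have h1 := Submodule.finrank_mono hker
  rw [finrank_span_singleton hz] at h1
  have h2 := LinearMap.finrank_range_add_finrank_ker (twistedPolar φ b c z)
  have h3 := LinearMap.finrank_range_add_finrank_ker T
  rw [LinearMap.range_eq_top.2 hTsurj, finrank_top, Module.finrank_self] at h3
  have heq := Submodule.eq_of_le_of_finrank_le hle (by omega)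
  have hmem : y ∈ LinearMap.range (twistedPolar φ b c z) := by
    rw [heq]
    exact hy
  exact hmem

/-- A zero `w` of the cubic form makes `Tr (w f(z) / s)` vanish, so `f(z) / s` is a value of the
polar map and its preimage `x` collides with `x + z`. -/
theorem twistedForm_not_injective [Finite k] [CharP K 2] (hK : Module.finrank k K = 3)
    (h3 : (3 : k) ≠ 0) {φ : K ≃ₐ[k] K} (hφ : ∀ x, φ (φ (φ x)) = x)
    (hfix : ∀ x, φ x = x → x ∈ Set.range (algebraMap k K)) {θ : K} (hθ : φ θ ≠ θ)
    (htr : ∀ x, algebraMap k K (Algebra.trace k K x) = x + φ x + φ (φ x))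
    {b c s n : K} (hs : s ≠ 0) (hn : ∀ y, y ^ 2 + s * y + n ≠ 0)
    (hbc : b * φ b * φ (φ b) ≠ c * φ c * φ (φ c)) :
    ∃ x z, z ≠ 0 ∧ twistedForm φ b c s n (x + z) = twistedForm φ b c s n x := by
  have h2 : (2 : K) = 0 := CharTwo.two_eq_zero
  have he0 : b * φ b * φ (φ b) + c * φ c * φ (φ c) ≠ 0 := fun h0 => hbc (CharTwo.add_eq_zero.1 h0)
  have hφe : φ (b * φ b * φ (φ b) + c * φ c * φ (φ c)) =
      b * φ b * φ (φ b) + c * φ c * φ (φ c) := by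
    simp only [map_add, map_mul, hφ]
    ring
  obtain ⟨w, hw, hG⟩ := exists_scaled_conjForm_eq_zero hK h3 φ hφ hfix hθ hφe he0
    (p := ((c * φ c) ^ 2 + s * (c * φ c) * φ b + n * φ b ^ 2) / s)
    (t := ((b * φ (φ b)) ^ 2 + s * (b * φ (φ b)) * φ (φ c) + n * φ (φ c) ^ 2) / s) (by
      intro y hy
      have hid := twisted_discriminant_identity b (φ b) (φ (φ b)) c (φ c) (φ (φ c)) s n
      generalize (c * φ c) ^ 2 + s * (c * φ c) * φ b + n * φ b ^ 2 = P at hy hid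
      generalize (b * φ (φ b)) ^ 2 + s * (b * φ (φ b)) * φ (φ c) + n * φ (φ c) ^ 2 = T at hy hid
      generalize c * φ c * b * φ (φ b) + φ b * φ (φ c) * n + c * φ c * φ (φ c) * s = u at hid
      generalize b * φ b * φ (φ b) + c * φ c * φ (φ c) = e at hy hid he0
      -- By the discriminant identity a root `y` of `y² + e y + p t` would give this root of `Y² + s
      -- Y + n`.
      refine hn ((s * y + u) / e) ?_
      have hy' : s ^ 2 * (y ^ 2 + e * y) + P * T = 0 := by
        have e1 : s ^ 2 * (P / s * (T / s)) = P * T := by field_simp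
        linear_combination s ^ 2 * hy - e1
      have e2 : ((s * y + u) / e) ^ 2 + s * ((s * y + u) / e) + n =
          ((s * y + u) ^ 2 + s * (s * y + u) * e + n * e ^ 2) / e ^ 2 := by field_simp
      rw [e2, div_eq_zero_iff]
      left
      linear_combination hy' + hid + s * y * u * h2)
  set z := φ (w * b) + φ (φ (w * c)) with hz
  -- If `z = 0`, then `w b = φ(w c)`, and taking norms gives `b` and `c` equal norm.
  have hz0 : z ≠ 0 := by
    intro h0
    have h1 : w * b = φ (w * c) := by
      apply φ.injective
      exact CharTwo.add_eq_zero.1 h0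
    have h2 := congrArg φ h1
    have h3 := congrArg φ h2
    simp only [map_mul, hφ] at h1 h2 h3
    have hw1 : φ w ≠ 0 := (map_ne_zero φ).2 hw
    have hw2 : φ (φ w) ≠ 0 := (map_ne_zero φ).2 hw1
    apply hbc
    apply mul_left_cancel₀ (mul_ne_zero (mul_ne_zero hw hw1) hw2)
    linear_combination φ w * φ b * φ (φ w) * φ (φ b) * h1 + φ w * φ c * φ (φ w) * φ (φ b) * h2 +
      φ w * φ c * φ (φ w) * φ (φ c) * h3
  have hid := twisted_norm_identity b (φ b) (φ (φ b)) c (φ c) (φ (φ c)) s n w (φ w) (φ (φ w))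
  have hfz : twistedForm φ b c s n z / s =
      ((c * φ c) ^ 2 + s * (c * φ c) * φ b + n * φ b ^ 2) / s * φ w ^ 2 +
      ((b * φ (φ b)) ^ 2 + s * (b * φ (φ b)) * φ (φ c) + n * φ (φ c) ^ 2) / s * φ (φ w) ^ 2 +
      (b * φ b * φ (φ b) + c * φ c * φ (φ c)) * (φ w * φ (φ w)) := by
    rw [div_eq_iff hs, twistedForm, hz]
    simp only [map_add, map_mul, hφ]
    rw [hid]
    field_simp
  obtain ⟨x, hx⟩ := range_twistedPolar hK hφ hfix htr hbc hw hz0 hz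
    (y := twistedForm φ b c s n z / s) (by
      apply (algebraMap k K).injective
      rw [htr, map_zero, hfz]
      generalize ((c * φ c) ^ 2 + s * (c * φ c) * φ b + n * φ b ^ 2) / s = p at hG
      generalize ((b * φ (φ b)) ^ 2 + s * (b * φ (φ b)) * φ (φ c) + n * φ (φ c) ^ 2) / s = t at hG
      generalize b * φ b * φ (φ b) + c * φ c * φ (φ c) = e at hG hφe
      simp only [map_add, map_mul, map_pow, hφ, hφe]
      linear_combination hG + e * w * φ w * φ (φ w) * h2)
  refine ⟨x, z, hz0, ?_⟩
  have hx' : s * twistedPolar φ b c z x = twistedForm φ b c s n z := by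
    rw [hx, mul_div_cancel₀ _ hs]
  change s * (b * (φ x * z + x * φ z) + c * (φ (φ x) * z + x * φ (φ z))) = _ at hx'
  simp only [twistedForm, map_add] at hx' ⊢
  linear_combination hx' + ((b * φ x + c * φ (φ x)) * (b * φ z + c * φ (φ z)) + n * x * z) * h2
    + ((b * φ z + c * φ (φ z)) ^ 2 + s * z * (b * φ z + c * φ (φ z)) + n * z ^ 2) * h2

end NotInjective

end FlagSpread

namespace FlagSpread

/-! ### The quadratic extension and its norm. -/

section Quadratic

variable {K F : Type*} [Field K] [Finite K] [Field F] [Algebra K F]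

/-- The conjugation of a quadratic extension of finite fields. -/
theorem exists_conjugation (hF : Module.finrank K F = 2) :
    ∃ σ : F ≃ₐ[K] F, (∀ z, σ z = z ^ Nat.card K) ∧ (∀ z, σ (σ z) = z) ∧
      (∀ z, σ z = z ↔ z ∈ Set.range (algebraMap K F)) := by
  have hfd : FiniteDimensional K F := FiniteDimensional.of_finrank_pos (by omega)
  have hfinF : Finite F := Module.finite_of_finite K
  have := Fintype.ofFinite K
  have := Fintype.ofFinite F
  have hcF : Nat.card F = Nat.card K ^ 2 := by rw [Module.natCard_eq_pow_finrank (K := K), hF]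
  have hσ : ∀ z : F, FiniteField.frobeniusAlgEquivOfAlgebraic K F z = z ^ Nat.card K := fun x => by
    rw [Nat.card_eq_fintype_card]; rfl
  refine ⟨FiniteField.frobeniusAlgEquivOfAlgebraic K F, hσ, fun z => ?_, fun z => ?_⟩
  · rw [hσ, hσ, ← pow_mul, ← pow_two, ← hcF, Nat.card_eq_fintype_card, FiniteField.pow_card]
  · rw [hσ]
    exact pow_card_eq_self_iff

/-- The norm to the subfield `K` of a map `K → F` is bijective if and only if it is injective. -/
theorem bijOn_norm_iff (hF : Module.finrank K F = 2) (h : K → F) :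
    Set.BijOn (fun x => h x ^ (1 + Nat.card K)) Set.univ (Set.range (algebraMap K F)) ↔
      Function.Injective fun x => h x ^ (1 + Nat.card K) := by
  obtain ⟨σ, hσ, hσ2, hσfix⟩ := exists_conjugation hF
  have hmem : ∀ x, h x ^ (1 + Nat.card K) ∈ Set.range (algebraMap K F) := fun x => by
    rw [← hσfix, pow_add, pow_one, ← hσ, map_mul, hσ2, mul_comm]
  choose g hg using hmem
  refine ⟨fun hb => Set.injOn_univ.1 hb.injOn, fun hinj => ⟨fun x _ => ⟨g x, hg x⟩,
    hinj.injOn, ?_⟩⟩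
  rintro _ ⟨y, rfl⟩
  have hginj : Function.Injective g := fun x x' hx => hinj (by
    change h x ^ _ = h x' ^ _
    rw [← hg, ← hg, hx])
  obtain ⟨x, rfl⟩ := Finite.surjective_of_injective hginj y
  exact ⟨x, Set.mem_univ x, (hg x).symm⟩

omit [Finite K] in
/-- The trace and the norm of an element of `F` outside `K`. -/
theorem exists_trace_norm [CharP K 2] {σ : F ≃ₐ[K] F} (hσ2 : ∀ z, σ (σ z) = z)
    (hσfix : ∀ z, σ z = z ↔ z ∈ Set.range (algebraMap K F)) {δ : F}
    (hδ : δ ∉ Set.range (algebraMap K F)) :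
    ∃ s n : K, algebraMap K F s = δ + σ δ ∧ algebraMap K F n = δ * σ δ ∧ s ≠ 0 ∧ n ≠ 0 ∧
      ∀ y, y ^ 2 + s * y + n ≠ 0 := by
  have : CharP F 2 := charP_of_injective_algebraMap (algebraMap K F).injective 2
  obtain ⟨s, hs⟩ := (hσfix (δ + σ δ)).1 (by rw [map_add, hσ2, add_comm])
  obtain ⟨n, hn⟩ := (hσfix (δ * σ δ)).1 (by rw [map_mul, hσ2, mul_comm])
  have hδ0 : δ ≠ 0 := by
    rintro rfl
    exact hδ ⟨0, map_zero _⟩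
  refine ⟨s, n, hs, hn, ?_, ?_, fun y hy => ?_⟩
  · rintro rfl
    rw [map_zero, eq_comm, CharTwo.add_eq_zero, eq_comm] at hs
    exact hδ ((hσfix δ).1 hs)
  · rintro rfl
    rw [map_zero, eq_comm, mul_eq_zero, map_eq_zero, or_self] at hn
    exact hδ0 hn
  · have h := congrArg (algebraMap K F) hy
    simp only [map_add, map_mul, map_pow, map_zero, hs, hn] at h
    have h' : (algebraMap K F y + δ) * (algebraMap K F y + σ δ) = 0 := by linear_combination h
    rcases mul_eq_zero.1 h' with h' | h'
    · exact hδ ⟨y, CharTwo.add_eq_zero.1 h'⟩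
    · apply hδ
      refine ⟨y, ?_⟩
      apply σ.injective
      rw [σ.commutes]
      exact CharTwo.add_eq_zero.1 h'

end Quadratic

/-! ### Injectivity of the norm of `Tr x + δ x`. -/

section TraceForm

variable {k K : Type*} [Field k] [Field K] [Algebra k K]

/-- The norm of `Tr x + δ x`, where `δ` has trace `s` and norm `n`. -/
def traceNormForm (φ : K ≃ₐ[k] K) (s n x : K) : K :=
  (x + φ x + φ (φ x)) ^ 2 + s * x * (x + φ x + φ (φ x)) + n * x ^ 2

theorem exists_sq_eq [Finite K] [CharP K 2] (x : K) : ∃ r, r ^ 2 = x := by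
  obtain ⟨r, hr⟩ := FiniteField.isSquare_of_char_two (ringChar.eq K 2) x
  exact ⟨r, by rw [hr, pow_two]⟩

theorem eq_of_sq_eq_sq [CharP K 2] {x y : K} (h : x ^ 2 = y ^ 2) : x = y := by
  rw [← CharTwo.add_eq_zero] at h ⊢
  rw [← CharTwo.add_sq] at h
  exact pow_eq_zero_iff two_ne_zero |>.1 h

/-- If the quotient `s / n` is not in the subfield, the norm of `Tr x + δ x` is not injective. -/
theorem traceNormForm_not_injective [Finite k] [CharP K 2] (hK : Module.finrank k K = 3)
    {φ : K ≃ₐ[k] K} (hφ : ∀ x, φ (φ (φ x)) = x)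
    (htr : ∀ x, algebraMap k K (Algebra.trace k K x) = x + φ x + φ (φ x))
    {s n : K} (hs : s ≠ 0) (hsn : φ (s / n) ≠ s / n) :
    ¬ Function.Injective (traceNormForm φ s n) := by
  intro hinj
  have h2 : (2 : K) = 0 := CharTwo.two_eq_zero
  have hfd : FiniteDimensional k K := FiniteDimensional.of_finrank_pos (by omega)
  have hfinK : Finite K := Module.finite_of_finite k
  -- It suffices to find `z` with `Tr z = 1` and `Tr (f z / s) = 0`: then `x = f z / s` has trace
  -- zero and `f (x + z) = f x`. As `f z / s = 1 / s + z + (r z)²`, the second condition prescribes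
  -- `Tr (r z)`, independently of `Tr z` because `r ∉ k`.
  obtain ⟨r, hr⟩ := exists_sq_eq (n / s)
  have hrφ : φ r ≠ r := by
    intro h
    apply hsn
    have := congrArg φ hr
    rw [map_pow, h, hr, map_div₀] at this
    rw [map_div₀, ← inv_div, ← this, inv_div]
  have hrφ2 : r + φ (φ r) ≠ 0 := by
    intro h
    rw [CharTwo.add_eq_zero] at h
    have := congrArg φ h
    rw [hφ] at this
    exact hrφ this
  set T : K → K := fun x => x + φ x + φ (φ x) with hT
  have hTφ : ∀ x, φ (T x) = T x := fun x => by
    simp only [hT, map_add, hφ]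
    ring
  obtain ⟨z1, hz1⟩ : ∃ z, T z = 1 := by
    obtain ⟨z, hz⟩ := Algebra.trace_surjective k K 1
    exact ⟨z, by rw [hT]; simp only [← htr, hz, map_one]⟩
  let y := z1 / (r + φ (φ r))
  have hy : T ((r + φ (φ r)) * y) = 1 := by rw [mul_div_cancel₀ _ hrφ2, hz1]
  obtain ⟨v, hv⟩ := exists_sq_eq (T (1 / s) + 1)
  have hvφ : φ v = v := by
    apply eq_of_sq_eq_sq
    rw [← map_pow, hv, map_add, hTφ, map_one]
  let μ := v + T (r * z1)
  have hμφ : φ μ = μ := by rw [map_add, hTφ, hvφ]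
  -- The added term has trace zero and changes `Tr (r z)` by `μ Tr ((r + φ² r) y) = μ`.
  let z := z1 + μ * (y + φ y)
  have hzT : T z = 1 := by
    rw [← hz1]
    simp only [hT, z, map_add, map_mul, hμφ, hφ]
    linear_combination μ * (y + φ y + φ (φ y)) * h2
  have hrz : T (r * z) = v := by
    have : T (r * z) = T (r * z1) + μ * T ((r + φ (φ r)) * y) := by
      simp only [hT, z, map_add, map_mul, hμφ, hφ]
      ring
    rw [this, hy]
    simp only [μ]
    linear_combination T (r * z1) * h2
  have hfz : traceNormForm φ s n z / s = 1 / s + z + (r * z) ^ 2 := by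
    have : z + φ z + φ (φ z) = 1 := hzT
    rw [traceNormForm, this, mul_pow, hr]
    field_simp
  have hTf : T (traceNormForm φ s n z / s) = 0 := by
    have hTsq : ∀ x, T (x ^ 2) = T x ^ 2 := fun x => by
      simp only [hT, map_pow]
      linear_combination -(x * φ x + x * φ (φ x) + φ x * φ (φ x)) * h2
    have hTadd : ∀ x y, T (x + y) = T x + T y := fun x y => by
      simp only [hT, map_add]
      ring
    rw [hfz, hTadd, hTadd, hTsq, hrz, hv, hzT]
    linear_combination (T (1 / s) + 1) * h2
  have hz0 : z ≠ 0 := by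
    intro h0
    rw [h0] at hzT
    simp [hT] at hzT
  have := hinj (a₁ := traceNormForm φ s n z / s + z) (a₂ := traceNormForm φ s n z / s) (by
    generalize hx : traceNormForm φ s n z / s = x at hTf
    have hx' : s * x = traceNormForm φ s n z := by rw [← hx, mul_div_cancel₀ _ hs]
    have e1 : x + φ x + φ (φ x) = 0 := hTf
    have e2 : z + φ z + φ (φ z) = 1 := hzT
    have e3 : x + z + φ (x + z) + φ (φ (x + z)) = 1 := by
      simp only [map_add]
      linear_combination e1 + e2
    rw [traceNormForm, e2] at hx'
    rw [traceNormForm, traceNormForm, e1, e3]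
    linear_combination hx' + (1 + s * z + n * z ^ 2 + n * x * z) * h2)
  exact hz0 (by simpa using this)

/-- If the quotient `s / n` is in the subfield, the norm of `Tr x + δ x` is injective. -/
theorem traceNormForm_injective [CharP K 2] {φ : K ≃ₐ[k] K} (hφ : ∀ x, φ (φ (φ x)) = x)
    {s n : K} (hn : n ≠ 0) (hsn : φ (s / n) = s / n)
    (h1 : 1 + s / n + (1 / n + φ (1 / n) + φ (φ (1 / n))) ≠ 0) :
    Function.Injective (traceNormForm φ s n) := by
  have h2 : (2 : K) = 0 := CharTwo.two_eq_zero
  set T : K → K := fun x => x + φ x + φ (φ x) with hT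
  have hTφ : ∀ x, φ (T x) = T x := fun x => by
    simp only [hT, map_add, hφ]
    ring
  have hTx : ∀ x, x + φ x + φ (φ x) = T x := fun _ => rfl
  have hg : ∀ x, traceNormForm φ s n x / n = x ^ 2 + s / n * x * T x + 1 / n * T x ^ 2 := fun x => by
    rw [traceNormForm, hTx]
    field_simp
    ring
  generalize s / n = c at *
  generalize 1 / n = m at *
  -- Because `c` is fixed by `φ`, the trace of the value depends only on `T x`, and by `h1` it
  -- determines `T x`.
  have hTg : ∀ x, T (x ^ 2 + c * x * T x + m * T x ^ 2) = T x ^ 2 * (1 + c + T m) := fun x => by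
    have e : T (x ^ 2 + c * x * T x + m * T x ^ 2) = T (x ^ 2) + c * T x ^ 2 + T m * T x ^ 2 := by
      rw [← hTx (x ^ 2 + c * x * T x + m * T x ^ 2)]
      simp only [map_add, map_mul, map_pow, hTφ, hsn]
      rw [← hTx (x ^ 2), ← hTx m]
      simp only [map_pow]
      linear_combination c * T x * hTx x
    have e' : T (x ^ 2) = T x ^ 2 := by
      simp only [hT, map_pow]
      linear_combination -(x * φ x + x * φ (φ x) + φ x * φ (φ x)) * h2
    rw [e, e']
    ring
  intro x y hxy
  have hxy' : x ^ 2 + c * x * T x + m * T x ^ 2 = y ^ 2 + c * y * T y + m * T y ^ 2 := by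
    rw [← hg, ← hg, hxy]
  have hTT : T x = T y := by
    apply eq_of_sq_eq_sq
    apply mul_right_cancel₀ h1
    rw [← hTg, ← hTg, hxy']
  rw [hTT] at hxy'
  have hfac : (x + y) * (x + y + c * T y) = 0 := by
    linear_combination hxy' + (y ^ 2 + x * y + c * y * T y) * h2
  rcases mul_eq_zero.1 hfac with h | h
  · exact CharTwo.add_eq_zero.1 h
  -- The trace of `x + y + c T y = 0` leaves `3 c T y = 0`, as `T x = T y`.
  · have hc : c * T y = 0 := by
      have h' : T (x + y + c * T y) = T 0 := by rw [h]
      have e : T (x + y + c * T y) = T x + T y + 3 * (c * T y) := by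
        rw [← hTx (x + y + c * T y)]
        simp only [map_add, map_mul, hTφ, hsn]
        rw [← hTx x, ← hTx y]
        ring
      rw [e, hTT] at h'
      have e0 : T 0 = 0 := by simp [hT]
      rw [e0] at h'
      linear_combination h' - (T y + c * T y) * h2
    rw [hc, add_zero] at h
    exact CharTwo.add_eq_zero.1 h

end TraceForm

end FlagSpread

namespace FlagSpread

/-! ### The criterion for the trace map and its scaled versions. -/

section TraceMap

variable {k K F : Type*} [Field k] [Finite k] [Field K] [Field F] [Algebra k K] [Algebra K F]
  [Algebra k F] [IsScalarTower k K F]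

/-- An element of `F` of trace `c` in `kˣ` and norm `m` over the cubic extension `K` of `k`. -/
theorem one_add_trace_ne_zero [CharP F 2] (hK : Module.finrank k K = 3) {σ : F ≃ₐ[K] F}
    (hσ : ∀ z, σ z = z ^ Nat.card K) {φ : K ≃ₐ[k] K} (hφq : ∀ x, φ x = x ^ Nat.card k) {ε : F}
    {c : k} {m : K} (hc : c ≠ 0) (hεc : ε + σ ε = algebraMap k F c)
    (hεm : ε * σ ε = algebraMap K F m) :
    1 + algebraMap k K c + (m + φ m + φ (φ m)) ≠ 0 := by
  intro h
  have h2 : (2 : F) = 0 := CharTwo.two_eq_zero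
  have := Fintype.ofFinite k
  have hfd : FiniteDimensional k K := FiniteDimensional.of_finrank_pos (by omega)
  have hfinK : Finite K := Module.finite_of_finite k
  let Φ : F →ₐ[k] F := FiniteField.frobeniusAlgHom k F
  have hΦ : ∀ z, Φ z = z ^ Nat.card k := fun z => by rw [Nat.card_eq_fintype_card]; rfl
  have hΦ3 : ∀ z, Φ (Φ (Φ z)) = σ z := fun z => by
    rw [hΦ, hΦ, hΦ, hσ, ← pow_mul, ← pow_mul, Module.natCard_eq_pow_finrank (K := k) (V := K), hK]
    congr 1
    ring
  have hΦK : ∀ x, Φ (algebraMap K F x) = algebraMap K F (φ x) := fun x => by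
    rw [hΦ, hφq, map_pow]
  have hck : algebraMap k F c = algebraMap K F (algebraMap k K c) :=
    IsScalarTower.algebraMap_apply k K F c
  have q0 : ε ^ 2 + algebraMap k F c * ε + algebraMap K F m = 0 := by
    rw [← hεc, ← hεm]
    linear_combination (ε ^ 2 + ε * σ ε) * h2
  have q1 := congrArg Φ q0
  simp only [map_add, map_mul, map_pow, AlgHom.commutes, hΦK, map_zero] at q1
  have q2 := congrArg Φ q1
  simp only [map_add, map_mul, map_pow, AlgHom.commutes, hΦK, map_zero] at q2
  -- The sum of the three conjugate equations `ε² + c ε + m = 0`, with `m + φ m + φ² m = 1 + c`,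
  -- places `ε + Φ ε + Φ² ε` in `k`. Being fixed by `Φ`, it gives `σ ε = Φ³ ε = ε`, hence `c = 0`.
  have hθ : (ε + Φ ε + Φ (Φ ε) + 1) * (ε + Φ ε + Φ (Φ ε) + 1 + algebraMap k F c) = 0 := by
    have h' := congrArg (algebraMap K F) h
    simp only [map_add, map_one, map_zero, ← hck] at h'
    linear_combination q0 + q1 + q2 - h' + (ε * Φ ε + ε * Φ (Φ ε) + Φ ε * Φ (Φ ε) +
      ε + Φ ε + Φ (Φ ε) + 1 + algebraMap k F c) * h2
  have hfix : Φ (ε + Φ ε + Φ (Φ ε)) = ε + Φ ε + Φ (Φ ε) := by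
    rcases mul_eq_zero.1 hθ with h | h
    · have : ε + Φ ε + Φ (Φ ε) = algebraMap k F 1 := by
        rw [map_one]
        exact CharTwo.add_eq_zero.1 h
      rw [this, AlgHom.commutes]
    · have : ε + Φ ε + Φ (Φ ε) = algebraMap k F (1 + c) := by
        rw [map_add, map_one]
        rw [add_assoc] at h
        exact CharTwo.add_eq_zero.1 h
      rw [this, AlgHom.commutes]
  rw [map_add, map_add, hΦ3] at hfix
  apply hc
  apply (algebraMap k F).injective
  rw [map_zero, ← hεc]
  linear_combination hfix + ε * h2

/-- For `δ` outside `K`, the norm of `Tr x + δ x` is injective on `K` if and only if the trace of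
`δ⁻¹` is in `kˣ`. -/
theorem trace_injective_iff [CharP k 2] (hK : Module.finrank k K = 3) (hF : Module.finrank K F = 2)
    {δ : F} (hδ : δ ∉ Set.range (algebraMap K F)) :
    Function.Injective (fun x : K => (algebraMap k F (Algebra.trace k K x) +
      δ * algebraMap K F x) ^ (1 + Nat.card K)) ↔
      ∃ c : k, c ≠ 0 ∧ δ⁻¹ + δ⁻¹ ^ Nat.card K = algebraMap k F c := by
  have : CharP K 2 := charP_of_injective_algebraMap (algebraMap k K).injective 2
  have : CharP F 2 := charP_of_injective_algebraMap (algebraMap k F).injective 2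
  have hfd : FiniteDimensional k K := FiniteDimensional.of_finrank_pos (by omega)
  have hfinK : Finite K := Module.finite_of_finite k
  obtain ⟨φ, hφq, hφ, hfix, ⟨θ, hθ⟩, htr⟩ := exists_frobenius hK
  obtain ⟨σ, hσ, hσ2, hσfix⟩ := exists_conjugation hF
  obtain ⟨s, n, hs, hn, hs0, hn0, -⟩ := exists_trace_norm hσ2 hσfix hδ
  have hck : ∀ c, algebraMap k F c = algebraMap K F (algebraMap k K c) :=
    IsScalarTower.algebraMap_apply k K F
  have hform : ∀ x : K, (algebraMap k F (Algebra.trace k K x) +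
      δ * algebraMap K F x) ^ (1 + Nat.card K) = algebraMap K F (traceNormForm φ s n x) := by
    intro x
    rw [pow_add, pow_one, ← hσ, hck, htr, traceNormForm]
    generalize x + φ x + φ (φ x) = t
    simp only [map_add, map_mul, map_pow, AlgEquiv.commutes, hs, hn]
    ring
  have hinj : Function.Injective (fun x : K => (algebraMap k F (Algebra.trace k K x) +
      δ * algebraMap K F x) ^ (1 + Nat.card K)) ↔ Function.Injective (traceNormForm φ s n) := by
    simp only [hform]
    exact (algebraMap K F).injective.of_comp_iff _
  have hδ0 : δ ≠ 0 := by
    rintro rfl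
    exact hδ ⟨0, map_zero _⟩
  have hσδ0 : σ δ ≠ 0 := (map_ne_zero σ).2 hδ0
  have hinv : δ⁻¹ + δ⁻¹ ^ Nat.card K = algebraMap K F (s / n) := by
    rw [← hσ, map_inv₀, map_div₀, hs, hn]
    field_simp
    ring
  rw [hinj, hinv]
  constructor
  · intro h
    by_contra hcon
    refine traceNormForm_not_injective hK hφ htr hs0 (fun hsn => hcon ?_) h
    obtain ⟨c, hc⟩ := hfix _ hsn
    refine ⟨c, ?_, by rw [hck, hc]⟩
    rintro rfl
    rw [map_zero, eq_comm, div_eq_zero_iff] at hc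
    exact hc.elim hs0 hn0
  · rintro ⟨c, hc0, hc⟩
    have hcK : s / n = algebraMap k K c := (algebraMap K F).injective (by rw [hc, hck])
    refine traceNormForm_injective hφ hn0 (by rw [hcK, φ.commutes]) ?_
    rw [hcK]
    refine one_add_trace_ne_zero hK hσ hφq (ε := δ⁻¹) hc0 ?_ ?_
    · rw [← hc, ← hinv, hσ]
    · rw [map_inv₀, map_div₀, map_one, hn]
      field_simp

/-- The analogue of `trace_injective_iff` for a scaled trace. -/
theorem scaled_trace_injective_iff [CharP k 2] (hK : Module.finrank k K = 3)
    (hF : Module.finrank K F = 2) {δ : F} (hδ : δ ∉ Set.range (algebraMap K F)) {u : K}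
    (hu : u ≠ 0) :
    Function.Injective (fun x : K => (algebraMap K F u⁻¹ * algebraMap k F (Algebra.trace k K
      (u ^ Nat.card k * x)) + δ * algebraMap K F x) ^ (1 + Nat.card K)) ↔
      ∃ c : k, c ≠ 0 ∧ δ⁻¹ + δ⁻¹ ^ Nat.card K =
        algebraMap K F (u ^ (1 - (Nat.card k : ℤ))) * algebraMap k F c := by
  have hfd : FiniteDimensional k K := FiniteDimensional.of_finrank_pos (by omega)
  have hfinK : Finite K := Module.finite_of_finite k
  set q := Nat.card k with hq
  set i := algebraMap K F with hi
  have hu' : i u ≠ 0 := (map_ne_zero i).2 hu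
  have hw : u ^ (1 - (q : ℤ)) = u / u ^ q := by
    rw [zpow_sub₀ hu, zpow_one, zpow_natCast]
  have hδ' : δ * i (u / u ^ q) ∉ Set.range i := by
    rintro ⟨y, hy⟩
    refine hδ ⟨y / (u / u ^ q), ?_⟩
    rw [map_div₀, hy, mul_div_cancel_right₀]
    exact (map_ne_zero i).2 (div_ne_zero hu (pow_ne_zero q hu))
  have key := trace_injective_iff hK hF hδ'
  have hpowK : ∀ x : K, i x ^ Nat.card K = i x := fun x => pow_card_eq_self_iff.2 ⟨x, rfl⟩
  -- With `y = u ^ q x` the map becomes `u⁻¹ (Tr y + δ u ^ (1 - q) y)`.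
  have e1 : Function.Injective (fun x : K => (i u⁻¹ * algebraMap k F (Algebra.trace k K
      (u ^ q * x)) + δ * i x) ^ (1 + Nat.card K)) ↔
      Function.Injective (fun x : K => (algebraMap k F (Algebra.trace k K x) +
      δ * i (u / u ^ q) * i x) ^ (1 + Nat.card K)) := by
    have hsurj : Function.Surjective (fun x : K => u ^ q * x) :=
      mul_left_surjective₀ (pow_ne_zero q hu)
    have hinj : Function.Injective (fun x : K => u ^ q * x) :=
      mul_right_injective₀ (pow_ne_zero q hu)
    have hscale : ∀ x : K, (i u⁻¹ * algebraMap k F (Algebra.trace k K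
        (u ^ q * x)) + δ * i x) ^ (1 + Nat.card K) = i u⁻¹ ^ (1 + Nat.card K) *
        (algebraMap k F (Algebra.trace k K (u ^ q * x)) +
          δ * i (u / u ^ q) * i (u ^ q * x)) ^ (1 + Nat.card K) := fun x => by
      rw [← mul_pow]
      congr 1
      simp only [map_mul, map_div₀, map_pow, map_inv₀]
      field_simp
    have hinj2 : Function.Injective (fun y : F => i u⁻¹ ^ (1 + Nat.card K) * y) :=
      mul_right_injective₀ (pow_ne_zero _ ((map_ne_zero i).2 (inv_ne_zero hu)))
    simp only [hscale]
    constructor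
    · intro h x y hxy
      obtain ⟨x, rfl⟩ := hsurj x
      obtain ⟨y, rfl⟩ := hsurj y
      rw [h (congrArg (fun z => i u⁻¹ ^ (1 + Nat.card K) * z) hxy)]
    · intro h x y hxy
      exact hinj (h (hinj2 hxy))
  rw [e1, key, hw]
  refine exists_congr fun c => and_congr_right fun _ => ?_
  rw [mul_inv, mul_pow, ← map_inv₀ i, hpowK, ← add_mul, map_inv₀, mul_comm (i (u / u ^ q)),
    ← div_eq_mul_inv, div_eq_iff ((map_ne_zero i).2 (div_ne_zero hu (pow_ne_zero q hu)))]

end TraceMap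

end FlagSpread

namespace FlagSpread

/-! ### General `q`-polynomials and Hilbert's theorem 90. -/

section GeneralMap

open Polynomial

/-- A reduced `q`-polynomial over a field with `q ^ 3` elements has at most three terms. -/
theorem IsQPolynomial.eq_sum {K : Type*} [Field K] {q : ℕ} (hq : 2 ≤ q) {L : K[X]}
    (hL : IsQPolynomial q L) (hdeg : L.natDegree ≤ q ^ 3 - 1) :
    L = C (L.coeff 1) * X + C (L.coeff q) * X ^ q + C (L.coeff (q ^ 2)) * X ^ q ^ 2 := by
  have h12 : q ≠ q ^ 2 := (lt_self_pow₀ (by omega) (by norm_num)).ne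
  have h02 : 1 ≠ q ^ 2 := (Nat.one_lt_pow (by norm_num) (by omega)).ne
  have h01 : 1 ≠ q := by omega
  ext m
  simp only [coeff_add, coeff_C_mul, coeff_X, coeff_X_pow]
  by_cases hm : m ∈ L.support
  · obtain ⟨i, rfl⟩ := hL m hm
    have hi : q ^ i < q ^ 3 := by
      have := (le_natDegree_of_mem_supp _ hm).trans hdeg
      have : 0 < q ^ 3 := by positivity
      omega
    have hi3 : i < 3 := (Nat.pow_lt_pow_iff_right (by omega)).1 hi
    interval_cases i
    · simp [h02, h01]
    · simp [h12, h01]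
    · simp [h12.symm, h02]
  · have h0 := notMem_support_iff.1 hm
    rw [h0]
    have hterm : ∀ j, L.coeff j * (if m = j then 1 else 0) = 0 := fun j => by
      split_ifs with h
      · rw [← h, h0, zero_mul]
      · rw [mul_zero]
    rw [hterm, hterm]
    have := hterm 1
    simp only [eq_comm (a := m)] at this
    rw [this]
    simp

/-- Hilbert's theorem 90 for a cyclic cubic extension. -/
theorem exists_mul_apply_eq_self {k K : Type*} [Field k] [Field K] [Algebra k K] (φ : K ≃ₐ[k] K)
    (hφ : ∀ x, φ (φ (φ x)) = x) {θ : K} (hθ : φ θ ≠ θ) {α : K} (hα : α * φ α * φ (φ α) = 1) :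
    ∃ u : K, u ≠ 0 ∧ α * φ u = u := by
  have hθ1 : φ (φ θ) ≠ φ θ := fun h => hθ (φ.injective h)
  have hθ2 : φ (φ θ) ≠ θ := fun h => hθ (by
    have := congrArg φ h
    rw [hφ] at this
    exact this.symm)
  by_contra hno
  -- Any nonzero value of this resolvent would be a solution. Its vanishing at `1`, `θ`, `θ²`
  -- contradicts the independence of `id`, `φ`, `φ²`.
  have hf : ∀ w, w + α * φ w + α * φ α * φ (φ w) = 0 := fun w => by
    by_contra hw
    refine hno ⟨_, hw, ?_⟩
    simp only [map_add, map_mul, hφ]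
    linear_combination w * hα
  have h0 := hf 1
  have h1 := hf θ
  have h2 := hf (θ ^ 2)
  simp only [map_one, map_pow] at h0 h1 h2
  have h : α * φ α * ((φ (φ θ) - θ) * (φ (φ θ) - φ θ)) = 0 := by
    linear_combination h2 - (θ + φ θ) * h1 + θ * φ θ * h0
  rw [mul_eq_zero, mul_eq_zero (a := φ (φ θ) - θ), sub_eq_zero, sub_eq_zero] at h
  rcases h with h | h | h
  · rw [h, zero_mul] at hα
    exact zero_ne_one hα
  · exact hθ2 h
  · exact hθ1 h

variable {k K F : Type*} [Field k] [Finite k] [Field K] [Field F] [Algebra k K] [Algebra K F]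
  [Algebra k F] [IsScalarTower k K F]

omit [Algebra k F] [IsScalarTower k K F] in
/-- If the norm of `b φ(x) + c φ²(x) + δ x` is injective on `K`, then `b` and `c` have the same
norm. -/
theorem exists_ratio_of_injective [CharP k 2] (hK : Module.finrank k K = 3)
    (hF : Module.finrank K F = 2) {φ : K ≃ₐ[k] K} (hφ : ∀ x, φ (φ (φ x)) = x)
    (hfix : ∀ x, φ x = x → x ∈ Set.range (algebraMap k K)) {θ : K} (hθ : φ θ ≠ θ)
    (htr : ∀ x, algebraMap k K (Algebra.trace k K x) = x + φ x + φ (φ x)) {b c : K}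
    (hbc : ¬ (b = 0 ∧ c = 0)) {δ : F} (hδ : δ ∉ Set.range (algebraMap K F))
    (hinj : Function.Injective (fun x : K =>
      (algebraMap K F (b * φ x + c * φ (φ x)) + δ * algebraMap K F x) ^ (1 + Nat.card K))) :
    c ≠ 0 ∧ ∃ u : K, u ≠ 0 ∧ c * φ (φ u) = b * u := by
  have : CharP K 2 := charP_of_injective_algebraMap (algebraMap k K).injective 2
  have hfd : FiniteDimensional k K := FiniteDimensional.of_finrank_pos (by omega)
  have hfinK : Finite K := Module.finite_of_finite k
  obtain ⟨σ, hσ, hσ2, hσfix⟩ := exists_conjugation hF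
  obtain ⟨s, n, hs, hn, hs0, hn0, hsn⟩ := exists_trace_norm hσ2 hσfix hδ
  have hform : ∀ x : K, (algebraMap K F (b * φ x + c * φ (φ x)) + δ * algebraMap K F x) ^
      (1 + Nat.card K) = algebraMap K F (twistedForm φ b c s n x) := by
    intro x
    rw [pow_add, pow_one, ← hσ, twistedForm]
    generalize b * φ x + c * φ (φ x) = t
    simp only [map_add, map_mul, map_pow, AlgEquiv.commutes, hs, hn]
    ring
  have hN : b * φ b * φ (φ b) = c * φ c * φ (φ c) := by
    by_contra hbc
    obtain ⟨x, z, hz, h⟩ := twistedForm_not_injective hK (by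
      intro h
      have h2 : (2 : k) = 0 := CharTwo.two_eq_zero
      exact one_ne_zero (by linear_combination h - h2 : (1 : k) = 0)) hφ hfix hθ htr hs0 hsn hbc
    exact hz (by simpa using hinj (a₁ := x + z) (a₂ := x) (by simp only [hform, h]))
  have hc0 : c ≠ 0 := by
    rintro rfl
    exact hbc ⟨by simpa using hN, rfl⟩
  refine ⟨hc0, ?_⟩
  have hc1 : φ c ≠ 0 := (_root_.map_ne_zero φ).2 hc0
  have hc2 : φ (φ c) ≠ 0 := (_root_.map_ne_zero φ).2 hc1
  obtain ⟨u, hu, hu'⟩ := exists_mul_apply_eq_self φ hφ hθ (α := φ (b / c)) (by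
    rw [hφ]
    simp only [map_div₀]
    field_simp
    linear_combination hN)
  have := congrArg (fun x => φ (φ x)) hu'
  simp only [map_mul, hφ] at this
  refine ⟨u, hu, ?_⟩
  rw [← this]
  field_simp

/-- If the norm of `L x + δ x` is injective on `K`, then `L x + δ x` is a scaled trace plus a
multiple of `x`. -/
theorem exists_scaled_trace [CharP k 2] (hK : Module.finrank k K = 3)
    (hF : Module.finrank K F = 2) {L : K[X]} (hmonic : L.Monic)
    (hdeg : L.natDegree ≤ Nat.card k ^ 3 - 1) (hL : IsQPolynomial (Nat.card k) L) (hLX : L ≠ X)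
    {δ : F} (hδ : δ ∉ Set.range (algebraMap K F))
    (hinj : Function.Injective (fun x : K =>
      (algebraMap K F (L.eval x) + δ * algebraMap K F x) ^ (1 + Nat.card K))) :
    ∃ (δ' : F) (u : K), δ' ∉ Set.range (algebraMap K F) ∧ u ≠ 0 ∧
      ∀ x : K, algebraMap K F (L.eval x) + δ * algebraMap K F x =
        algebraMap K F u⁻¹ * algebraMap k F (Algebra.trace k K (u ^ Nat.card k * x)) +
          δ' * algebraMap K F x := by
  have : CharP F 2 := charP_of_injective_algebraMap (algebraMap k F).injective 2
  have hq : 2 ≤ Nat.card k := Finite.one_lt_card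
  obtain ⟨φ, hφq, hφ, hfix, ⟨θ, hθ⟩, htr⟩ := exists_frobenius hK
  have hck : ∀ c, algebraMap k F c = algebraMap K F (algebraMap k K c) :=
    IsScalarTower.algebraMap_apply k K F
  have hsum := hL.eq_sum hq hdeg
  set a := L.coeff 1
  set b := L.coeff (Nat.card k) with hb
  set c := L.coeff (Nat.card k ^ 2) with hc
  have heval : ∀ x, L.eval x = a * x + (b * φ x + c * φ (φ x)) := fun x => by
    rw [hsum, hφq, hφq, ← pow_mul, ← pow_two]
    simp only [eval_add, eval_mul, eval_C, eval_X, eval_pow]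
    ring
  have hδa : ∀ y, δ + algebraMap K F y ∉ Set.range (algebraMap K F) := by
    rintro y ⟨x, hx⟩
    exact hδ ⟨x - y, by rw [map_sub, hx, add_sub_cancel_right]⟩
  obtain ⟨hc0, u, hu, hub⟩ := exists_ratio_of_injective hK hF hφ hfix hθ htr (b := b) (c := c) (by
      rintro ⟨hb0, hc0⟩
      rw [hb0, hc0] at hsum
      simp only [map_zero, zero_mul, add_zero] at hsum
      have ha : a = 1 := by
        have := hmonic
        rw [hsum, Monic.def, leadingCoeff_C_mul_X] at this
        exact this
      rw [ha, map_one, one_mul] at hsum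
      exact hLX hsum) (hδa a) (by
      convert hinj using 3 with x
      rw [heval]
      simp only [map_add, map_mul]
      ring)
  -- As `c ≠ 0`, the degree is `q ^ 2` and `c` is the leading coefficient of a monic polynomial.
  have hc1 : c = 1 := by
    have hd : L.natDegree = Nat.card k ^ 2 := by
      refine le_antisymm ?_ (le_natDegree_of_ne_zero hc0)
      have h1 : 1 ≤ Nat.card k ^ 2 := Nat.one_le_pow _ _ (by omega)
      have h2 : Nat.card k ≤ Nat.card k ^ 2 := Nat.le_self_pow (by norm_num) _
      rw [hsum]
      refine natDegree_add_le_of_degree_le (natDegree_add_le_of_degree_le ?_ ?_) ?_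
      · exact ((natDegree_C_mul_le _ _).trans natDegree_X_le).trans h1
      · exact (natDegree_C_mul_X_pow_le b _).trans h2
      · exact natDegree_C_mul_X_pow_le c _
    rw [hc, ← hd]
    exact hmonic
  rw [hc1, one_mul] at hub
  -- The scaled trace contains the linear term `(φ u / u) x`, which `δ'` must cancel in
  -- characteristic two.
  refine ⟨δ + algebraMap K F (a + φ u / u), u, hδa _, hu, fun x => ?_⟩
  rw [hck, htr, heval, ← map_mul, ← hφq]
  have hu' : algebraMap K F u ≠ 0 := (_root_.map_ne_zero _).2 hu
  have htrace : φ u * x + φ (φ u * x) + φ (φ (φ u * x)) =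
      φ u * x + b * u * φ x + u * φ (φ x) := by
    simp only [map_mul, hφ]
    rw [hub]
  rw [htrace, hc1]
  simp only [map_add, map_mul, map_div₀, map_inv₀, map_one]
  field_simp
  linear_combination -(algebraMap K F x * algebraMap K F (φ u)) *
    (CharTwo.two_eq_zero : (2 : F) = 0)

end GeneralMap

end FlagSpread

namespace FlagSpread

/-! ### Multiplications acting on subspaces. -/

section Theta

variable {k F : Type*} [Field k] [Field F] [Algebra k F]

theorem mem_Theta_smul {a : Fˣ} {W : Submodule k F} {v : F} :
    v ∈ Theta k F a • W ↔ ∃ w ∈ W, (a : F) * w = v := by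
  rw [← SetLike.mem_coe, coe_smul_submodule]
  rfl

theorem finrank_Theta_smul (a : Fˣ) (W : Submodule k F) :
    Module.finrank k (Theta k F a • W : Submodule k F) = Module.finrank k W := by
  have h : (Theta k F a • W : Submodule k F) = W.map (LinearMap.mulLeft k (a : F)) := by
    ext v
    rw [mem_Theta_smul]
    rfl
  rw [h]
  exact (Submodule.equivMapOfInjective _ (mul_right_injective₀ a.ne_zero) W).finrank_eq.symm

theorem Theta_smul_eq_of_scalar {c : k} (hc : c ≠ 0) {a b : Fˣ} (h : (a : F) = b * algebraMap k F c)
    (W : Submodule k F) : Theta k F a • W = Theta k F b • W := by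
  ext v
  rw [mem_Theta_smul, mem_Theta_smul]
  constructor
  · rintro ⟨w, hw, rfl⟩
    exact ⟨c • w, W.smul_mem c hw, by rw [h, Algebra.smul_def, mul_assoc]⟩
  · rintro ⟨w, hw, rfl⟩
    refine ⟨c⁻¹ • w, W.smul_mem _ hw, ?_⟩
    rw [h, Algebra.smul_def, map_inv₀, mul_assoc, mul_inv_cancel_left₀]
    exact (map_ne_zero _).2 hc

theorem mem_orbit_Theta_iff {β : Fˣ} {W U : Submodule k F} :
    U ∈ MulAction.orbit (Subgroup.zpowers (Theta k F β)) W ↔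
      ∃ a ∈ Subgroup.zpowers β, U = Theta k F a • W := by
  constructor
  · rintro ⟨⟨_, i, rfl⟩, rfl⟩
    exact ⟨β ^ i, ⟨i, rfl⟩, by rw [map_zpow]; rfl⟩
  · rintro ⟨_, ⟨i, rfl⟩, rfl⟩
    exact ⟨⟨Theta k F β ^ i, i, rfl⟩, by rw [map_zpow]; rfl⟩

theorem mem_zpowers_of_pow_orderOf_eq_one {β a : Fˣ} (hβ : orderOf β ≠ 0) (ha : a ^ orderOf β = 1) :
    a ∈ Subgroup.zpowers β := by
  have : NeZero (orderOf β) := ⟨hβ⟩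
  have hprim : IsPrimitiveRoot β (orderOf β) := IsPrimitiveRoot.orderOf β
  rw [IsPrimitiveRoot.zpowers_eq hprim]
  exact ha

end Theta

/-! ### The orbit is a spread. -/

section Orbit

variable {k K F : Type*} [Field k] [Finite k] [Field K] [Field F] [Algebra k K] [Algebra K F]
  [Algebra k F] [IsScalarTower k K F]

/-- The orbit of an image on which the norm is injective is a spread. -/
theorem isSpread_traceOrbit [CharP k 2] (hK : Module.finrank k K = 3)
    (hF : Module.finrank K F = 2) {β : Fˣ}
    (hβ : orderOf β = (Nat.card K + 1) * (Nat.card k - 1)) {δ : F}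
    (hinj : Function.Injective (fun x : K => (algebraMap k F (Algebra.trace k K x) +
      δ * algebraMap K F x) ^ (1 + Nat.card K))) :
    IsSpread k (traceOrbit k K β δ) := by
  have hfd : FiniteDimensional k K := FiniteDimensional.of_finrank_pos (by omega)
  have hfinK : Finite K := Module.finite_of_finite k
  have hq : 2 ≤ Nat.card k := Finite.one_lt_card
  have hβ0 : orderOf β ≠ 0 := by
    rw [hβ]
    exact mul_ne_zero (by omega) (by omega)
  let h : K →ₗ[k] F := traceMap (K := K) k δ
  have hh : Function.Injective h := fun x y hxy => hinj (congrArg (· ^ (1 + Nat.card K)) hxy)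
  have hbij := (bijOn_norm_iff hF (fun x : K => algebraMap k F (Algebra.trace k K x) +
      δ * algebraMap K F x)).2 hinj
  have hnorm : ∀ v : F, v ^ (1 + Nat.card K) ∈ Set.range (algebraMap K F) := by
    obtain ⟨σ, hσ, hσ2, hσfix⟩ := exists_conjugation hF
    intro v
    rw [← hσfix, pow_add, pow_one, ← hσ, map_mul, hσ2, mul_comm]
  constructor
  · intro U hU
    obtain ⟨a, -, rfl⟩ := mem_orbit_Theta_iff.1 hU
    rw [finrank_Theta_smul, LinearMap.finrank_range_of_inj hh, hK,
      ← Module.finrank_mul_finrank k K F, hK, hF]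
  · intro v hv
    obtain ⟨x, -, hx⟩ := hbij.surjOn (hnorm v)
    change h x ^ (1 + Nat.card K) = v ^ (1 + Nat.card K) at hx
    have hx0 : h x ≠ 0 := by
      intro h0
      rw [h0, zero_pow (by omega)] at hx
      exact hv (pow_eq_zero_iff (by omega) |>.1 hx.symm)
    -- The points `v` and `h x` have the same norm, so `a` has norm one and is a power of `β`.
    let a : Fˣ := Units.mk0 v hv / Units.mk0 (h x) hx0
    have ha : (a : F) = v / h x := by simp [a]
    have hamem : a ∈ Subgroup.zpowers β := by
      apply mem_zpowers_of_pow_orderOf_eq_one hβ0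
      apply Units.ext
      rw [hβ, Units.val_pow_eq_pow_val, ha, pow_mul, div_pow, add_comm (Nat.card K), ← hx,
        div_self (pow_ne_zero _ hx0), one_pow, Units.val_one]
    refine ⟨Theta k F a • LinearMap.range h, ⟨mem_orbit_Theta_iff.2 ⟨a, hamem, rfl⟩,
      mem_Theta_smul.2 ⟨h x, ⟨x, rfl⟩, by rw [ha, div_mul_cancel₀ _ hx0]⟩⟩, ?_⟩
    rintro U ⟨hU, hvU⟩
    obtain ⟨b, ⟨i, rfl⟩, rfl⟩ := mem_orbit_Theta_iff.1 hU
    obtain ⟨_, ⟨y, rfl⟩, hy⟩ := mem_Theta_smul.1 hvU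
    set b : Fˣ := β ^ i with hb
    change (b : F) * h y = v at hy
    have hbN : (b ^ (1 + Nat.card K)) ^ (Nat.card k - 1) = 1 := by
      rw [← pow_mul, add_comm 1, ← hβ, hb, ← zpow_natCast, zpow_comm, zpow_natCast,
        pow_orderOf_eq_one, one_zpow]
    obtain ⟨c, hc⟩ : ((b : F) ^ (1 + Nat.card K)) ∈ Set.range (algebraMap k F) := by
      rw [← pow_card_eq_self_iff]
      have h1 := congrArg Units.val hbN
      rw [Units.val_pow_eq_pow_val, Units.val_pow_eq_pow_val, Units.val_one] at h1
      rw [← Nat.sub_add_cancel (by omega : 1 ≤ Nat.card k), pow_succ, h1, one_mul]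
    -- On `k` the norm is squaring, so the norm of `b`, which lies in `k`, is the norm of a scalar
    -- `r`. Injectivity gives `r y = x`, and `a`, `b` differ by a scalar.
    obtain ⟨r, hr⟩ := exists_sq_eq c
    have hrF : algebraMap k F r ^ (1 + Nat.card K) = (b : F) ^ (1 + Nat.card K) := by
      rw [← hc, ← hr, pow_add, pow_one, IsScalarTower.algebraMap_apply k K F,
        pow_card_eq_self_iff.2 ⟨_, rfl⟩, ← pow_two, IsScalarTower.algebraMap_apply k K F, ← map_pow,
        ← map_pow]
    have hr0 : r ≠ 0 := by
      rintro rfl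
      rw [map_zero, zero_pow (by omega)] at hrF
      exact pow_ne_zero _ b.ne_zero hrF.symm
    have hxy : r • y = x := by
      apply hinj
      change h (r • y) ^ (1 + Nat.card K) = h x ^ (1 + Nat.card K)
      rw [hx, ← hy, map_smul, Algebra.smul_def, mul_pow, mul_pow, hrF]
    symm
    have hy0 : h y ≠ 0 := by
      intro h0
      rw [h0, mul_zero] at hy
      exact hv hy.symm
    refine Theta_smul_eq_of_scalar (c := r⁻¹) (inv_ne_zero hr0) ?_ _
    have hr0' : algebraMap k F r ≠ 0 := (map_ne_zero _).2 hr0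
    rw [ha, div_eq_iff hx0, ← hxy, map_smul, Algebra.smul_def, ← hy, map_inv₀]
    field_simp
    rfl

end Orbit

end FlagSpread

namespace FlagSpread

/-! ### Spreads and the semilinear group. -/

section Spreads

variable {k V : Type*} [Field k] [Finite k] [AddCommGroup V] [Module k V] [Module.Finite k V]

theorem finrank_GammaL_smul (g : GammaL k V) (W : Submodule k V) :
    Module.finrank k (g • W : Submodule k V) = Module.finrank k W := by
  have h : Nat.card (g • W : Submodule k V) = Nat.card W := by
    refine (Nat.card_congr ((g : Equiv.Perm V).image (W : Set V))).symm
  rw [Module.natCard_eq_pow_finrank (K := k) (V := ↥(g • W)),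
    Module.natCard_eq_pow_finrank (K := k) (V := W)] at h
  exact Nat.pow_right_injective Finite.one_lt_card h

omit [Finite k] [Module.Finite k V] in
theorem mem_GammaL_smul {g : GammaL k V} {W : Submodule k V} {v : V} :
    v ∈ g • W ↔ ∃ w ∈ W, (g : Equiv.Perm V) w = v := by
  rw [← SetLike.mem_coe, coe_smul_submodule]
  rfl

theorem IsSpread.smul {S : Set (Submodule k V)} (hS : IsSpread k S) (g : GammaL k V) :
    IsSpread k (g • S) := by
  constructor
  · rintro _ ⟨W, hW, rfl⟩
    change 2 * Module.finrank k (g • W : Submodule k V) = _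
    rw [finrank_GammaL_smul, hS.1 W hW]
  · intro v hv
    have hv' : (g : Equiv.Perm V)⁻¹ v ≠ 0 := by
      intro h
      apply hv
      rw [Equiv.Perm.inv_eq_iff_eq] at h
      rw [h]
      have := g.2.1 0 0
      simpa using this
    have hmem : ∀ W : Submodule k V, v ∈ W ↔ (g : Equiv.Perm V)⁻¹ v ∈ g⁻¹ • W := by
      intro W
      rw [mem_GammaL_smul]
      constructor
      · intro h
        exact ⟨v, h, rfl⟩
      · rintro ⟨w, hw, h⟩
        rwa [← (g : Equiv.Perm V)⁻¹.injective h]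
    obtain ⟨W, ⟨hW, hvW⟩, huniq⟩ := hS.2 _ hv'
    refine ⟨g • W, ⟨Set.smul_mem_smul_set hW, ?_⟩, ?_⟩
    · rw [hmem, inv_smul_smul]
      exact hvW
    · rintro U ⟨hU, hvU⟩
      rw [Set.mem_smul_set_iff_inv_smul_mem] at hU
      rw [← huniq (g⁻¹ • U) ⟨hU, (hmem U).1 hvU⟩, smul_inv_smul]

omit [Finite k] [Module.Finite k V] in
theorem IsSpread.eq_of_mem {S : Set (Submodule k V)} (hS : IsSpread k S) {U W : Submodule k V}
    (hU : U ∈ S) (hW : W ∈ S) {v : V} (hv : v ≠ 0) (hvU : v ∈ U) (hvW : v ∈ W) : U = W :=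
  (hS.2 v hv).unique ⟨hU, hvU⟩ ⟨hW, hvW⟩

omit [Finite k] [Module.Finite k V] in
/-- A spread that is contained in another spread is equal to it. -/
theorem IsSpread.eq_of_subset {S T : Set (Submodule k V)} (hS : IsSpread k S) (hT : IsSpread k T)
    (hTS : T ⊆ S) (hV : 0 < Module.finrank k V) : T = S := by
  refine Set.Subset.antisymm hTS fun U hU => ?_
  have hU0 : U ≠ ⊥ := by
    rintro rfl
    have := hS.1 _ hU
    rw [finrank_bot] at this
    omega
  obtain ⟨v, hvU, hv⟩ := U.exists_mem_ne_zero_of_ne_bot hU0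
  obtain ⟨W, ⟨hW, hvW⟩, -⟩ := hT.2 v hv
  rwa [hS.eq_of_mem hU (hTS hW) hv hvU hvW]

end Spreads

/-! ### Spreads invariant under a subgroup of the Singer group. -/

section SingerInvariant

variable {k K F : Type*} [Field k] [Finite k] [Field K] [Field F] [Algebra k K] [Algebra K F]
  [Algebra k F] [IsScalarTower k K F]

omit [Finite k] in
theorem Theta_injective : Function.Injective (Theta k F) := by
  intro a b h
  have := congrArg (fun g : GammaL k F => (g : Equiv.Perm F) 1) h
  apply Units.ext
  simpa [Theta] using this

omit [Finite k] in
/-- A subgroup that meets the Singer group in a group of the order of `β` contains `Θ(β)`. -/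
theorem Theta_mem_of_card [Finite F] {H : Subgroup (GammaL k F)} {β : Fˣ}
    (h : Nat.card (H ⊓ (Theta k F).range : Subgroup (GammaL k F)) = orderOf β) :
    Theta k F β ∈ H := by
  have hcard : Nat.card (H.comap (Theta k F)) = orderOf β := by
    rw [← h, inf_comm, ← Subgroup.map_comap_eq]
    exact Nat.card_congr ((H.comap (Theta k F)).equivMapOfInjective _ Theta_injective).toEquiv
  have hle : H.comap (Theta k F) ≤ Subgroup.zpowers β := by
    intro a ha
    apply mem_zpowers_of_pow_orderOf_eq_one (orderOf_pos β).ne'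
    rw [← hcard]
    have := pow_card_eq_one' (x := (⟨a, ha⟩ : H.comap (Theta k F)))
    exact congrArg Subtype.val this
  have heq := Subgroup.eq_of_le_of_card_ge hle (by rw [hcard, Nat.card_zpowers])
  have : β ∈ H.comap (Theta k F) := heq ▸ Subgroup.mem_zpowers β
  exact this

omit [Finite k] in
theorem Theta_smul_spread {S : Set (Submodule k F)} {β : Fˣ} (hβ : Theta k F β • S = S) {a : Fˣ}
    (ha : a ∈ Subgroup.zpowers β) : Theta k F a • S = S := by
  obtain ⟨i, rfl⟩ := ha
  have : Theta k F β ∈ MulAction.stabilizer (GammaL k F) S := hβ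
  have := zpow_mem this i
  rw [← map_zpow] at this
  exact this

/-- The norm is injective on the components of a spread that is invariant under `Θ(β)`. -/
theorem norm_injOn_component [CharP k 2] (hK : Module.finrank k K = 3)
    (hF : Module.finrank K F = 2) {β : Fˣ}
    (hβ : orderOf β = (Nat.card K + 1) * (Nat.card k - 1)) {S : Set (Submodule k F)}
    (hS : IsSpread k S) (hβS : Theta k F β • S = S) {W : Submodule k F} (hW : W ∈ S) :
    Set.InjOn (fun v : F => v ^ (1 + Nat.card K)) W := by
  classical
  have : CharP F 2 := charP_of_injective_algebraMap (algebraMap k F).injective 2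
  have hfd : FiniteDimensional k K := FiniteDimensional.of_finrank_pos (by omega)
  have hfd' : FiniteDimensional K F := FiniteDimensional.of_finrank_pos (by omega)
  have hfinK : Finite K := Module.finite_of_finite k
  have hfinF : Finite F := Module.finite_of_finite K
  have hfd'' : FiniteDimensional k F := Module.Finite.of_finite
  have := Fintype.ofFinite F
  have hq : 2 ≤ Nat.card k := Finite.one_lt_card
  have hβ0 : orderOf β ≠ 0 := (orderOf_pos β).ne'
  intro v hv w hw hvw
  change v ^ (1 + Nat.card K) = w ^ (1 + Nat.card K) at hvw
  by_cases hw0 : w = 0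
  · rw [hw0, zero_pow (by omega)] at hvw
    rw [hw0]
    exact pow_eq_zero_iff (by omega) |>.1 hvw
  by_cases hv0 : v = 0
  · rw [hv0, zero_pow (by omega)] at hvw
    rw [hv0]
    exact (pow_eq_zero_iff (by omega) |>.1 hvw.symm).symm
  let a : Fˣ := Units.mk0 v hv0 / Units.mk0 w hw0
  have ha : (a : F) = v / w := by simp [a]
  have haN : (a : F) ^ (1 + Nat.card K) = 1 := by
    rw [ha, div_pow, hvw, div_self (pow_ne_zero _ hw0)]
  have hamem : a ∈ Subgroup.zpowers β := by
    apply mem_zpowers_of_pow_orderOf_eq_one hβ0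
    apply Units.ext
    rw [hβ, Units.val_pow_eq_pow_val, pow_mul, add_comm (Nat.card K), haN, one_pow, Units.val_one]
  -- `Θ(a)` preserves the spread and maps the point `w` of `W` to the point `v` of `W`.
  have haW : Theta k F a • W = W := by
    refine hS.eq_of_mem ?_ hW hv0 (mem_Theta_smul.2 ⟨w, hw, ?_⟩) hv
    · have := Set.smul_mem_smul_set (a := Theta k F a) hW
      rwa [Theta_smul_spread hβS hamem] at this
    · rw [ha, div_mul_cancel₀ _ hw0]
  have hmem : ∀ x : F, x ∈ W ↔ (a : F) * x ∈ W := fun x => by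
    constructor
    · intro hx
      rw [← haW]
      exact mem_Theta_smul.2 ⟨x, hx, rfl⟩
    · intro hx
      rw [← haW] at hx
      obtain ⟨y, hy, hyx⟩ := mem_Theta_smul.1 hx
      rwa [← mul_left_cancel₀ a.ne_zero hyx]
  have hfW : Module.finrank k W = 3 := by
    have := hS.1 W hW
    rw [← Module.finrank_mul_finrank k K F, hK, hF] at this
    omega
  let Wf : Finset F := Finset.univ.filter (fun x => x ∈ W)
  have hWf : Wf.card = Nat.card K := by
    rw [Module.natCard_eq_pow_finrank (K := k) (V := K), hK, ← hfW,
      ← Module.natCard_eq_pow_finrank (K := k) (V := W), Nat.card_eq_fintype_card]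
    exact (Fintype.card_subtype _).symm
  have h0 : (0 : F) ∈ Wf := by simp [Wf]
  -- The product over the `Q - 1` nonzero elements of `W` gives `a ^ (Q - 1) = 1`. Together with `a
  -- ^ (Q + 1) = 1` this yields `a² = 1`, hence `a = 1`.
  have hprod : ∏ x ∈ Wf.erase 0, x = ∏ x ∈ Wf.erase 0, (a : F) * x := by
    symm
    refine Finset.prod_bij (fun x _ => (a : F) * x) ?_ ?_ ?_ ?_
    · intro x hx
      simp only [Finset.mem_erase, Wf, Finset.mem_filter, Finset.mem_univ, true_and] at hx ⊢
      exact ⟨mul_ne_zero a.ne_zero hx.1, (hmem x).1 hx.2⟩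
    · intro x _ y _ h
      exact mul_left_cancel₀ a.ne_zero h
    · intro y hy
      simp only [Finset.mem_erase, Wf, Finset.mem_filter, Finset.mem_univ, true_and] at hy
      have e : (a : F) * ((a⁻¹ : Fˣ) * y) = y := by rw [← mul_assoc, Units.mul_inv, one_mul]
      refine ⟨(a⁻¹ : Fˣ) * y, ?_, e⟩
      simp only [Finset.mem_erase, Wf, Finset.mem_filter, Finset.mem_univ, true_and]
      exact ⟨mul_ne_zero (Units.ne_zero _) hy.1, by rw [hmem, e]; exact hy.2⟩
    · intro x _
      rfl
  rw [Finset.prod_mul_distrib, Finset.prod_const, Finset.card_erase_of_mem h0, hWf] at hprod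
  have haQ : (a : F) ^ (Nat.card K - 1) = 1 := by
    have hne : ∏ x ∈ Wf.erase 0, x ≠ 0 := Finset.prod_ne_zero_iff.2 fun x hx =>
      (Finset.mem_erase.1 hx).1
    exact mul_right_cancel₀ hne (hprod.symm.trans (one_mul _).symm)
  have ha1 : (a : F) = 1 := by
    apply eq_of_sq_eq_sq
    have hK1 : 1 ≤ Nat.card K := Nat.card_pos
    rw [one_pow, ← haN, show 1 + Nat.card K = (Nat.card K - 1) + 2 by omega, pow_add, haQ, one_mul]
  rw [ha, div_eq_one_iff_eq hw0] at ha1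
  exact ha1

omit [IsScalarTower k K F] in
/-- A spread that is invariant under `Θ(β)` and has a component `d K` consists of `K`-subspaces. -/
theorem component_smul_mem [CharP k 2] (hK : Module.finrank k K = 3)
    (hF : Module.finrank K F = 2) {β : Fˣ}
    (hβ : orderOf β = (Nat.card K + 1) * (Nat.card k - 1)) {S : Set (Submodule k F)}
    (hS : IsSpread k S) (hβS : Theta k F β • S = S) {U : Submodule k F} (hU : U ∈ S) {d : F}
    (hd : d ≠ 0) (hdU : ∀ x : K, d * algebraMap K F x ∈ U) {W : Submodule k F} (hW : W ∈ S) {v : F}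
    (hv : v ∈ W) (x : K) : algebraMap K F x * v ∈ W := by
  have : CharP K 2 := charP_of_injective_algebraMap (algebraMap k K).injective 2
  have hfd : FiniteDimensional k K := FiniteDimensional.of_finrank_pos (by omega)
  have hfd' : FiniteDimensional K F := FiniteDimensional.of_finrank_pos (by omega)
  have hfinK : Finite K := Module.finite_of_finite k
  have hfinF : Finite F := Module.finite_of_finite K
  by_cases hv0 : v = 0
  · rw [hv0, mul_zero]
    exact W.zero_mem
  obtain ⟨σ, hσ, hσ2, hσfix⟩ := exists_conjugation hF
  obtain ⟨y, hy⟩ : (v / d) ^ (1 + Nat.card K) ∈ Set.range (algebraMap K F) := by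
    rw [← hσfix, pow_add, pow_one, ← hσ, map_mul, hσ2, mul_comm]
  -- The norm on `K` is squaring, so `v / d` has the norm of some `r ∈ K`. Thus `v` lies in `a d K`
  -- with `a` of norm one, and this is a component.
  obtain ⟨r, rfl⟩ := exists_sq_eq y
  have hr : algebraMap K F r ^ (1 + Nat.card K) = (v / d) ^ (1 + Nat.card K) := by
    rw [← hy, pow_add, pow_one, pow_card_eq_self_iff.2 ⟨_, rfl⟩, map_pow, pow_two]
  have hr0 : algebraMap K F r ≠ 0 := by
    intro h0
    rw [h0, zero_pow (by omega)] at hr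
    exact pow_ne_zero _ (div_ne_zero hv0 hd) hr.symm
  let a : Fˣ := Units.mk0 (v / d) (div_ne_zero hv0 hd) / Units.mk0 _ hr0
  have ha : (a : F) = v / d / algebraMap K F r := by simp [a]
  have hamem : a ∈ Subgroup.zpowers β := by
    apply mem_zpowers_of_pow_orderOf_eq_one (orderOf_pos β).ne'
    apply Units.ext
    rw [hβ, Units.val_pow_eq_pow_val, pow_mul, add_comm (Nat.card K), ha, div_pow, hr,
      div_self (pow_ne_zero _ (div_ne_zero hv0 hd)), one_pow, Units.val_one]
  have haU : Theta k F a • U ∈ S := by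
    have := Set.smul_mem_smul_set (a := Theta k F a) hU
    rwa [Theta_smul_spread hβS hamem] at this
  have hWU : W = Theta k F a • U := by
    refine hS.eq_of_mem hW haU hv0 hv (mem_Theta_smul.2 ⟨_, hdU r, ?_⟩)
    rw [ha]
    field_simp
  rw [hWU]
  refine mem_Theta_smul.2 ⟨_, hdU (r * x), ?_⟩
  rw [ha, map_mul]
  field_simp

omit [IsScalarTower k K F] in
/-- A subspace of half the dimension has a translate under the Singer group that meets `K`
trivially. -/
theorem exists_Theta_disjoint (hK : Module.finrank k K = 3) (hF : Module.finrank K F = 2)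
    {W : Submodule k F} (hW : Module.finrank k W = 3) :
    ∃ a : Fˣ, ∀ x : K, algebraMap K F x ∈ Theta k F a • W → x = 0 := by
  have hfd : FiniteDimensional k K := FiniteDimensional.of_finrank_pos (by omega)
  have hfd' : FiniteDimensional K F := FiniteDimensional.of_finrank_pos (by omega)
  have hfinK : Finite K := Module.finite_of_finite k
  have hfinF : Finite F := Module.finite_of_finite K
  have hfd'' : FiniteDimensional k F := Module.Finite.of_finite
  by_contra hno
  push Not at hno
  -- A pair `(w, x)` with `a w = x ≠ 0` determines `a = x / w`. If every multiple of `W` met `K`,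
  -- this would give an injection `F → W × K` between sets of equal size, but `(0, 1)` is never
  -- attained.
  have hex : ∀ a : F, ∃ p : W × K, (a = 0 → p = 0) ∧ (a ≠ 0 → p.2 ≠ 0) ∧
      a * p.1 = algebraMap K F p.2 := by
    intro a
    by_cases ha : a = 0
    · exact ⟨0, fun _ => rfl, fun h => absurd ha h, by simp⟩
    · obtain ⟨x, hx, hx0⟩ := hno (Units.mk0 a ha)
      obtain ⟨w, hw, hwx⟩ := mem_Theta_smul.1 hx
      exact ⟨(⟨w, hw⟩, x), fun h => absurd h ha, fun _ => hx0, hwx⟩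
  choose f hf0 hf1 hf using hex
  have hinj : Function.Injective f := by
    intro a b hab
    by_cases ha : a = 0
    · by_contra hne
      have hb : b ≠ 0 := fun hb => hne (ha.trans hb.symm)
      exact hf1 b hb (by rw [← hab, hf0 a ha]; rfl)
    · have h1 := hf a
      have h2 := hf b
      rw [← hab, ← h1] at h2
      refine (mul_right_cancel₀ ?_ h2).symm
      intro h0
      rw [h0, mul_zero, eq_comm, map_eq_zero] at h1
      exact hf1 a ha h1
  have hcard : Nat.card F = Nat.card (W × K) := by
    rw [Nat.card_prod, Module.natCard_eq_pow_finrank (K := k) (V := W), hW, ← hK,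
      ← Module.natCard_eq_pow_finrank (K := k) (V := K), Module.natCard_eq_pow_finrank (K := K) (V := F),
      hF, pow_two]
  obtain ⟨a, ha⟩ := ((Nat.bijective_iff_injective_and_card f).2 ⟨hinj, hcard⟩).2 (0, 1)
  have := hf a
  rw [ha] at this
  simp at this

end SingerInvariant

end FlagSpread

namespace FlagSpread

/-! ### Linear maps of the cubic extension as Frobenius polynomials. -/

section LinearMaps

variable {k K : Type*} [Field k] [Finite k] [Field K] [Algebra k K]

/-- The linear map `x ↦ a x + b φ(x) + c φ²(x)`. -/
def frobeniusPolynomial (φ : K ≃ₐ[k] K) (p : K × K × K) : K →ₗ[k] K :=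
  LinearMap.mulLeft k p.1 + LinearMap.mulLeft k p.2.1 ∘ₗ φ.toLinearMap +
    LinearMap.mulLeft k p.2.2 ∘ₗ φ.toLinearMap ∘ₗ φ.toLinearMap

-- Evaluation at `1`, `θ`, `θ²` gives a Vandermonde system with distinct nodes `θ`, `φ θ`, `φ² θ`.
omit [Finite k] in
theorem frobeniusPolynomial_injective {φ : K ≃ₐ[k] K} (hφ : ∀ x, φ (φ (φ x)) = x) {θ : K}
    (hθ : φ θ ≠ θ) : Function.Injective (frobeniusPolynomial φ) := by
  rintro ⟨a, b, c⟩ ⟨a', b', c'⟩ h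
  have h' : ∀ x, a * x + b * φ x + c * φ (φ x) = a' * x + b' * φ x + c' * φ (φ x) := fun x =>
    LinearMap.congr_fun h x
  have h1 := h' 1
  have h2 := h' θ
  have h3 := h' (θ * θ)
  simp only [map_one, map_mul] at h1 h2 h3
  have hθ2 : φ (φ θ) - θ ≠ 0 := fun h0 => hθ (by
    have := congrArg φ (sub_eq_zero.1 h0)
    rw [hφ] at this
    exact this.symm)
  have hθ3 : φ (φ θ) - φ θ ≠ 0 := fun h0 => hθ (φ.injective (sub_eq_zero.1 h0))
  have hc : c = c' := by
    refine sub_eq_zero.1 ((mul_eq_zero.1 (?_ : (c - c') * ((φ (φ θ) - θ) * (φ (φ θ) - φ θ)) = 0)).resolve_right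
      (mul_ne_zero hθ2 hθ3))
    linear_combination h3 - (θ + φ θ) * h2 + θ * φ θ * h1
  subst hc
  have hb : b = b' := by
    refine sub_eq_zero.1 ((mul_eq_zero.1 (?_ : (b - b') * (φ θ - θ) = 0)).resolve_right
      (sub_ne_zero.2 hθ))
    linear_combination h2 - θ * h1
  subst hb
  have ha : a = a' := by linear_combination h1
  rw [ha]

/-- Every `k`-linear map of a cubic extension is a reduced `q`-polynomial. -/
theorem exists_eq_frobenius (hK : Module.finrank k K = 3) {φ : K ≃ₐ[k] K}
    (hφ : ∀ x, φ (φ (φ x)) = x) {θ : K} (hθ : φ θ ≠ θ) (l : K →ₗ[k] K) :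
    ∃ a b c : K, ∀ x, l x = a * x + (b * φ x + c * φ (φ x)) := by
  have hfd : FiniteDimensional k K := FiniteDimensional.of_finrank_pos (by omega)
  have hfinK : Finite K := Module.finite_of_finite k
  have : Finite (K →ₗ[k] K) := Module.finite_of_finite k
  have hcard : Nat.card (K × K × K) = Nat.card (K →ₗ[k] K) := by
    rw [Nat.card_prod, Nat.card_prod, Module.natCard_eq_pow_finrank (K := k) (V := K),
      Module.natCard_eq_pow_finrank (K := k) (V := K →ₗ[k] K), Module.finrank_linearMap, hK]
    ring
  obtain ⟨⟨a, b, c⟩, h⟩ := ((Nat.bijective_iff_injective_and_card _).2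
    ⟨frobeniusPolynomial_injective hφ hθ, hcard⟩).2 l
  refine ⟨a, b, c, fun x => ?_⟩
  rw [← h, ← add_assoc]
  rfl

end LinearMaps

/-! ### The kernel condition and graphs of linear maps. -/

section TypeC

variable {k K F : Type*} [Field k] [Finite k] [Field K] [Field F] [Algebra k K] [Algebra K F]
  [Algebra k F] [IsScalarTower k K F]

omit [Finite k] in
/-- A multiplication that fixes all components of a spread with kernel `k` is a scalar. -/
theorem mem_range_of_kernel_eq {S : Set (Submodule k F)}
    (hS : kernel S = (Module.toAddMonoidEnd k F).range) {g : GammaL k F} {d : F}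
    (hd : ∀ W ∈ g • S, ∀ v ∈ W, d * v ∈ W) : d ∈ Set.range (algebraMap k F) := by
  obtain ⟨σ, hσ⟩ := g.2.2
  -- The conjugate under `g` of multiplication by `d` lies in the kernel of `S`, so it is a scalar
  -- `c`; evaluation at `g⁻¹(1)` gives `d = σ c`.
  let f : AddMonoid.End F :=
    AddMonoidHom.mk' (fun v => (g : Equiv.Perm F).symm (d * (g : Equiv.Perm F) v)) fun u v => by
      apply (g : Equiv.Perm F).injective
      rw [g.2.1, g.2.1]
      simp only [Equiv.apply_symm_apply]
      ring
  have hf : f ∈ kernel S := by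
    intro W hW w hw
    obtain ⟨w', hw', h⟩ := mem_GammaL_smul.1 (hd (g • W) (Set.smul_mem_smul_set hW) _
      (mem_GammaL_smul.2 ⟨w, hw, rfl⟩))
    change (g : Equiv.Perm F).symm (d * (g : Equiv.Perm F) w) ∈ W
    rwa [← h, Equiv.symm_apply_apply]
  rw [hS] at hf
  obtain ⟨c, hc⟩ := hf
  have h1 : c • (g : Equiv.Perm F).symm 1 =
      (g : Equiv.Perm F).symm (d * (g : Equiv.Perm F) ((g : Equiv.Perm F).symm 1)) :=
    DFunLike.congr_fun hc ((g : Equiv.Perm F).symm 1)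
  have h2 := congrArg (g : Equiv.Perm F) h1
  rw [hσ] at h2
  simp only [Equiv.apply_symm_apply, mul_one] at h2
  exact ⟨σ c, by rw [← h2, Algebra.smul_def, mul_one]⟩

/-- A subspace of half the dimension that meets `K` trivially is the graph of a linear map. -/
theorem exists_linear_graph (hK : Module.finrank k K = 3) (hF : Module.finrank K F = 2) {δ : F}
    (hδ : δ ∉ Set.range (algebraMap K F)) {U : Submodule k F} (hU : Module.finrank k U = 3)
    (hUK : ∀ x : K, algebraMap K F x ∈ U → x = 0) :
    ∃ l : K →ₗ[k] K, ∀ x, algebraMap K F (l x) + δ * algebraMap K F x ∈ U := by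
  have hfd : FiniteDimensional k K := FiniteDimensional.of_finrank_pos (by omega)
  have hfd' : FiniteDimensional K F := FiniteDimensional.of_finrank_pos (by omega)
  have hfd'' : FiniteDimensional k F := Module.Finite.trans K F
  let i : K →ₗ[k] F := (IsScalarTower.toAlgHom k K F).toLinearMap
  have hi : ∀ x, i x = algebraMap K F x := fun _ => rfl
  let T : K × K →ₗ[k] F := i ∘ₗ LinearMap.fst k K K +
    LinearMap.mulLeft k δ ∘ₗ i ∘ₗ LinearMap.snd k K K
  have hT : ∀ x y, T (x, y) = algebraMap K F x + δ * algebraMap K F y := fun _ _ => rfl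
  have hTinj : Function.Injective T := by
    rw [injective_iff_map_eq_zero]
    rintro ⟨x, y⟩ h
    rw [hT] at h
    have hy : y = 0 := by
      by_contra hy
      refine hδ ⟨-x / y, ?_⟩
      rw [map_div₀, map_neg, div_eq_iff ((map_ne_zero _).2 hy)]
      linear_combination -h
    subst hy
    rw [map_zero, mul_zero, add_zero, map_eq_zero] at h
    rw [h]
    rfl
  let e := LinearEquiv.ofInjectiveOfFinrankEq T hTinj (by
    rw [Module.finrank_prod, ← Module.finrank_mul_finrank k K F, hK, hF])
  have he : ∀ p, e p = T p := fun _ => rfl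
  -- The second coordinate for `F = K ⊕ δ K`; its kernel on `U` is the trivial intersection with
  -- `K`.
  let s : U →ₗ[k] K := LinearMap.snd k K K ∘ₗ e.symm.toLinearMap ∘ₗ U.subtype
  have hs : Function.Injective s := by
    rw [injective_iff_map_eq_zero]
    intro u hu
    have h := he (e.symm u)
    rw [LinearEquiv.apply_symm_apply] at h
    change (e.symm u).2 = 0 at hu
    rw [← Prod.mk.eta (p := e.symm (u : F)), hT, hu, map_zero, mul_zero, add_zero] at h
    have h0 := hUK _ (h ▸ u.2)
    rw [h0, map_zero] at h
    exact Subtype.ext h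
  let e' := LinearEquiv.ofInjectiveOfFinrankEq s hs (by rw [hU, hK])
  have he' : ∀ u, e' u = s u := fun _ => rfl
  refine ⟨LinearMap.fst k K K ∘ₗ e.symm.toLinearMap ∘ₗ U.subtype ∘ₗ e'.symm.toLinearMap,
    fun x => ?_⟩
  have h1 : (e.symm (e'.symm x : U)).2 = x := by
    have := he' (e'.symm x)
    rw [LinearEquiv.apply_symm_apply] at this
    exact this.symm
  change algebraMap K F (e.symm (e'.symm x : U)).1 + _ ∈ U
  have h2 := hT (e.symm (e'.symm x : U)).1 (e.symm (e'.symm x : U)).2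
  rw [h1] at h2
  rw [← h2]
  have h3 : T ((e.symm (e'.symm x : U)).1, x) = (e'.symm x : U) := by
    have := he (e.symm (e'.symm x : U))
    rw [LinearEquiv.apply_symm_apply, ← Prod.mk.eta (p := e.symm ((e'.symm x : U) : F)), h1] at this
    exact this.symm
  rw [h3]
  exact (e'.symm x).2

end TypeC

end FlagSpread

namespace FlagSpread

/-! ### Classification of the spreads of type `𝒞`. -/

section Classification

variable {k K F : Type*} [Field k] [Finite k] [Field K] [Field F] [Algebra k K] [Algebra K F]
  [Algebra k F] [IsScalarTower k K F]

omit [Finite k] in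
theorem Theta_smul_smul_spread {S : Set (Submodule k F)} {β : Fˣ} (hβ : Theta k F β • S = S)
    (a : Fˣ) : Theta k F β • Theta k F a • S = Theta k F a • S := by
  rw [← mul_smul, ← map_mul, mul_comm, map_mul, mul_smul, hβ]

/-- A spread that is invariant under `Θ(β)` and has the image of `x ↦ Tr(x) + δ x` as a component
is the orbit of this image. -/
theorem eq_traceOrbit [CharP k 2] (hK : Module.finrank k K = 3)
    (hF : Module.finrank K F = 2) {β : Fˣ}
    (hβ : orderOf β = (Nat.card K + 1) * (Nat.card k - 1)) {S : Set (Submodule k F)}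
    (hS : IsSpread k S) (hβS : Theta k F β • S = S) {δ : F}
    (hδ : δ ∉ Set.range (algebraMap K F)) {U : Submodule k F} (hU : U ∈ S)
    (hδU : ∀ x : K, traceMap k δ x ∈ U) :
    (∃ c : k, c ≠ 0 ∧ δ⁻¹ + δ⁻¹ ^ Nat.card K = algebraMap k F c) ∧ traceOrbit k K β δ = S := by
  have hfd : FiniteDimensional k K := FiniteDimensional.of_finrank_pos (by omega)
  have hfd' : FiniteDimensional K F := FiniteDimensional.of_finrank_pos (by omega)
  have hfd'' : FiniteDimensional k F := Module.Finite.trans K F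
  have hFk : Module.finrank k F = 6 := by rw [← Module.finrank_mul_finrank k K F, hK, hF]
  have hinj0 : Function.Injective (traceMap (K := K) k δ) := by
    rw [injective_iff_map_eq_zero]
    intro x hx
    change algebraMap k F (Algebra.trace k K x) + δ * algebraMap K F x = 0 at hx
    by_contra hx0
    refine hδ ⟨-algebraMap k K (Algebra.trace k K x) / x, ?_⟩
    rw [map_div₀, map_neg, ← IsScalarTower.algebraMap_apply, div_eq_iff ((map_ne_zero _).2 hx0)]
    linear_combination -hx
  have hinj : Function.Injective (fun x : K => (algebraMap k F (Algebra.trace k K x) +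
      δ * algebraMap K F x) ^ (1 + Nat.card K)) := fun x y hxy =>
    hinj0 (norm_injOn_component hK hF hβ hS hβS hU (hδU x) (hδU y) hxy)
  refine ⟨(trace_injective_iff hK hF hδ).1 hinj, ?_⟩
  have hrange : LinearMap.range (traceMap (K := K) k δ) = U := by
    refine Submodule.eq_of_le_of_finrank_eq ?_ ?_
    · rintro _ ⟨x, rfl⟩
      exact hδU x
    · have := hS.1 U hU
      rw [LinearMap.finrank_range_of_inj hinj0, hK]
      omega
  refine hS.eq_of_subset (isSpread_traceOrbit hK hF hβ hinj) ?_ (by omega)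
  intro W hW
  obtain ⟨a, ha, rfl⟩ := mem_orbit_Theta_iff.1 hW
  rw [hrange, ← Theta_smul_spread hβS ha]
  exact Set.smul_mem_smul_set hU

/-- A spread of type `𝒞` is isomorphic to the orbit of the image of a map `x ↦ Tr(x) + δ x`. -/
theorem IsTypeC.exists_traceOrbit [CharP k 2] (hK : Module.finrank k K = 3)
    (hF : Module.finrank K F = 2) {β : Fˣ}
    (hβ : orderOf β = (Nat.card K + 1) * (Nat.card k - 1)) {S : Set (Submodule k F)}
    (hS : IsTypeC 3 S) :
    ∃ δ : F, δ ∉ Set.range (algebraMap K F) ∧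
      (∃ c : k, c ≠ 0 ∧ δ⁻¹ + δ⁻¹ ^ Nat.card K = algebraMap k F c) ∧
      AreIsomorphic S (traceOrbit k K β δ) := by
  have hfd : FiniteDimensional k K := FiniteDimensional.of_finrank_pos (by omega)
  have hfd' : FiniteDimensional K F := FiniteDimensional.of_finrank_pos (by omega)
  have hfd'' : FiniteDimensional k F := Module.Finite.trans K F
  have hfinK : Finite K := Module.finite_of_finite k
  have hfinF : Finite F := Module.finite_of_finite K
  have hFk : Module.finrank k F = 6 := by rw [← Module.finrank_mul_finrank k K F, hK, hF]
  obtain ⟨φ, -, hφ, hfix, ⟨θ, hθ⟩, htr⟩ := exists_frobenius hK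
  obtain ⟨-, hSs, hker, -, S', ⟨g, rfl⟩, -, hcard⟩ := hS
  have hβg : Theta k F β • g • S = g • S := Theta_mem_of_card (H := autGroup (g • S)) (by
    rw [hcard, hβ, Module.natCard_eq_pow_finrank (K := k) (V := K), hK])
  obtain ⟨W, ⟨hW, -⟩, -⟩ := (hSs.smul g).2 1 one_ne_zero
  have hW3 : Module.finrank k W = 3 := by
    have := (hSs.smul g).1 W hW
    omega
  -- The Singer group is commutative, so multiplying the spread by `a` keeps it invariant under
  -- `Θ(β)`. The component `U` then meets `K` trivially and is a graph.
  obtain ⟨a, ha⟩ := exists_Theta_disjoint hK hF hW3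
  have hS1 := (hSs.smul g).smul (Theta k F a)
  have hβ1 := Theta_smul_smul_spread hβg a
  have hU := Set.smul_mem_smul_set (a := Theta k F a) hW
  set U := Theta k F a • W with hUdef
  have hU3 : Module.finrank k U = 3 := by rw [hUdef, finrank_Theta_smul, hW3]
  obtain ⟨δ₀, hδ₀⟩ : ∃ δ₀ : F, δ₀ ∉ Set.range (algebraMap K F) := by
    by_contra hno
    push Not at hno
    have h1 : Nat.card F ≤ Nat.card K := Nat.card_le_card_of_surjective (algebraMap K F) hno
    rw [Module.natCard_eq_pow_finrank (K := K) (V := F), hF] at h1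
    exact absurd h1 (not_le.2 (lt_self_pow₀ Finite.one_lt_card (by norm_num)))
  obtain ⟨l, hl⟩ := exists_linear_graph hK hF hδ₀ hU3 ha
  obtain ⟨a₀, b, c, hlabc⟩ := exists_eq_frobenius hK hφ hθ l
  set δ := δ₀ + algebraMap K F a₀ with hδdef
  have hδ : δ ∉ Set.range (algebraMap K F) := by
    rintro ⟨y, hy⟩
    exact hδ₀ ⟨y - a₀, by rw [map_sub, hy, hδdef, add_sub_cancel_right]⟩
  have hδU : ∀ x : K, algebraMap K F (b * φ x + c * φ (φ x)) + δ * algebraMap K F x ∈ U := by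
    intro x
    convert hl x using 1
    rw [hlabc, hδdef, map_add _ (a₀ * x), map_mul _ a₀]
    ring
  have hne : ∀ {d : F}, d ∉ Set.range (algebraMap K F) → d ≠ 0 := by
    rintro _ hd rfl
    exact hd ⟨0, map_zero _⟩
  -- Otherwise `U = δ K`, all components are `K`-subspaces, and multiplication by `θ ∉ k` preserves
  -- them, against the kernel being `k`.
  have hbc : ¬(b = 0 ∧ c = 0) := by
    rintro ⟨rfl, rfl⟩
    have hδU' : ∀ x : K, δ * algebraMap K F x ∈ U := fun x => by simpa using hδU x
    obtain ⟨r, hr⟩ : algebraMap K F θ ∈ Set.range (algebraMap k F) := by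
      refine mem_range_of_kernel_eq (g := Theta k F a * g) hker fun W hW v hv => ?_
      rw [mul_smul] at hW
      exact component_smul_mem hK hF hβ hS1 hβ1 hU (hne hδ) hδU' hW hv θ
    rw [IsScalarTower.algebraMap_apply k K F] at hr
    exact hθ (by rw [← (algebraMap K F).injective hr, φ.commutes])
  have hinj : Function.Injective (fun x : K => (algebraMap K F (b * φ x + c * φ (φ x)) +
      δ * algebraMap K F x) ^ (1 + Nat.card K)) := by
    intro x y hxy
    have h := norm_injOn_component hK hF hβ hS1 hβ1 hU (hδU x) (hδU y) hxy
    by_contra hne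
    refine hδ ⟨-(b * φ (x - y) + c * φ (φ (x - y))) / (x - y), ?_⟩
    rw [map_div₀, div_eq_iff ((map_ne_zero _).2 (sub_ne_zero.2 hne))]
    simp only [map_sub, map_neg, map_add, map_mul] at h ⊢
    linear_combination -h
  obtain ⟨hc, u, hu, hcu⟩ := exists_ratio_of_injective hK hF hφ hfix hθ htr hbc hδ hinj
  have hφu : φ u ≠ 0 := (map_ne_zero φ).2 hu
  -- From `c φ²(u) = b u` follows `(u / c)(b φ(y) + c φ²(y)) = Tr (φ(u) y) - φ(u) y`. So
  -- multiplication by `u / c` and the substitution `x = φ(u) y` produce the trace map, and the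
  -- subtracted term becomes the `-1` in `ε`.
  have hm : algebraMap K F (u / c) ≠ 0 := (map_ne_zero _).2 (div_ne_zero hu hc)
  set m : Fˣ := Units.mk0 _ hm with hmdef
  have hm' : (m : F) = algebraMap K F (u / c) := rfl
  set ε := algebraMap K F (u / (c * φ u)) * δ - 1 with hεdef
  have hε : ε ∉ Set.range (algebraMap K F) := by
    rintro ⟨y, hy⟩
    refine hδ ⟨(y + 1) / (u / (c * φ u)), ?_⟩
    rw [map_div₀, map_add, hy, hεdef, map_one, sub_add_cancel, mul_div_cancel_left₀]
    exact (map_ne_zero _).2 (div_ne_zero hu (mul_ne_zero hc hφu))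
  have hεU : ∀ x : K, traceMap k ε x ∈ Theta k F m • U := by
    intro x
    obtain ⟨y, rfl⟩ := mul_left_surjective₀ hφu x
    refine mem_Theta_smul.2 ⟨_, hδU y, ?_⟩
    change _ = algebraMap k F (Algebra.trace k K (φ u * y)) + ε * algebraMap K F (φ u * y)
    rw [IsScalarTower.algebraMap_apply k K F, htr, hεdef, hm']
    have h1 : u / c * (b * φ y + c * φ (φ y)) = φ (φ u) * φ y + u * φ (φ y) := by
      field_simp
      linear_combination -φ y * hcu
    have h2 : u / c = u / (c * φ u) * φ u := by field_simp
    rw [mul_add, ← map_mul, h1]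
    rw [h2]
    simp only [map_add, map_mul, hφ]
    ring
  obtain ⟨hconst, hEq⟩ := eq_traceOrbit hK hF hβ (hS1.smul (Theta k F m))
    (Theta_smul_smul_spread hβ1 m) hε (Set.smul_mem_smul_set hU) hεU
  exact ⟨ε, hε, hconst, Theta k F m * (Theta k F a * g), by rw [hEq, mul_smul, mul_smul]⟩

end Classification

end FlagSpread
theorem mainTheorem3 {k K F : Type*} [Field k] [Finite k] [Field K] [Field F]
    [Algebra k K] [Algebra K F] [Algebra k F] [IsScalarTower k K F]
    (q : ℕ) (hq : Nat.card k = q) (heven : Even q)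
    (hK : Module.finrank k K = 3) (hF : Module.finrank K F = 2)
    (β : Fˣ) (hβ : orderOf β = (q ^ 3 + 1) * (q - 1)) :
    -- the case of the trace map
    (∀ δ : F, δ ∉ Set.range (algebraMap K F) →
      (Set.BijOn
          (fun x : K => (algebraMap k F (Algebra.trace k K x) + δ * algebraMap K F x) ^ (1 + q ^ 3))
          Set.univ (Set.range (algebraMap K F)) ↔
        ∃ c : k, c ≠ 0 ∧ δ⁻¹ + δ⁻¹ ^ q ^ 3 = algebraMap k F c)) ∧
    -- the case of a general monic reduced q-polynomial
    (∀ L : Polynomial K, L.Monic → L.natDegree ≤ q ^ 3 - 1 → FlagSpread.IsQPolynomial q L →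
      L ≠ Polynomial.X → ∀ δ : F, δ ∉ Set.range (algebraMap K F) →
      (Set.BijOn
          (fun x : K => (algebraMap K F (L.eval x) + δ * algebraMap K F x) ^ (1 + q ^ 3))
          Set.univ (Set.range (algebraMap K F)) ↔
        ∃ (δ' : F) (u : K), δ' ∉ Set.range (algebraMap K F) ∧ u ≠ 0 ∧
          (∀ x : K, algebraMap K F (L.eval x) + δ * algebraMap K F x =
            algebraMap K F u⁻¹ * algebraMap k F (Algebra.trace k K (u ^ q * x)) +
              δ' * algebraMap K F x) ∧
          ∃ c : k, c ≠ 0 ∧ δ'⁻¹ + δ'⁻¹ ^ q ^ 3 =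
            algebraMap K F (u ^ (1 - (q : ℤ))) * algebraMap k F c)) ∧
    -- the orbits in question are spreads
    (∀ δ : F, δ ∉ Set.range (algebraMap K F) →
      (∃ c : k, c ≠ 0 ∧ δ⁻¹ + δ⁻¹ ^ q ^ 3 = algebraMap k F c) →
      FlagSpread.IsSpread k (FlagSpread.traceOrbit k K β δ)) ∧
    -- the classification of the spreads of type 𝒞
    (∀ S : Set (Submodule k F), FlagSpread.IsTypeC 3 S →
      ∃ δ : F, δ ∉ Set.range (algebraMap K F) ∧
        (∃ c : k, c ≠ 0 ∧ δ⁻¹ + δ⁻¹ ^ q ^ 3 = algebraMap k F c) ∧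
        FlagSpread.AreIsomorphic S (FlagSpread.traceOrbit k K β δ)) := by
  subst hq
  have hfd : FiniteDimensional k K := FiniteDimensional.of_finrank_pos (by omega)
  have hfinK : Finite K := Module.finite_of_finite k
  have hcard : Nat.card k ^ 3 = Nat.card K := by
    rw [Module.natCard_eq_pow_finrank (K := k) (V := K), hK]
  have hchar : CharP k 2 := by
    have := Fintype.ofFinite k
    rw [Nat.card_eq_fintype_card] at heven
    exact ringChar.of_eq (FiniteField.even_card_iff_char_two.2 (Nat.even_iff.1 heven))
  rw [hcard] at hβ ⊢
  refine ⟨fun δ hδ => ?_, fun L hmonic hdeg hL hLX δ hδ => ?_, fun δ hδ hc => ?_, fun S hS => ?_⟩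
  · rw [FlagSpread.bijOn_norm_iff hF, FlagSpread.trace_injective_iff hK hF hδ]
  · rw [FlagSpread.bijOn_norm_iff hF]
    constructor
    · intro hinj
      obtain ⟨δ', u, hδ', hu, h⟩ := FlagSpread.exists_scaled_trace hK hF hmonic
        (by rwa [hcard]) hL hLX hδ hinj
      simp only [h] at hinj
      exact ⟨δ', u, hδ', hu, h, (FlagSpread.scaled_trace_injective_iff hK hF hδ' hu).1 hinj⟩
    · rintro ⟨δ', u, hδ', hu, h, hc⟩
      simp only [h]
      exact (FlagSpread.scaled_trace_injective_iff hK hF hδ' hu).2 hc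
  · exact FlagSpread.isSpread_traceOrbit hK hF hβ ((FlagSpread.trace_injective_iff hK hF hδ).2 hc)
  · exact hS.exists_traceOrbit hK hF hβ
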